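/- Let $\mathbb K$ be an algebraically closed field of arbitrary characteristic, let $n\ge 1$, and let $V$, $W$ be dual $\mathbb K$-vector spaces of dimension $n+1$, with $R=\operatorname{Sym}(V^*)$ and $S=\operatorname{Sym}(W^*)$ the coordinate rings of $\mathbb P^n=\mathbb P(V)$ and $\mathbb P(W)$. Let $Z\subset\mathbb P^n$ be a nonempty finite set of points and $\mathcal A_Z=\{p^\perp : p\in Z\}$ the dual hyperplane arrangement in $\mathbb P(W)$. "General" means: for all members of some nonempty Zariski open subset. *Splitting type.* Let $D(\mathcal A_Z)$ be the graded $S$-module of $\mathbb K$-derivations $\theta$ of $S$ with $\theta(I(H))\subseteq I(H)$ for all $H\in\mathcal A_Z$, graded by $\deg\theta=\deg\theta(\ell)$ for linear forms $\ell$, and let $D_0(\mathcal A_Z)=D(\mathcal A_Z)/S\theta_e$, where $\theta_e$ is the Euler derivation. The splitting type of $D_0(\mathcal A_Z)$ is the tuple $0\le a_1\le\dots\le a_n$ of integers such that $\widetilde{D_0(\mathcal A_Z)}|_L\cong\bigoplus_{i=1}^n\mathcal O_L(-a_i)$ for a general line $L\subset\mathbb P(W)$. *Modified expected number of conditions.*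 For an integer $d\ge 0$, let $$\operatorname{Ex.C}(Z,d)=\min\Big\{\sum_{i=0}^s(d\dim H_i+1)\ :\ H_0,\dots,H_s\subseteq\mathbb P^n\text{ nonempty linear subspaces with }Z\subseteq\bigcup_{i=0}^s H_i\Big\}.$$ *Very unexpected hypersurfaces.* For $X\subseteq\mathbb P^n$ let $I(X)\subseteq R$ be its homogeneous ideal, and write $[\,\cdot\,]_d$ for degree $d$ parts. Let $Q\subset\mathbb P^n$ denote a general linear subspace of codimension $2$ (empty if $n=1$), and read $I(Q)^{d-1}$ as $R$ if $d=0$. We say that $Z$ admits very unexpected hypersurfaces in degree $d$ if there is a subset $W'\subseteq Z$ such that (I) $[I(Z)\cap I(Q)^{d-1}]_d=[I(W')\cap I(Q)^{d-1}]_d$ for general $Q$; (II) for every irreducible closed subvariety $X\subseteq\mathbb P^n$, $|W'\cap X|\le\dim[I(Q)^{d-1}/(I(X)\cap I(Q)^{d-1})]_d$ for general $Q$ (how general may depend on $X$); (III) $\dim[R/I(W')]_d>\dim[I(Q)^{d-1}/(I(W')\cap I(Q)^{d-1})]_d$ for general $Q$. **Theorem.** Let $(a_1,\dots,a_n)$ be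 the splitting type of $D_0(\mathcal A_Z)$. Then for every integer $d\ge 0$, $$\sum_{i=1}^n\max\{0,d-a_i\}\ \ge\ nd+1-\operatorname{Ex.C}(Z,d),$$ and the inequality is strict if and only if $Z$ admits very unexpected hypersurfaces in degree $d$. -/

import Mathlib

open MvPolynomial

noncomputable section

namespace PointConfig

/-! Both `V` and the dual space `W` are `Fin (n + 1) → K`, paired by the dot product, and
`Sym (V^*)`, `Sym (W^*)` are the polynomial rings in the coordinates. Linear subspaces of a
projective space are given by vector subspaces; the projective dimension is the rank minus one. -/

section

variable {K : Type*} [Field K] {n : ℕ}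

/-! ### Linear subspaces, ideals, graded pieces -/

/-- The orthogonal `L^⊥` of a linear subspace under the pairing of `W` with `V`. -/
def perp (L : Submodule K (Fin (n + 1) → K)) : Submodule K (Fin (n + 1) → K) where
  carrier := {v | ∀ w ∈ L, w ⬝ᵥ v = 0}
  zero_mem' := fun w _ => dotProduct_zero w
  add_mem' := fun {a b} ha hb w hw => by rw [dotProduct_add, ha w hw, hb w hw, add_zero]
  smul_mem' := fun c a ha w hw => by rw [dotProduct_smul, ha w hw, smul_zero]

/-- The ideal `I(H)` of a linear subspace. -/
def linIdeal (H : Submodule K (Fin (n + 1) → K)) : Ideal (MvPolynomial (Fin (n + 1)) K) :=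
  vanishingIdeal K (H : Set (Fin (n + 1) → K))

/-- The ideal `I(X)` of a set of points of projective space: the polynomials that vanish on every
representative of every point of `X`. -/
def projIdeal (X : Set (Projectivization K (Fin (n + 1) → K))) :
    Ideal (MvPolynomial (Fin (n + 1)) K) :=
  vanishingIdeal K {v | ∃ p ∈ X, v ∈ p.submodule}

/-- The degree `d` part `[J]_d` of an ideal. -/
def piece (J : Ideal (MvPolynomial (Fin (n + 1)) K)) (d : ℕ) :
    Submodule K (MvPolynomial (Fin (n + 1)) K) :=
  J.restrictScalars K ⊓ homogeneousSubmodule (Fin (n + 1)) K d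

/-- `dim [J / (I ∩ J)]_d`, the number of conditions that `I` imposes on `[J]_d`. -/
def numConditions (J I : Ideal (MvPolynomial (Fin (n + 1)) K)) (d : ℕ) : ℕ :=
  Module.finrank K (piece J d ⧸ (piece (I ⊓ J) d).submoduleOf (piece J d))

/-! ### General lines and general subspaces of codimension two -/

/-- `P L` holds for a general line `L` of the projective space: there is a nonzero polynomial in
the coordinates of two vectors such that `P` holds for the span of any two independent vectors at
which that polynomial does not vanish. -/
def ForGeneralLine (P : Submodule K (Fin (n + 1) → K) → Prop) : Prop :=
  ∃ p : MvPolynomial (Fin 2 × Fin (n + 1)) K, p ≠ 0 ∧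
    ∀ u : Fin 2 → Fin (n + 1) → K, LinearIndependent K u →
      eval (fun ij => u ij.1 ij.2) p ≠ 0 → P (Submodule.span K (Set.range u))

/-- `P Q` holds for a general linear subspace `Q` of codimension two, that is, for the common zero
set `Q` of two general linear forms. -/
def ForGeneralCodimTwo (P : Submodule K (Fin (n + 1) → K) → Prop) : Prop :=
  ForGeneralLine (fun L => P (perp L))

/-! ### Derivations of hyperplane arrangements -/

/-- The module `D(𝓐)` of `𝓐`-derivations, the derivations `θ` of `S` such that `θ(I(H)) ⊆ I(H)` for
all `H ∈ 𝓐`. The free `S`-module `Der S` is identified with `Fin (n + 1) → S`, the vector `g`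
standing for the derivation `∑ g_i ∂/∂Y_i`, which is `mkDerivation K g`. -/
def derModule (𝓐 : Set (Submodule K (Fin (n + 1) → K))) :
    Submodule (MvPolynomial (Fin (n + 1)) K) (Fin (n + 1) → MvPolynomial (Fin (n + 1)) K) where
  carrier := {g | ∀ H ∈ 𝓐, ∀ f ∈ linIdeal H, mkDerivation K g f ∈ linIdeal H}
  zero_mem' := fun H _ f _ => by
    have h : mkDerivation K (0 : Fin (n + 1) → MvPolynomial (Fin (n + 1)) K) = 0 :=
      derivation_ext fun i => by simp
    rw [h]
    exact (linIdeal H).zero_mem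
  add_mem' := fun {g₁ g₂} h₁ h₂ H hH f hf => by
    have h : mkDerivation K (g₁ + g₂) = mkDerivation K g₁ + mkDerivation K g₂ :=
      derivation_ext fun i => by simp
    rw [h]
    exact (linIdeal H).add_mem (h₁ H hH f hf) (h₂ H hH f hf)
  smul_mem' := fun c g hg H hH f hf => by
    have h : mkDerivation K (c • g) = c • mkDerivation K g :=
      derivation_ext fun i => by simp
    rw [h]
    exact (linIdeal H).mul_mem_left c (hg H hH f hf)

/-- The Euler derivation `∑ Y_i ∂/∂Y_i`. -/
def eulerDer (K : Type*) [Field K] (n : ℕ) : Fin (n + 1) → MvPolynomial (Fin (n + 1)) K :=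
  fun i => X i

/-- The reduced module of derivations `D_0(𝓐) = D(𝓐) / S θ_e`. -/
abbrev RedDerModule (𝓐 : Set (Submodule K (Fin (n + 1) → K))) :=
  derModule 𝓐 ⧸
    (Submodule.span (MvPolynomial (Fin (n + 1)) K) {eulerDer K n}).submoduleOf (derModule 𝓐)

/-- The graded `S / I(L)`-module `D_0(𝓐) / I(L) D_0(𝓐)`; the sheaf on the line `L` associated with
it is the restriction to `L` of the sheaf associated with `D_0(𝓐)`. -/
abbrev RedDerRestrict (𝓐 : Set (Submodule K (Fin (n + 1) → K)))
    (L : Submodule K (Fin (n + 1) → K)) :=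
  RedDerModule 𝓐 ⧸
    (linIdeal L • (⊤ : Submodule (MvPolynomial (Fin (n + 1)) K) (RedDerModule 𝓐)))

/-- The degree `m` part of `D_0(𝓐) / I(L) D_0(𝓐)`, for the polynomial degree: it consists of the
classes of the derivations that send every coordinate to a form of degree `m`. -/
def redDerPiece (𝓐 : Set (Submodule K (Fin (n + 1) → K))) (L : Submodule K (Fin (n + 1) → K))
    (m : ℕ) : Set (RedDerRestrict 𝓐 L) :=
  {x | ∃ θ : derModule 𝓐, (∀ i, (θ.1 i).IsHomogeneous m) ∧
    x = Submodule.Quotient.mk (Submodule.Quotient.mk θ)}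

/-- The degree `m` part of the graded free module `⨁ i, (S / I(L))(-a i)`. -/
def freePiece (L : Submodule K (Fin (n + 1) → K)) (a : Fin n → ℕ) (m : ℕ) :
    Set (Fin n → MvPolynomial (Fin (n + 1)) K ⧸ linIdeal L) :=
  {g | ∀ i, (a i ≤ m → ∃ f : MvPolynomial (Fin (n + 1)) K, f.IsHomogeneous (m - a i) ∧
      g i = Ideal.Quotient.mk (linIdeal L) f) ∧ (m < a i → g i = 0)}

/-- The restriction to the line `L` of the sheaf associated with `D_0(𝓐)` is isomorphic to
`⨁ i, 𝒪_L(-a i)`: there is a degree-preserving linear map from `D_0(𝓐) / I(L) D_0(𝓐)` to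
`⨁ i, (S / I(L))(-a i)` that is bijective in all large degrees. (Over the two-variable polynomial
ring `S / I(L)` the free module is the full module of sections of its sheaf, so that isomorphisms
of the two sheaves are the same as such maps.) -/
def SplitsOnLine (𝓐 : Set (Submodule K (Fin (n + 1) → K))) (L : Submodule K (Fin (n + 1) → K))
    (a : Fin n → ℕ) : Prop :=
  ∃ φ : RedDerRestrict 𝓐 L →ₗ[MvPolynomial (Fin (n + 1)) K]
      (Fin n → MvPolynomial (Fin (n + 1)) K ⧸ linIdeal L),
    (∀ m, Set.MapsTo φ (redDerPiece 𝓐 L m) (freePiece L a m)) ∧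
    ∃ m₀, ∀ m, m₀ ≤ m → Set.BijOn φ (redDerPiece 𝓐 L m) (freePiece L a m)

/-- `a` is the splitting type of `D_0(𝓐)`. -/
def IsSplittingType (𝓐 : Set (Submodule K (Fin (n + 1) → K))) (a : Fin n → ℕ) : Prop :=
  Monotone a ∧ ForGeneralLine (fun L => SplitsOnLine 𝓐 L a)

/-- The arrangement `𝓐_Z` of the hyperplanes dual to the points of `Z`. -/
def dualArrangement (Z : Finset (Projectivization K (Fin (n + 1) → K))) :
    Set (Submodule K (Fin (n + 1) → K)) :=
  {H | ∃ p ∈ Z, H = perp p.submodule}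

/-! ### Very unexpected hypersurfaces -/

/-- Zariski closed subsets of projective space. -/
def IsProjClosed (X : Set (Projectivization K (Fin (n + 1) → K))) : Prop :=
  ∃ F : Set (MvPolynomial (Fin (n + 1)) K), (∀ f ∈ F, ∃ k, f.IsHomogeneous k) ∧
    X = {p | ∀ f ∈ F, ∀ v ∈ p.submodule, eval v f = 0}

/-- Irreducible closed subvarieties of projective space. -/
def IsIrredSubvariety (X : Set (Projectivization K (Fin (n + 1) → K))) : Prop :=
  IsProjClosed X ∧ X.Nonempty ∧
    ∀ Y₁ Y₂ : Set (Projectivization K (Fin (n + 1) → K)),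
      IsProjClosed Y₁ → IsProjClosed Y₂ → X ⊆ Y₁ ∪ Y₂ → X ⊆ Y₁ ∨ X ⊆ Y₂

/-- `Z` admits very unexpected `mQ`-hypersurfaces in degree `d`, for `Q` a general linear subspace
of codimension two. In the second condition the subvariety `X` is fixed before `Q` is chosen. -/
def AdmitsVeryUnexpectedMult (Z : Finset (Projectivization K (Fin (n + 1) → K))) (m d : ℕ) :
    Prop :=
  ∃ W : Finset (Projectivization K (Fin (n + 1) → K)), W ⊆ Z ∧
    ForGeneralCodimTwo (fun Q : Submodule K (Fin (n + 1) → K) =>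
      piece (projIdeal (Z : Set (Projectivization K (Fin (n + 1) → K))) ⊓ linIdeal Q ^ m) d =
        piece (projIdeal (W : Set (Projectivization K (Fin (n + 1) → K))) ⊓ linIdeal Q ^ m) d) ∧
    (∀ X : Set (Projectivization K (Fin (n + 1) → K)), IsIrredSubvariety X →
      ForGeneralCodimTwo (fun Q : Submodule K (Fin (n + 1) → K) =>
        ((W : Set (Projectivization K (Fin (n + 1) → K))) ∩ X).ncard ≤ numConditions (linIdeal Q ^ m) (projIdeal X) d)) ∧
    ForGeneralCodimTwo (fun Q : Submodule K (Fin (n + 1) → K) =>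
      numConditions (linIdeal Q ^ m) (projIdeal (W : Set (Projectivization K (Fin (n + 1) → K)))) d <
        numConditions ⊤ (projIdeal (W : Set (Projectivization K (Fin (n + 1) → K)))) d)

/-- `Z` admits very unexpected hypersurfaces in degree `d`: the multiplicity along the general
codimension two subspace is `d - 1`. For `d = 0` the ideal power is the whole ring. -/
def AdmitsVeryUnexpected (Z : Finset (Projectivization K (Fin (n + 1) → K))) (d : ℕ) : Prop :=
  AdmitsVeryUnexpectedMult Z (d - 1) d

/-! ### The modified expected number of conditions -/

/-- `Ex.C(Z, d)`: the minimum of `∑ (d * dim H_i + 1)` over the finite families of nonempty linear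
subspaces `H_i` of projective space that cover `Z`. -/
def exC (Z : Finset (Projectivization K (Fin (n + 1) → K))) (d : ℕ) : ℕ :=
  sInf {c | ∃ 𝓗 : Finset (Submodule K (Fin (n + 1) → K)),
    (∀ H ∈ 𝓗, H ≠ ⊥) ∧ (∀ p ∈ Z, ∃ H ∈ 𝓗, p.submodule ≤ H) ∧
    c = ∑ H ∈ 𝓗, (d * (Module.finrank K H - 1) + 1)}

end

end PointConfig

end

noncomputable section

namespace PointConfig

section

variable {K : Type*} [Field K] {n : ℕ}

/-! Write d = e + 1 and let Q be the common zero set of the linear forms x = `linForm (u 1)` and y =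
`linForm (u 0)`. A form of degree d in I(Q)^e is a sum of terms h_j x^j y^(e-j) with h_j linear. Its
value at v is therefore the pairing of the family h with the tensor v ⊗ (x^j y^(e-j))_j, so the
number of conditions that a set X imposes on such forms is the rank of the tensors of its points
(`numConditions_axis`). For general Q this rank is at most d dim H + 1 for a linear subspace H
(`finrank_powSpan_le`), and at least that for an irreducible X with linear span H
(`le_finrank_powSpan`). So condition (II) says exactly that W' is sparse: each linear H contains at
most d dim H + 1 of its points.

The splitting type enters through the dual line L = Q^⊥. A derivation θ of degree m is sent to the
form ∑ X_i θ_i, with θ_i evaluated at the point of L orthogonal to v; this form vanishes on Z and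
lies in I(Q)^m. The map kills the Euler derivation, is onto in large degrees
(`IsGeneralFor.exists_dForm_eq`), and has only torsion as kernel on the restriction of D_0 to L.
Since its target and the split module are both saturated, their dimensions agree in every degree:
dim [I(Z) ∩ I(Q)^e]_d = ∑ max(0, d - a_i) (`finrank_multForms_of_splitsOnLine`). The space
[I(Q)^e]_d has dimension nd + 1, so if Z imposes r conditions on it, the claim becomes r ≤ Ex.C(Z,
d), with r < Ex.C(Z, d) exactly in the very unexpected case. The inequality is subadditivity of rank
over a cover (`le_exC`).

The strict case is matroid theory. A maximal sparse subset of Z has at least Ex.C(Z, d) points,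
because its maximal tight subspaces are disjoint and cover Z (`exC_le_card_of_maximal`). A sparse
set imposes independent conditions on all forms of degree d: Edmonds' partition theorem supplies
products of d hyperplanes that separate its points (`IsSparse.exists_separating_form`). If r <
Ex.C(Z, d), a subset of Z whose tensors form a basis is sparse; enlarged to a maximal sparse W, it
imposes r conditions on the special forms and more than r on all forms. Conversely, a witness W' is
sparse, so r < |W'| ≤ Ex.C(Z, d). -/

/-! ### Linear forms, orthogonality and ideals of linear subspaces. -/

/-- The linear form `∑ w_i X_i`. -/
def linForm (w : Fin (n + 1) → K) : MvPolynomial (Fin (n + 1)) K := ∑ i, C (w i) * X i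

@[simp] theorem eval_linForm (w v : Fin (n + 1) → K) : eval v (linForm w) = w ⬝ᵥ v := by
  simp [linForm, dotProduct]

theorem linForm_isHomogeneous (w : Fin (n + 1) → K) : (linForm w).IsHomogeneous 1 :=
  IsHomogeneous.sum _ _ _ fun _ _ => isHomogeneous_C_mul_X _ _

theorem linForm_add (w w' : Fin (n + 1) → K) : linForm (w + w') = linForm w + linForm w' := by
  simp [linForm, add_mul, Finset.sum_add_distrib]

theorem linForm_smul (c : K) (w : Fin (n + 1) → K) : linForm (c • w) = C c * linForm w := by
  simp [linForm, Finset.mul_sum, mul_assoc]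

theorem linForm_zero : linForm (0 : Fin (n + 1) → K) = 0 := by simp [linForm]

theorem linForm_single (i : Fin (n + 1)) : linForm (Pi.single i (1 : K)) = X i := by
  simp [linForm, Pi.single_apply]

theorem linForm_injective : Function.Injective (linForm : (Fin (n + 1) → K) → _) := by
  intro w w' h
  ext i
  simpa using congrArg (eval (Pi.single i 1)) h

theorem mem_perp {L : Submodule K (Fin (n + 1) → K)} {v : Fin (n + 1) → K} :
    v ∈ perp L ↔ ∀ w ∈ L, w ⬝ᵥ v = 0 := Iff.rfl

theorem mem_linIdeal {H : Submodule K (Fin (n + 1) → K)} {f : MvPolynomial (Fin (n + 1)) K} :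
    f ∈ linIdeal H ↔ ∀ v ∈ H, eval v f = 0 := by
  simp [linIdeal, aeval_eq_eval]

theorem mem_projIdeal {X : Set (Projectivization K (Fin (n + 1) → K))}
    {f : MvPolynomial (Fin (n + 1)) K} :
    f ∈ projIdeal X ↔ ∀ p ∈ X, ∀ v ∈ p.submodule, eval v f = 0 := by
  simp only [projIdeal, mem_vanishingIdeal_iff, aeval_eq_eval, Set.mem_ofPred_eq]
  exact ⟨fun h p hp v hv => h v ⟨p, hp, hv⟩, fun h v ⟨p, hp, hv⟩ => h p hp v hv⟩

theorem exists_dotProduct_of_dual (f : Module.Dual K (Fin (n + 1) → K)) :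
    ∃ w : Fin (n + 1) → K, ∀ v, f v = w ⬝ᵥ v :=
  ⟨(dotProductEquiv K (Fin (n + 1))).symm f, fun v => by
    conv_lhs => rw [← (dotProductEquiv K (Fin (n + 1))).apply_symm_apply f]
    exact dotProductEquiv_apply_apply ..⟩

theorem exists_dotProduct_ne_zero_of_notMem {U : Submodule K (Fin (n + 1) → K)}
    {v : Fin (n + 1) → K} (hv : v ∉ U) :
    ∃ w : Fin (n + 1) → K, w ⬝ᵥ v ≠ 0 ∧ ∀ x ∈ U, w ⬝ᵥ x = 0 := by
  obtain ⟨f, hf, hU⟩ := U.exists_le_ker_of_notMem hv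
  obtain ⟨w, hw⟩ := exists_dotProduct_of_dual f
  exact ⟨w, by rwa [← hw], fun x hx => by rw [← hw]; exact hU hx⟩

/-- A vector with prescribed products with the members of an independent family. -/
theorem exists_dotProduct_eq {ι : Type*} {b : ι → Fin (n + 1) → K} (hb : LinearIndependent K b)
    (c : ι → K) : ∃ w : Fin (n + 1) → K, ∀ i, w ⬝ᵥ b i = c i := by
  obtain ⟨g, hg⟩ := ((Module.Basis.span hb).constr K c).exists_extend
  obtain ⟨w, hw⟩ := exists_dotProduct_of_dual g
  refine ⟨w, fun i => ?_⟩
  rw [← hw]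
  have h1 := LinearMap.congr_fun hg (Module.Basis.span hb i)
  rw [Module.Basis.constr_basis] at h1
  rw [← h1]
  simp [Module.Basis.span_apply]

theorem perp_perp (U : Submodule K (Fin (n + 1) → K)) : perp (perp U) = U := by
  apply le_antisymm
  · intro v hv
    by_contra h
    obtain ⟨w, hw, hU⟩ := exists_dotProduct_ne_zero_of_notMem h
    exact hw (hv w fun x hx => by rw [dotProduct_comm]; exact hU x hx)
  · intro v hv w hw
    rw [dotProduct_comm]
    exact hw v hv

theorem mem_perp_span {s : Set (Fin (n + 1) → K)} {v : Fin (n + 1) → K} :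
    v ∈ perp (Submodule.span K s) ↔ ∀ w ∈ s, w ⬝ᵥ v = 0 := by
  refine ⟨fun h w hw => h w (Submodule.subset_span hw), fun h w hw => ?_⟩
  induction hw using Submodule.span_induction with
  | mem x hx => exact h x hx
  | zero => simp
  | add x y _ _ hx hy => rw [add_dotProduct, hx, hy, add_zero]
  | smul a x _ hx => rw [smul_dotProduct, hx, smul_zero]

/-- Pull polynomials back along a projection onto H. Over an infinite field, vanishing on H means
that the pullback is the zero polynomial, so I(H) is the kernel of a map to a domain. The pullback
moves each variable only by a linear form in H^⊥, which gives generators of I(H). -/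
theorem exists_linIdeal_eq_ker [Infinite K] (H : Submodule K (Fin (n + 1) → K)) :
    ∃ w : Fin (n + 1) → Fin (n + 1) → K, (∀ i, Pi.single i 1 - w i ∈ perp H) ∧
      ∀ f, f ∈ linIdeal H ↔ aeval (fun i => linForm (w i)) f = 0 := by
  obtain ⟨π, hπ⟩ := H.exists_isCompl
  let P : (Fin (n + 1) → K) →ₗ[K] (Fin (n + 1) → K) := H.subtype ∘ₗ H.projectionOnto π hπ
  have hP : ∀ v ∈ H, P v = v := fun v hv => by
    have := H.projectionOnto_apply_left hπ ⟨v, hv⟩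
    simp only [P, LinearMap.comp_apply, this, Submodule.subtype_apply]
  have hPm : ∀ v, P v ∈ H := fun v => (H.projectionOnto π hπ v).2
  choose w hw using fun i => exists_dotProduct_of_dual ((LinearMap.proj i).comp P)
  have key : ∀ v f, eval v (aeval (fun i => linForm (w i)) f) = eval (P v) f := by
    intro v f
    induction f using MvPolynomial.induction_on with
    | C a => simp
    | add p q hp hq => simp only [map_add, hp, hq]
    | mul_X p i hp =>
      have := hw i v
      simp only [LinearMap.coe_comp, Function.comp_apply, LinearMap.coe_proj,
        Function.eval] at this
      rw [map_mul, map_mul, map_mul, hp, aeval_X, eval_linForm, eval_X, this]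
  refine ⟨w, fun i v hv => ?_, fun f => ?_⟩
  · have := hw i v
    rw [LinearMap.comp_apply, hP v hv] at this
    rw [dotProduct_comm, sub_dotProduct, ← this]
    simp
  · rw [mem_linIdeal]
    constructor
    · intro h
      apply MvPolynomial.funext
      intro v
      rw [key, map_zero]
      exact h _ (hPm v)
    · intro h v hv
      rw [← hP v hv, ← key, h, map_zero]

theorem linIdeal_isPrime [Infinite K] (H : Submodule K (Fin (n + 1) → K)) :
    (linIdeal H).IsPrime := by
  obtain ⟨w, -, hw⟩ := exists_linIdeal_eq_ker H
  have : linIdeal H = RingHom.ker (aeval (R := K) fun i => linForm (w i)) := by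
    ext f; rw [hw]; rfl
  rw [this]
  exact RingHom.ker_isPrime _

theorem linForm_mem_linIdeal {H : Submodule K (Fin (n + 1) → K)} {w : Fin (n + 1) → K} :
    linForm w ∈ linIdeal H ↔ w ∈ perp H := by
  rw [mem_linIdeal]
  simp only [eval_linForm, mem_perp]
  exact forall₂_congr fun v _ => by rw [dotProduct_comm]

theorem linIdeal_perp_span [Infinite K] (s : Set (Fin (n + 1) → K)) :
    linIdeal (perp (Submodule.span K s)) = Ideal.span (linForm '' s) := by
  apply le_antisymm
  · have hlin : ∀ w ∈ Submodule.span K s, linForm w ∈ Ideal.span (linForm '' s) := by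
      intro w hw
      induction hw using Submodule.span_induction with
      | mem x hx => exact Ideal.subset_span ⟨x, hx, rfl⟩
      | zero => rw [linForm_zero]; exact zero_mem _
      | add x y _ _ hx hy => rw [linForm_add]; exact add_mem hx hy
      | smul a x _ hx => rw [linForm_smul]; exact Ideal.mul_mem_left _ _ hx
    obtain ⟨w, hw, hf⟩ := exists_linIdeal_eq_ker (perp (Submodule.span K s))
    rw [perp_perp] at hw
    have hsub : ∀ f, f - aeval (fun i => linForm (w i)) f ∈ Ideal.span (linForm '' s) := by
      intro f
      induction f using MvPolynomial.induction_on with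
      | C a => simp [algebraMap_eq]
      | add p q hp hq =>
        have := add_mem hp hq
        rw [map_add]
        convert this using 1
        ring
      | mul_X p i hp =>
        have h1 : X i - linForm (w i) ∈ Ideal.span (linForm '' s) := by
          have := hlin _ (hw i)
          rw [sub_eq_add_neg, linForm_add, linForm_single, ← neg_one_smul K, linForm_smul] at this
          simpa [sub_eq_add_neg] using this
        have h2 := add_mem (Ideal.mul_mem_left _ p h1)
          (Ideal.mul_mem_right (linForm (w i)) _ hp)
        rw [map_mul, aeval_X]
        convert h2 using 1
        ring
    intro f hfI
    have := hsub f
    rwa [(hf f).1 hfI, sub_zero] at this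
  · rw [Ideal.span_le]
    rintro _ ⟨w, hw, rfl⟩
    rw [SetLike.mem_coe, linForm_mem_linIdeal, perp_perp]
    exact Submodule.subset_span hw

theorem linIdeal_perp_singleton [Infinite K] (w : Fin (n + 1) → K) :
    linIdeal (perp (K ∙ w)) = Ideal.span {linForm w} := by
  rw [linIdeal_perp_span, Set.image_singleton]

theorem linForm_prime [Infinite K] {w : Fin (n + 1) → K} (hw : w ≠ 0) : Prime (linForm w) := by
  rw [← Ideal.span_singleton_prime, ← linIdeal_perp_singleton]
  · exact linIdeal_isPrime _
  · rw [← linForm_zero]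
    exact fun h => hw (linForm_injective h)

theorem linForm_dvd_iff [Infinite K] {w w' : Fin (n + 1) → K} :
    linForm w ∣ linForm w' ↔ w' ∈ K ∙ w := by
  rw [← Ideal.mem_span_singleton, ← linIdeal_perp_singleton, linForm_mem_linIdeal, perp_perp]

/-! ### General lines -/

/-- A property of pairs of vectors holds for a general pair. -/
def ForGeneralPair (P : (Fin 2 → Fin (n + 1) → K) → Prop) : Prop :=
  ∃ p : MvPolynomial (Fin 2 × Fin (n + 1)) K, p ≠ 0 ∧
    ∀ u : Fin 2 → Fin (n + 1) → K, LinearIndependent K u →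
      eval (fun ij => u ij.1 ij.2) p ≠ 0 → P u

theorem forGeneralLine_iff {P : Submodule K (Fin (n + 1) → K) → Prop} :
    ForGeneralLine P ↔ ForGeneralPair fun u => P (Submodule.span K (Set.range u)) := Iff.rfl

theorem forGeneralCodimTwo_iff {P : Submodule K (Fin (n + 1) → K) → Prop} :
    ForGeneralCodimTwo P ↔
      ForGeneralPair fun u => P (perp (Submodule.span K (Set.range u))) := Iff.rfl

namespace ForGeneralPair

theorem mono {P P' : (Fin 2 → Fin (n + 1) → K) → Prop} (h : ForGeneralPair P)
    (hP : ∀ u, LinearIndependent K u → P u → P' u) : ForGeneralPair P' := by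
  obtain ⟨p, hp, h⟩ := h
  exact ⟨p, hp, fun u hu hpu => hP u hu (h u hu hpu)⟩

theorem and {P P' : (Fin 2 → Fin (n + 1) → K) → Prop} (h : ForGeneralPair P)
    (h' : ForGeneralPair P') : ForGeneralPair fun u => P u ∧ P' u := by
  obtain ⟨p, hp, h⟩ := h
  obtain ⟨q, hq, h'⟩ := h'
  refine ⟨p * q, mul_ne_zero hp hq, fun u hu hpu => ?_⟩
  rw [map_mul] at hpu
  exact ⟨h u hu (left_ne_zero_of_mul hpu), h' u hu (right_ne_zero_of_mul hpu)⟩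

theorem of_forall {P : (Fin 2 → Fin (n + 1) → K) → Prop}
    (h : ∀ u, LinearIndependent K u → P u) : ForGeneralPair P :=
  ⟨1, one_ne_zero, fun u hu _ => h u hu⟩

theorem forall_finset {ι : Type*} (s : Finset ι) {P : ι → (Fin 2 → Fin (n + 1) → K) → Prop}
    (h : ∀ i ∈ s, ForGeneralPair (P i)) : ForGeneralPair fun u => ∀ i ∈ s, P i u := by
  classical
  induction s using Finset.induction_on with
  | empty => exact of_forall fun u _ i hi => absurd hi (Finset.notMem_empty i)
  | insert a s ha ih =>
    refine ((h a (Finset.mem_insert_self a s)).and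
      (ih fun i hi => h i (Finset.mem_insert_of_mem hi))).mono fun u _ hu i hi => ?_
    rcases Finset.mem_insert.1 hi with rfl | hi
    · exact hu.1
    · exact hu.2 i hi

end ForGeneralPair

/-! ### Linear independence as an open condition. -/

/-- Linear independence of a family with polynomial coordinates is an open condition. -/
theorem exists_poly_linearIndependent {σ ι κ : Type*} [Finite ι] [Finite κ]
    (g : ι → κ → MvPolynomial σ K) (x₀ : σ → K)
    (h₀ : LinearIndependent K fun i k => eval x₀ (g i k)) :
    ∃ p : MvPolynomial σ K, eval x₀ p ≠ 0 ∧
      ∀ x, eval x p ≠ 0 → LinearIndependent K fun i k => eval x (g i k) := by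
  classical
  have := Fintype.ofFinite ι
  have := Fintype.ofFinite κ
  -- Composing with a fixed left inverse of the family at `x₀` turns it into a square matrix with
  -- polynomial entries that is the identity at `x₀`. Its determinant is the required polynomial.
  obtain ⟨r, hr⟩ := LinearMap.exists_leftInverse_of_injective
    (Fintype.linearCombination K fun i k => eval x₀ (g i k))
    (by
      exact LinearMap.ker_eq_bot.2 (linearIndependent_iff_injective_fintypeLinearCombination.1 h₀))
  let M : Matrix ι ι (MvPolynomial σ K) := fun i j =>
    ∑ k, C (r (Pi.single k 1) j) * g i k
  have hM : ∀ x, (eval x).mapMatrix M = Matrix.of fun i j => r (fun k => eval x (g i k)) j := by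
    intro x
    ext i j
    change eval x (∑ k, C (r (Pi.single k 1) j) * g i k) = r (fun k => eval x (g i k)) j
    conv_rhs => rw [← Finset.univ_sum_single (fun k => eval x (g i k))]
    rw [map_sum, map_sum, Finset.sum_apply]
    refine Finset.sum_congr rfl fun k _ => ?_
    conv_rhs => rw [← mul_one (eval x (g i k)), ← smul_eq_mul, Pi.single_smul, map_smul]
    simp [mul_comm]
  refine ⟨M.det, ?_, fun x hx => ?_⟩
  · rw [RingHom.map_det, hM]
    have : (Matrix.of fun i j => r (fun k => eval x₀ (g i k)) j) = (1 : Matrix ι ι K) := by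
      ext i j
      have := congrFun (LinearMap.congr_fun hr (Pi.single i 1)) j
      simpa [Fintype.linearCombination_apply_single, Matrix.one_apply, Pi.single_apply, eq_comm]
        using this
    rw [this, Matrix.det_one]
    exact one_ne_zero
  · rw [RingHom.map_det, hM] at hx
    have h1 := Matrix.linearIndependent_rows_of_det_ne_zero hx
    exact LinearIndependent.of_comp r h1

theorem forGeneralPair_linearIndependent {ι κ : Type*} [Finite ι] [Finite κ]
    (g : ι → κ → MvPolynomial (Fin 2 × Fin (n + 1)) K) (u₀ : Fin 2 → Fin (n + 1) → K)
    (h₀ : LinearIndependent K fun i k => eval (fun ij => u₀ ij.1 ij.2) (g i k)) :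
    ForGeneralPair fun u =>
      LinearIndependent K fun i k => eval (fun ij => u ij.1 ij.2) (g i k) := by
  obtain ⟨p, hp, h⟩ := exists_poly_linearIndependent g _ h₀
  exact ⟨p, fun h0 => hp (by rw [h0, map_zero]), fun u _ hu => h _ hu⟩

theorem ForGeneralPair.exists [Infinite K] (hn : 1 ≤ n) {P : (Fin 2 → Fin (n + 1) → K) → Prop}
    (h : ForGeneralPair P) : ∃ u, LinearIndependent K u ∧ P u := by
  obtain ⟨p, hp, h⟩ := h
  let i : Fin 2 → Fin (n + 1) := Fin.castLE (by omega)
  obtain ⟨q, hq, hqu⟩ := exists_poly_linearIndependent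
    (σ := Fin 2 × Fin (n + 1)) (K := K) (fun (j : Fin 2) (k : Fin (n + 1)) => X (j, k))
    (fun ij => (Pi.single (i ij.1) 1 : Fin (n + 1) → K) ij.2) (by
      simp only [eval_X]
      have := (Pi.basisFun K (Fin (n + 1))).linearIndependent.comp i (Fin.castLE_injective _)
      convert this using 2
      ext k
      simp)
  -- The factor `q` forces independence of the pair; it exists because n ≥ 1 leaves room for two
  -- basis vectors.
  have hpq : p * q ≠ 0 := mul_ne_zero hp fun h0 => hq (by rw [h0, map_zero])
  obtain ⟨x, hx⟩ : ∃ x, eval x (p * q) ≠ 0 := by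
    by_contra! hc
    exact hpq (MvPolynomial.funext fun x => by rw [hc, map_zero])
  rw [map_mul] at hx
  have hLI : LinearIndependent K fun (j : Fin 2) (k : Fin (n + 1)) => x (j, k) := by
    simpa using hqu x (right_ne_zero_of_mul hx)
  exact ⟨fun j k => x (j, k), hLI, h _ hLI (left_ne_zero_of_mul hx)⟩

/-! ### The rank of the tensors attached to a set of vectors. -/

theorem finrank_eq_finrank_map_add {V V' : Type*} [AddCommGroup V] [Module K V]
    [FiniteDimensional K V] [AddCommGroup V'] [Module K V'] (T : V →ₗ[K] V')
    (S : Submodule K V) :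
    Module.finrank K S =
      Module.finrank K (S.map T) + Module.finrank K (S ⊓ LinearMap.ker T : Submodule K V) := by
  have h := LinearMap.finrank_range_add_finrank_ker (T.domRestrict S)
  rw [LinearMap.range_domRestrict] at h
  rw [← h, LinearMap.ker_domRestrict, ← Submodule.map_comap_subtype,
    Submodule.finrank_map_subtype_eq]

/-- The vector `v ⊗ (x^j y^(e - j))_j`, where `x`, `y` are the products of `v` with `u 1`, `u 0`. -/
def powVec (u : Fin 2 → Fin (n + 1) → K) (e : ℕ) (v : Fin (n + 1) → K) :
    Fin (e + 1) → Fin (n + 1) → K :=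
  fun j => ((u 1 ⬝ᵥ v) ^ (j : ℕ) * (u 0 ⬝ᵥ v) ^ (e - j)) • v

/-- The span of the vectors `powVec u e v` with `v` in a given set. -/
def powSpan (u : Fin 2 → Fin (n + 1) → K) (e : ℕ) (s : Set (Fin (n + 1) → K)) :
    Submodule K (Fin (e + 1) → Fin (n + 1) → K) :=
  Submodule.span K (powVec u e '' s)

theorem powVec_smul (u : Fin 2 → Fin (n + 1) → K) (e : ℕ) (c : K) (v : Fin (n + 1) → K) :
    powVec u e (c • v) = c ^ (e + 1) • powVec u e v := by
  ext j i
  have hj : c ^ (e + 1) = c ^ (j : ℕ) * c ^ (e - j) * c := by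
    rw [← pow_add, ← pow_succ]
    congr 2
    omega
  simp only [powVec, dotProduct_smul, smul_eq_mul, Pi.smul_apply, hj]
  ring

theorem powSpan_mono {u : Fin 2 → Fin (n + 1) → K} {e : ℕ} {s t : Set (Fin (n + 1) → K)}
    (h : s ⊆ t) : powSpan u e s ≤ powSpan u e t :=
  Submodule.span_mono (Set.image_mono h)

theorem powVec_mem_powSpan {u : Fin 2 → Fin (n + 1) → K} {e : ℕ} {s : Set (Fin (n + 1) → K)}
    {v : Fin (n + 1) → K} (hv : v ∈ s) : powVec u e v ∈ powSpan u e s :=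
  Submodule.subset_span ⟨v, hv, rfl⟩

/-- Forgetting the coordinate j = 0 lowers e by one, at the cost of the scalar x(v). Both rank
bounds below are inductions on e along this map. -/
theorem tail_powVec (u : Fin 2 → Fin (n + 1) → K) (e : ℕ) (v : Fin (n + 1) → K) :
    LinearMap.funLeft K (Fin (n + 1) → K) Fin.succ (powVec u (e + 1) v) =
      (u 1 ⬝ᵥ v) • powVec u e v := by
  ext j i
  simp only [LinearMap.funLeft_apply, powVec, Pi.smul_apply, smul_eq_mul, Fin.val_succ, pow_succ,
    Nat.add_sub_add_right]
  ring

theorem finrank_inf_ker_dotProduct {H : Submodule K (Fin (n + 1) → K)} {w : Fin (n + 1) → K}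
    (hw : ∃ v ∈ H, w ⬝ᵥ v ≠ 0) :
    Module.finrank K (H ⊓ LinearMap.ker (dotProductEquiv K (Fin (n + 1)) w) :
      Submodule K (Fin (n + 1) → K)) + 1 = Module.finrank K H := by
  rw [finrank_eq_finrank_map_add (dotProductEquiv K (Fin (n + 1)) w) H, add_comm]
  congr 1
  obtain ⟨v, hv, h⟩ := hw
  have : H.map (dotProductEquiv K (Fin (n + 1)) w) = ⊤ := by
    refine (eq_bot_or_eq_top (α := Ideal K) _).resolve_left fun h0 => h ?_
    exact (Submodule.mem_bot K).1 (h0 ▸ Submodule.mem_map_of_mem hv)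
  rw [this, finrank_top, Module.finrank_self]

/-- The tail map sends the span for e + 1 into the span for e. On its kernel only the coordinate w_0
survives, and the relation u_1 · w_0 = u_0 · w_1 puts w_0 into the hyperplane u_1 = 0 of H. Each
step thus adds at most the projective dimension of H. -/
theorem finrank_powSpan_le {H : Submodule K (Fin (n + 1) → K)} {u : Fin 2 → Fin (n + 1) → K}
    (hu : ∃ v ∈ H, u 1 ⬝ᵥ v ≠ 0) (e : ℕ) :
    Module.finrank K (powSpan u e (H : Set (Fin (n + 1) → K))) ≤
        (e + 1) * (Module.finrank K H - 1) + 1 := by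
  have hpos := finrank_inf_ker_dotProduct hu
  have hcoord : ∀ e, ∀ w ∈ powSpan u e H, ∀ j, w j ∈ H := by
    intro e w hw j
    have : powSpan u e H ≤ H.comap (LinearMap.proj j) := by
      refine Submodule.span_le.2 ?_
      rintro _ ⟨v, hv, rfl⟩
      exact H.smul_mem _ hv
    exact this hw
  induction e with
  | zero =>
    have : Module.finrank K (powSpan u 0 H) ≤ Module.finrank K H := by
      refine LinearMap.finrank_le_finrank_of_injective
        (f := ((LinearMap.proj 0).domRestrict (powSpan u 0 H)).codRestrict H
          fun w => hcoord 0 w w.2 0) ?_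
      intro w w' h
      ext j i
      have := congrFun (congrArg Subtype.val h) i
      have hj : j = 0 := Subsingleton.elim (α := Fin 1) j 0
      rw [hj]
      exact this
    omega
  | succ e ih =>
    rw [finrank_eq_finrank_map_add (LinearMap.funLeft K (Fin (n + 1) → K) Fin.succ)]
    have h1 : (powSpan u (e + 1) H).map (LinearMap.funLeft K (Fin (n + 1) → K) Fin.succ) ≤
        powSpan u e H := by
      rw [powSpan, Submodule.map_span, Submodule.span_le]
      rintro _ ⟨_, ⟨v, hv, rfl⟩, rfl⟩
      rw [tail_powVec]
      exact Submodule.smul_mem _ _ (powVec_mem_powSpan hv)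
    have h2 : Module.finrank K (powSpan u (e + 1) H ⊓
        LinearMap.ker (LinearMap.funLeft K (Fin (n + 1) → K) Fin.succ) : Submodule K _) ≤
        Module.finrank K (H ⊓ LinearMap.ker (dotProductEquiv K (Fin (n + 1)) (u 1)) :
          Submodule K (Fin (n + 1) → K)) := by
      have hrel : ∀ w ∈ powSpan u (e + 1) H, u 1 ⬝ᵥ w 0 = u 0 ⬝ᵥ w 1 := by
        intro w hw
        induction hw using Submodule.span_induction with
        | mem x hx =>
          obtain ⟨v, hv, rfl⟩ := hx
          simp only [powVec, dotProduct_smul, smul_eq_mul, Fin.val_zero, Fin.val_one, pow_zero,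
            Nat.sub_zero, Nat.add_sub_cancel, pow_succ]
          ring
        | zero => simp
        | add x y _ _ hx hy => simp only [Pi.add_apply, dotProduct_add, hx, hy]
        | smul a x _ hx => simp only [Pi.smul_apply, dotProduct_smul, hx]
      have htail : ∀ w ∈ LinearMap.ker (LinearMap.funLeft K (Fin (n + 1) → K)
          (Fin.succ : Fin (e + 1) → Fin (e + 2))), ∀ j, w (Fin.succ j) = 0 :=
        fun w hw j => congrFun (LinearMap.mem_ker.1 hw) j
      refine LinearMap.finrank_le_finrank_of_injective
        (f := ((LinearMap.proj 0).domRestrict _).codRestrict _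
          fun w => ⟨hcoord (e + 1) w w.2.1 0, ?_⟩) ?_
      · have h0 := hrel w w.2.1
        rw [show (1 : Fin (e + 2)) = Fin.succ 0 from rfl, htail w w.2.2, dotProduct_zero] at h0
        exact h0
      · intro w w' h
        ext j : 2
        refine Fin.cases ?_ (fun j => ?_) j
        · exact congrArg Subtype.val h
        · rw [htail w w.2.2, htail w' w'.2.2]
    have h3 := Submodule.finrank_mono h1
    have h4 : (e + 1 + 1) * (Module.finrank K H - 1) =
      (e + 1) * (Module.finrank K H - 1) + (Module.finrank K H - 1) := by ring
    omega

/-- The linear map sending `h` to the form `∑ h_{j,i} X_i x^j y^(e - j)`. -/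
def powForm (u : Fin 2 → Fin (n + 1) → K) (e : ℕ) :
    (Fin (e + 1) → Fin (n + 1) → K) →ₗ[K] MvPolynomial (Fin (n + 1)) K where
  toFun h := ∑ j, linForm (h j) * (linForm (u 1) ^ (j : ℕ) * linForm (u 0) ^ (e - j))
  map_add' h h' := by simp [linForm_add, add_mul, Finset.sum_add_distrib]
  map_smul' c h := by
    simp only [Pi.smul_apply, linForm_smul, RingHom.id_apply, smul_eq_C_mul, Finset.mul_sum,
      mul_assoc]

theorem powForm_apply (u : Fin 2 → Fin (n + 1) → K) (e : ℕ) (h : Fin (e + 1) → Fin (n + 1) → K) :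
    powForm u e h = ∑ j, linForm (h j) * (linForm (u 1) ^ (j : ℕ) * linForm (u 0) ^ (e - j)) :=
  rfl

theorem powForm_isHomogeneous (u : Fin 2 → Fin (n + 1) → K) (e : ℕ)
    (h : Fin (e + 1) → Fin (n + 1) → K) : (powForm u e h).IsHomogeneous (e + 1) := by
  refine IsHomogeneous.sum _ _ _ fun j _ => ?_
  have := (linForm_isHomogeneous (h j)).mul (((linForm_isHomogeneous (u 1)).pow j).mul
    ((linForm_isHomogeneous (u 0)).pow (e - j)))
  convert this using 1
  omega

theorem eval_powForm (u : Fin 2 → Fin (n + 1) → K) (e : ℕ) (h : Fin (e + 1) → Fin (n + 1) → K)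
    (v : Fin (n + 1) → K) : eval v (powForm u e h) = ∑ j, h j ⬝ᵥ powVec u e v j := by
  simp only [powForm_apply, map_sum, map_mul, map_pow, eval_linForm, powVec, dotProduct_smul,
    smul_eq_mul]
  exact Finset.sum_congr rfl fun j _ => by ring

theorem exists_sum_dotProduct_of_dual {ι : Type*} [Fintype ι]
    (f : Module.Dual K (ι → Fin (n + 1) → K)) :
    ∃ h : ι → Fin (n + 1) → K, ∀ w, f w = ∑ j, h j ⬝ᵥ w j := by
  classical
  choose h hh using fun j => exists_dotProduct_of_dual
    (f ∘ₗ LinearMap.single K (fun _ => Fin (n + 1) → K) j)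
  refine ⟨h, fun w => ?_⟩
  conv_lhs => rw [← Finset.univ_sum_single w, map_sum]
  exact Finset.sum_congr rfl fun j _ => hh j (w j)

/-- A set of vectors on which a product of forms vanishes only if one of the factors does. -/
def IsIrredCone (s : Set (Fin (n + 1) → K)) : Prop :=
  ∀ (f g : MvPolynomial (Fin (n + 1)) K) (k l : ℕ), f.IsHomogeneous k → g.IsHomogeneous l →
    (∀ v ∈ s, eval v f * eval v g = 0) → (∀ v ∈ s, eval v f = 0) ∨ ∀ v ∈ s, eval v g = 0

/-- Here the tail map covers the whole span for e: a functional killing its image is a form f with x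
f = 0 on s, and irreducibility gives f = 0 on s because x does not vanish there. The kernel contains
the tensors of the b_i, which lie on x = 0 and have first coordinate b_i, so each step adds at least
h. The b_i must belong to s itself, not merely to its span. -/
theorem le_finrank_powSpan {s : Set (Fin (n + 1) → K)} (hs : IsIrredCone s)
    {u : Fin 2 → Fin (n + 1) → K} (hu : ∃ v ∈ s, u 1 ⬝ᵥ v ≠ 0) {h : ℕ}
    {b : Fin h → Fin (n + 1) → K} (hb : LinearIndependent K b) (hbs : ∀ i, b i ∈ s)
    (hb1 : ∀ i, u 1 ⬝ᵥ b i = 0) (hb0 : ∀ i, u 0 ⬝ᵥ b i = 1) (e : ℕ) :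
    (e + 1) * h + 1 ≤ Module.finrank K (powSpan u e s) := by
  induction e with
  | zero =>
    obtain ⟨v, hv, hv1⟩ := hu
    have hLI : LinearIndependent K (Fin.cons v b : Fin (h + 1) → Fin (n + 1) → K) := by
      refine linearIndependent_finCons.2 ⟨hb, fun hmem => hv1 ?_⟩
      have : Submodule.span K (Set.range b) ≤
          LinearMap.ker (dotProductEquiv K (Fin (n + 1)) (u 1)) := by
        rw [Submodule.span_le]
        rintro _ ⟨i, rfl⟩
        exact hb1 i
      exact this hmem
    have hLI2 : LinearIndependent K fun i =>
        powVec u 0 ((Fin.cons v b : Fin (h + 1) → Fin (n + 1) → K) i) := by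
      refine LinearIndependent.of_comp (LinearMap.proj 0) ?_
      convert hLI using 2
      ext i
      simp [powVec]
    have := finrank_span_eq_card hLI2
    rw [Fintype.card_fin] at this
    calc (0 + 1) * h + 1 = h + 1 := by ring
      _ = _ := this.symm
      _ ≤ _ := ?_
    refine Submodule.finrank_mono (Submodule.span_mono ?_)
    rintro _ ⟨i, rfl⟩
    refine ⟨_, ?_, rfl⟩
    exact Fin.cases hv hbs i
  | succ e ih =>
    rw [finrank_eq_finrank_map_add (LinearMap.funLeft K (Fin (n + 1) → K) Fin.succ)]
    have h1 : powSpan u e s ≤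
        (powSpan u (e + 1) s).map (LinearMap.funLeft K (Fin (n + 1) → K) Fin.succ) := by
      refine Submodule.span_le.2 ?_
      rintro _ ⟨v, hv, rfl⟩
      by_contra hmem
      obtain ⟨f, hf, hM⟩ := Submodule.exists_le_ker_of_notMem hmem
      obtain ⟨c, hc⟩ := exists_sum_dotProduct_of_dual f
      have hfe : ∀ w, f (powVec u e w) = eval w (powForm u e c) := fun w => by
        rw [hc, eval_powForm]
      rcases hs (linForm (u 1)) (powForm u e c) 1 (e + 1) (linForm_isHomogeneous _)
        (powForm_isHomogeneous _ _ _) (fun w hw => by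
          rw [eval_linForm, ← hfe, ← smul_eq_mul, ← map_smul, ← tail_powVec]
          exact hM (Submodule.mem_map_of_mem (powVec_mem_powSpan hw))) with h0 | h0
      · obtain ⟨w, hw, hw1⟩ := hu
        exact hw1 (by simpa using h0 w hw)
      · exact hf (by rw [hfe]; exact h0 v hv)
    have h2 : h ≤ Module.finrank K (powSpan u (e + 1) s ⊓
        LinearMap.ker (LinearMap.funLeft K (Fin (n + 1) → K) Fin.succ) : Submodule K _) := by
      have hLI : LinearIndependent K fun i => powVec u (e + 1) (b i) := by
        refine LinearIndependent.of_comp (LinearMap.proj 0) ?_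
        convert hb using 2
        ext i
        simp [powVec, hb0]
      have := finrank_span_eq_card hLI
      rw [Fintype.card_fin] at this
      rw [← this]
      refine Submodule.finrank_mono (Submodule.span_le.2 ?_)
      rintro _ ⟨i, rfl⟩
      refine ⟨powVec_mem_powSpan (hbs i), ?_⟩
      rw [SetLike.mem_coe, LinearMap.mem_ker, tail_powVec, hb1, zero_smul]
    have h3 := Submodule.finrank_mono h1
    have h4 : (e + 1 + 1) * h = (e + 1) * h + h := by ring
    omega

/-! ### Passage from one special pair to a general pair. -/

/-- The coordinates of `powVec`, as polynomials in the coordinates of `u`. -/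
def powPoly (e : ℕ) (v : Fin (n + 1) → K) (k : Fin (e + 1) × Fin (n + 1)) :
    MvPolynomial (Fin 2 × Fin (n + 1)) K :=
  C (v k.2) * ((∑ i, C (v i) * X (1, i)) ^ (k.1 : ℕ) * (∑ i, C (v i) * X (0, i)) ^ (e - k.1))

theorem eval_powPoly (u : Fin 2 → Fin (n + 1) → K) (e : ℕ) (v : Fin (n + 1) → K)
    (k : Fin (e + 1) × Fin (n + 1)) :
    eval (fun ij => u ij.1 ij.2) (powPoly e v k) = powVec u e v k.1 k.2 := by
  simp only [powPoly, powVec, map_mul, map_pow, map_sum, eval_C, eval_X, Pi.smul_apply,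
    smul_eq_mul, dotProduct, mul_comm (v _)]

theorem forGeneralPair_linearIndependent_powVec {ι : Type*} [Finite ι] {e : ℕ}
    {v : ι → Fin (n + 1) → K} {u₀ : Fin 2 → Fin (n + 1) → K}
    (h : LinearIndependent K fun i => powVec u₀ e (v i)) :
    ForGeneralPair fun u => LinearIndependent K fun i => powVec u e (v i) := by
  have key : ∀ u : Fin 2 → Fin (n + 1) → K,
      LinearIndependent K (fun i k => eval (fun ij => u ij.1 ij.2) (powPoly e (v i) k)) ↔
        LinearIndependent K fun i => powVec u e (v i) := by
    intro u
    simp only [eval_powPoly]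
    exact (LinearEquiv.curry K K (Fin (e + 1)) (Fin (n + 1))).toLinearMap.linearIndependent_iff
      (v := fun i (k : Fin (e + 1) × Fin (n + 1)) => powVec u e (v i) k.1 k.2)
      (LinearEquiv.ker _) |>.symm
  exact (forGeneralPair_linearIndependent (fun i k => powPoly e (v i) k) u₀ ((key _).2 h)).mono
    fun u _ hu => (key u).1 hu

theorem forGeneralPair_le_finrank_powSpan {s : Set (Fin (n + 1) → K)} {e r : ℕ}
    {u₀ : Fin 2 → Fin (n + 1) → K} (h : r ≤ Module.finrank K (powSpan u₀ e s)) :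
    ForGeneralPair fun u => r ≤ Module.finrank K (powSpan u e s) := by
  obtain ⟨f, hf, -, hLI⟩ := Submodule.exists_fun_fin_finrank_span_eq K (powVec u₀ e '' s)
  choose v hv hvf using hf
  have hLI' : LinearIndependent K fun i => powVec u₀ e (v i) := by simpa only [hvf] using hLI
  refine (forGeneralPair_linearIndependent_powVec hLI').mono fun u _ hu => h.trans ?_
  have := finrank_span_eq_card hu
  rw [Fintype.card_fin] at this
  rw [powSpan, ← this]
  refine Submodule.finrank_mono (Submodule.span_le.2 ?_)
  rintro _ ⟨i, rfl⟩
  exact powVec_mem_powSpan (hv i)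

theorem forGeneralPair_le_finrank_powSpan_of_isIrredCone {s : Set (Fin (n + 1) → K)}
    (hs : IsIrredCone s) (h0 : ∃ v ∈ s, v ≠ 0) (e : ℕ) :
    ForGeneralPair fun u =>
      (e + 1) * (Module.finrank K (Submodule.span K s) - 1) + 1 ≤
        Module.finrank K (powSpan u e s) := by
  obtain ⟨b, hb, -, hLI⟩ := Submodule.exists_fun_fin_finrank_span_eq K s
  have hpos : 0 < Module.finrank K (Submodule.span K s) := by
    obtain ⟨v, hv, hv0⟩ := h0
    rw [Module.finrank_pos_iff_exists_ne_zero]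
    exact ⟨⟨v, Submodule.subset_span hv⟩, fun h => hv0 (congrArg Subtype.val h)⟩
  generalize Module.finrank K (Submodule.span K s) = r at *
  obtain ⟨h, rfl⟩ : ∃ h, r = h + 1 := ⟨r - 1, by omega⟩
  -- By openness one special pair suffices. For a basis of the span chosen inside s, x is 1 on the
  -- first vector and 0 on the others, and y is 1 on all of them.
  obtain ⟨x, hx⟩ := exists_dotProduct_eq hLI (Fin.cons 1 fun _ => 0)
  obtain ⟨y, hy⟩ := exists_dotProduct_eq hLI fun _ => 1
  refine forGeneralPair_le_finrank_powSpan (u₀ := ![y, x]) ?_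
  refine le_finrank_powSpan hs ⟨b 0, hb 0, ?_⟩ (hLI.comp Fin.succ (Fin.succ_injective _))
    (fun i => hb _) (fun i => ?_) (fun i => ?_) e
  · simpa using by rw [hx 0]; simp
  · simpa using hx i.succ
  · simpa using hy i.succ

theorem forGeneralPair_finrank_powSpan_le {H : Submodule K (Fin (n + 1) → K)} (hH : H ≠ ⊥)
    (e : ℕ) :
    ForGeneralPair fun u =>
      Module.finrank K (powSpan u e (H : Set (Fin (n + 1) → K))) ≤
        (e + 1) * (Module.finrank K H - 1) + 1 := by
  obtain ⟨v, hv, hv0⟩ := H.exists_mem_ne_zero_of_ne_bot hH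
  obtain ⟨i, hi⟩ := Function.ne_iff.1 hv0
  refine ForGeneralPair.mono (P := fun u => u 1 ⬝ᵥ v ≠ 0)
    ⟨∑ i, C (v i) * X (1, i), fun h => hi ?_, fun u _ hu => ?_⟩
    fun u _ hu => finrank_powSpan_le ⟨v, hv, hu⟩ e
  · simpa [Pi.single_apply, Prod.ext_iff] using
      congrArg (eval (Pi.single (M := fun _ => K) (1, i) 1)) h
  · simpa [dotProduct, mul_comm] using hu

/-! ### Homogeneous components of products -/

theorem homogeneousComponent_mul {σ R : Type*} [CommSemiring R] {a : MvPolynomial σ R} {i : ℕ}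
    (ha : a.IsHomogeneous i) (f : MvPolynomial σ R) (j : ℕ) :
    homogeneousComponent (i + j) (a * f) = a * homogeneousComponent j f := by
  induction f using MvPolynomial.induction_on' with
  | monomial d c =>
    have hd := isHomogeneous_monomial (R := R) (d := d) c rfl
    rw [homogeneousComponent_of_mem hd, homogeneousComponent_of_mem (ha.mul hd)]
    by_cases h : d.degree = j
    · simp [h]
    · simp [Ne.symm h]
  | add p q hp hq => rw [mul_add, map_add, map_add, mul_add, hp, hq]

theorem exists_homogeneous_factor {σ R : Type*} [CommSemiring R] {a f : MvPolynomial σ R}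
    {i j : ℕ} (ha : a.IsHomogeneous i) (hf : f.IsHomogeneous (i + j)) (h : a ∣ f) :
    ∃ g, g.IsHomogeneous j ∧ f = a * g := by
  obtain ⟨g, rfl⟩ := h
  refine ⟨homogeneousComponent j g, homogeneousComponent_isHomogeneous _ _, ?_⟩
  rw [← homogeneousComponent_mul ha, homogeneousComponent_eq_self hf]

theorem eq_zero_of_dvd_of_lt {σ R : Type*} [CommRing R] [IsDomain R] {a f : MvPolynomial σ R}
    {i j : ℕ} (ha : a.IsHomogeneous i) (ha0 : a ≠ 0) (hf : f.IsHomogeneous j) (hij : j < i)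
    (h : a ∣ f) : f = 0 := by
  by_contra hf0
  obtain ⟨g, rfl⟩ := h
  have := totalDegree_mul_of_isDomain ha0 (right_ne_zero_of_mul hf0)
  rw [hf.totalDegree hf0, ha.totalDegree ha0] at this
  omega

theorem exists_eq_linForm {f : MvPolynomial (Fin (n + 1)) K} (hf : f.IsHomogeneous 1) :
    ∃ w, f = linForm w := by
  have h : f ∈ Submodule.span K (Set.range X) := by
    rw [← homogeneousSubmodule_one_eq_span_X]
    exact hf
  obtain ⟨w, rfl⟩ := (Submodule.mem_span_range_iff_exists_fun K).1 h
  exact ⟨w, by simp [linForm, smul_eq_C_mul]⟩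

/-! ### Powers of the ideal generated by two elements -/

theorem span_pair_pow {R : Type*} [CommSemiring R] (a b : R) (e : ℕ) :
    Ideal.span {a, b} ^ e = Ideal.span (Set.range fun j : Fin (e + 1) =>
      a ^ (j : ℕ) * b ^ (e - j)) := by
  apply le_antisymm
  · induction e with
    | zero => simp [Ideal.span, Set.range_const]
    | succ e ih =>
      rw [pow_succ]
      refine (Ideal.mul_mono_left ih).trans ?_
      rw [Ideal.span_mul_span, Ideal.span_le]
      rintro _ ⟨_, ⟨j, rfl⟩, t, ht | ht, rfl⟩ <;> obtain ht : t = _ := ht <;> subst t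
      · refine Ideal.subset_span ⟨j.succ, ?_⟩
        change a ^ ((j : ℕ) + 1) * b ^ (e + 1 - ((j : ℕ) + 1)) = _
        rw [Nat.add_sub_add_right]
        ring
      · refine Ideal.subset_span ⟨j.castSucc, ?_⟩
        change a ^ (j : ℕ) * b ^ (e + 1 - (j : ℕ)) = _
        rw [show e + 1 - (j : ℕ) = e - j + 1 by omega]
        ring
  · rw [Ideal.span_le]
    rintro _ ⟨j, rfl⟩
    have h := Ideal.mul_mem_mul
      (Ideal.pow_mem_pow (Ideal.subset_span (Set.mem_insert a {b})) (j : ℕ))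
      (Ideal.pow_mem_pow (Ideal.subset_span (Set.mem_insert_of_mem a rfl : b ∈ ({a, b} : Set R)))
        (e - j))
    rwa [← pow_add, show (j : ℕ) + (e - j) = e by omega] at h

theorem sup_pow_succ_le {R : Type*} [CommSemiring R] (I J : Ideal R) (m : ℕ) :
    (I ⊔ J) ^ (m + 1) ≤ I * (I ⊔ J) ^ m ⊔ J ^ (m + 1) := by
  induction m with
  | zero => simp
  | succ m ih =>
    rw [pow_succ (I ⊔ J) (m + 1)]
    refine (Ideal.mul_mono_left ih).trans ?_
    rw [Ideal.sup_mul]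
    refine sup_le (le_sup_of_le_left ?_) ?_
    · rw [mul_assoc, ← pow_succ]
    · rw [Ideal.mul_sup, mul_comm _ I, ← pow_succ]
      exact sup_le_sup (Ideal.mul_mono_right (Ideal.pow_right_mono le_sup_right _)) le_rfl

/-- An element of (a, b)^(m+1) is a y' + b^(m+1) c with y' in (a, b)^m. If a divides it then a
divides c, since a is prime and does not divide b; cancelling a lowers the order by exactly one. -/
theorem mem_span_pair_pow_of_mul_mem {R : Type*} [CommRing R] [IsDomain R] {a b g : R}
    (ha : Prime a) (hab : ¬ a ∣ b) {m : ℕ} (h : a * g ∈ Ideal.span {a, b} ^ (m + 1)) :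
    g ∈ Ideal.span {a, b} ^ m := by
  rw [Ideal.span_insert] at h ⊢
  obtain ⟨y, hy, z, hz, hyz⟩ := Submodule.mem_sup.1 (sup_pow_succ_le _ _ m h)
  obtain ⟨y', hy', rfl⟩ := Ideal.mem_span_singleton_mul.1 hy
  rw [Ideal.span_singleton_pow, Ideal.mem_span_singleton] at hz
  obtain ⟨c, rfl⟩ := hz
  have hc : a ∣ b ^ (m + 1) * c := ⟨g - y', by rw [mul_sub, ← hyz]; ring⟩
  obtain ⟨c', rfl⟩ := (ha.dvd_or_dvd hc).resolve_left fun h => hab (ha.dvd_of_dvd_pow h)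
  have hg : g = y' + b ^ (m + 1) * c' := by
    apply mul_left_cancel₀ ha.ne_zero
    rw [← hyz]
    ring
  rw [hg]
  refine add_mem hy' (Ideal.mul_mem_right _ _ ?_)
  exact Ideal.pow_le_pow_right m.le_succ
    (Ideal.pow_mem_pow (Ideal.mem_sup_right (Ideal.mem_span_singleton_self b)) _)

theorem mem_span_pair_pow_of_pow_mul_mem {R : Type*} [CommRing R] [IsDomain R] {a b g : R}
    (ha : Prime a) (hab : ¬ a ∣ b) {m : ℕ} (k : ℕ)
    (h : a ^ k * g ∈ Ideal.span {a, b} ^ (m + k)) : g ∈ Ideal.span {a, b} ^ m := by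
  induction k with
  | zero => simpa using h
  | succ k ih =>
    refine ih (mem_span_pair_pow_of_mul_mem ha hab ?_)
    rwa [← mul_assoc, ← pow_succ']

/-! ### The ideal of a subspace of codimension two -/

/-- The common zero set of the two linear forms given by `u`. -/
def axis (u : Fin 2 → Fin (n + 1) → K) : Submodule K (Fin (n + 1) → K) :=
  perp (Submodule.span K (Set.range u))

theorem linIdeal_axis [Infinite K] (u : Fin 2 → Fin (n + 1) → K) :
    linIdeal (axis u) = Ideal.span {linForm (u 1), linForm (u 0)} := by
  rw [axis, linIdeal_perp_span]
  congr 1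
  ext x
  simp [Fin.exists_fin_two, eq_comm, or_comm]

theorem exists_eq_sum_of_mem_pow [Infinite K] {u : Fin 2 → Fin (n + 1) → K} {e r : ℕ}
    {f : MvPolynomial (Fin (n + 1)) K} (hf : f.IsHomogeneous (e + r))
    (h : f ∈ linIdeal (axis u) ^ e) :
    ∃ c : Fin (e + 1) → MvPolynomial (Fin (n + 1)) K, (∀ j, (c j).IsHomogeneous r) ∧
      f = ∑ j, c j * (linForm (u 1) ^ (j : ℕ) * linForm (u 0) ^ (e - j)) := by
  rw [linIdeal_axis, span_pair_pow] at h
  obtain ⟨c, rfl⟩ := Ideal.mem_span_range_iff_exists_fun.1 h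
  refine ⟨fun j => homogeneousComponent r (c j),
    fun j => homogeneousComponent_isHomogeneous _ _, ?_⟩
  conv_lhs => rw [← homogeneousComponent_eq_self hf, map_sum]
  refine Finset.sum_congr rfl fun j _ => ?_
  have := ((linForm_isHomogeneous (u 1)).pow j).mul ((linForm_isHomogeneous (u 0)).pow (e - j))
  rw [show 1 * (j : ℕ) + 1 * (e - j) = e by omega] at this
  rw [mul_comm, homogeneousComponent_mul this, mul_comm]

theorem pow_mul_pow_mem [Infinite K] (u : Fin 2 → Fin (n + 1) → K) {e : ℕ} (j : Fin (e + 1)) :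
    linForm (u 1) ^ (j : ℕ) * linForm (u 0) ^ (e - j) ∈ linIdeal (axis u) ^ e := by
  rw [linIdeal_axis, span_pair_pow]
  exact Ideal.subset_span ⟨j, rfl⟩

theorem mem_piece {J : Ideal (MvPolynomial (Fin (n + 1)) K)} {d : ℕ}
    {f : MvPolynomial (Fin (n + 1)) K} : f ∈ piece J d ↔ f ∈ J ∧ f.IsHomogeneous d := Iff.rfl

theorem range_powForm [Infinite K] (u : Fin 2 → Fin (n + 1) → K) (e : ℕ) :
    LinearMap.range (powForm u e) = piece (linIdeal (axis u) ^ e) (e + 1) := by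
  ext f
  rw [mem_piece, LinearMap.mem_range]
  constructor
  · rintro ⟨h, rfl⟩
    refine ⟨?_, powForm_isHomogeneous u e h⟩
    rw [powForm_apply]
    exact Ideal.sum_mem _ fun j _ => Ideal.mul_mem_left _ _ (pow_mul_pow_mem u j)
  · rintro ⟨hI, hf⟩
    obtain ⟨c, hc, rfl⟩ := exists_eq_sum_of_mem_pow hf hI
    choose w hw using fun j => exists_eq_linForm (hc j)
    exact ⟨w, by simp only [powForm_apply, hw]⟩

instance (J : Ideal (MvPolynomial (Fin (n + 1)) K)) (d : ℕ) : FiniteDimensional K (piece J d) := by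
  have : FiniteDimensional K (homogeneousSubmodule (Fin (n + 1)) K d) :=
    Module.Finite.iff_fg.2 (homogeneousSubmodule_fg _ _ d)
  exact Submodule.finiteDimensional_of_le (inf_le_right : piece J d ≤ _)

theorem numConditions_add_finrank (J I : Ideal (MvPolynomial (Fin (n + 1)) K)) (d : ℕ) :
    numConditions J I d + Module.finrank K (piece (I ⊓ J) d) = Module.finrank K (piece J d) := by
  have hle : piece (I ⊓ J) d ≤ piece J d := fun f hf => ⟨hf.1.2, hf.2⟩
  rw [← Submodule.finrank_quotient_add_finrank ((piece (I ⊓ J) d).submoduleOf (piece J d)),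
    numConditions, (Submodule.submoduleOfEquivOfLe hle).finrank_eq]

/-! ### Numbers of conditions as ranks of tensors. -/

/-- The representatives of the points of a set, together with the zero vector. -/
def cone (X : Set (Projectivization K (Fin (n + 1) → K))) : Set (Fin (n + 1) → K) :=
  {v | ∃ p ∈ X, v ∈ p.submodule}

theorem mem_projIdeal_iff_cone {X : Set (Projectivization K (Fin (n + 1) → K))}
    {f : MvPolynomial (Fin (n + 1)) K} : f ∈ projIdeal X ↔ ∀ v ∈ cone X, eval v f = 0 := by
  rw [mem_projIdeal]
  exact ⟨fun h v ⟨p, hp, hv⟩ => h p hp v hv, fun h p hp v hv => h v ⟨p, hp, hv⟩⟩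

theorem finrank_annihilator_powSpan (u : Fin 2 → Fin (n + 1) → K) (e : ℕ)
    (s : Set (Fin (n + 1) → K)) (A : Submodule K (Fin (e + 1) → Fin (n + 1) → K))
    (hA : ∀ h, h ∈ A ↔ ∀ v ∈ s, eval v (powForm u e h) = 0) :
    Module.finrank K (powSpan u e s) + Module.finrank K A =
      Module.finrank K (Fin (e + 1) → Fin (n + 1) → K) := by
  rw [← Subspace.finrank_add_finrank_dualAnnihilator_eq (powSpan u e s)]
  congr 1
  let D : (Fin (e + 1) → Fin (n + 1) → K) →ₗ[K]
      Module.Dual K (Fin (e + 1) → Fin (n + 1) → K) :=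
    { toFun := fun h => ∑ j, (dotProductEquiv K (Fin (n + 1)) (h j)) ∘ₗ LinearMap.proj j
      map_add' := fun h h' => by
        simp only [Pi.add_apply, map_add, LinearMap.add_comp, Finset.sum_add_distrib]
      map_smul' := fun c h => by
        simp only [Pi.smul_apply, map_smul, LinearMap.smul_comp, Finset.smul_sum,
          RingHom.id_apply] }
  have hD : ∀ h w, D h w = ∑ j, h j ⬝ᵥ w j := fun h w => by
    simp [D, LinearMap.sum_apply, dotProductEquiv_apply_apply]
  have hinj : Function.Injective D := by
    rw [← LinearMap.ker_eq_bot, LinearMap.ker_eq_bot']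
    intro h hh
    ext j i
    have := LinearMap.congr_fun hh (Pi.single j (Pi.single i 1))
    rw [hD, Finset.sum_eq_single j (fun k _ hk => by rw [Pi.single_eq_of_ne hk]; simp)
      (by simp)] at this
    simpa using this
  have himg : A.map D = (powSpan u e s).dualAnnihilator := by
    ext f
    rw [Submodule.mem_map, Submodule.mem_dualAnnihilator]
    have hiff : ∀ h, (h ∈ A ↔ ∀ w ∈ powSpan u e s, D h w = 0) := by
      intro h
      rw [hA]
      constructor
      · intro hs w hw
        have : powSpan u e s ≤ LinearMap.ker (D h) := by
          refine Submodule.span_le.2 ?_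
          rintro _ ⟨v, hv, rfl⟩
          rw [SetLike.mem_coe, LinearMap.mem_ker, hD, ← eval_powForm]
          exact hs v hv
        exact this hw
      · intro hs v hv
        rw [eval_powForm, ← hD]
        exact hs _ (powVec_mem_powSpan hv)
    constructor
    · rintro ⟨h, hh, rfl⟩
      exact (hiff h).1 hh
    · intro hf
      obtain ⟨h, hh⟩ := exists_sum_dotProduct_of_dual f
      have : f = D h := LinearMap.ext fun w => by rw [hh, hD]
      subst this
      exact ⟨h, (hiff h).2 hf, rfl⟩
  rw [← himg]
  exact (Submodule.equivMapOfInjective D hinj A).finrank_eq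

/-- The families h whose form vanishes on X are the annihilator of the span of the tensors. The map
`powForm` is not injective when e > 0, owing to x · y = y · x, but its kernel enters both dimension
counts and cancels. -/
theorem numConditions_axis [Infinite K] (u : Fin 2 → Fin (n + 1) → K) (e : ℕ)
    (X : Set (Projectivization K (Fin (n + 1) → K))) :
    numConditions (linIdeal (axis u) ^ e) (projIdeal X) (e + 1) =
      Module.finrank K (powSpan u e (cone X)) := by
  let T := powForm u e
  let N := piece (projIdeal X ⊓ linIdeal (axis u) ^ e) (e + 1)
  have hN : N ≤ LinearMap.range T := by
    rw [range_powForm]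
    exact fun f hf => ⟨hf.1.2, hf.2⟩
  have h1 := numConditions_add_finrank (linIdeal (axis u) ^ e) (projIdeal X) (e + 1)
  change _ + Module.finrank K N = _ at h1
  have h2 := finrank_annihilator_powSpan u e (cone X) (N.comap T) fun h => by
    rw [← mem_projIdeal_iff_cone, Submodule.mem_comap]
    refine ⟨fun hh => hh.1.1, fun hh => ?_⟩
    have : T h ∈ piece (linIdeal (axis u) ^ e) (e + 1) := by
      rw [← range_powForm]
      exact ⟨h, rfl⟩
    exact ⟨⟨hh, this.1⟩, this.2⟩
  have h3 := finrank_eq_finrank_map_add T (N.comap T)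
  rw [Submodule.map_comap_eq_of_le hN,
    inf_eq_right.2 (Submodule.comap_bot T ▸ Submodule.comap_mono bot_le)] at h3
  have h4 := LinearMap.finrank_range_add_finrank_ker T
  rw [range_powForm] at h4
  omega

/-! ### Partition of vectors into independent sets -/

/-- The vector `c ⊗ v`. -/
def tens (d : ℕ) (c : Fin d → K) (v : Fin (n + 1) → K) : Fin d → Fin (n + 1) → K :=
  fun i => c i • v

/-- For each of the finitely many T, independence on T is an open condition on the coefficients. A
point off the product of the corresponding polynomials is as independent as possible on all T at
once. -/
theorem exists_generic_tens [Infinite K] {E : Type*} [Finite E] (v : E → Fin (n + 1) → K) (d : ℕ) :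
    ∃ c : E → Fin d → K, ∀ T : Finset E,
      (∃ c' : E → Fin d → K, LinearIndepOn K (fun e => tens d (c' e) (v e)) (T : Set E)) →
        LinearIndepOn K (fun e => tens d (c e) (v e)) (T : Set E) := by
  classical
  have := Fintype.ofFinite E
  have key : ∀ T : Finset E, ∃ p : MvPolynomial (E × Fin d) K, p ≠ 0 ∧
      ∀ x, eval x p ≠ 0 →
      (∃ c' : E → Fin d → K, LinearIndepOn K (fun e => tens d (c' e) (v e)) (T : Set E)) →
        LinearIndepOn K (fun e => tens d (fun i => x (e, i)) (v e)) (T : Set E) := by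
    intro T
    by_cases h : ∃ c' : E → Fin d → K, LinearIndepOn K (fun e => tens d (c' e) (v e)) (T : Set E)
    · obtain ⟨c', hc'⟩ := h
      have hiff : ∀ x : E × Fin d → K,
          LinearIndependent K (fun (e : (T : Set E)) (k : Fin d × Fin (n + 1)) =>
            eval x (X ((e : E), k.1) * C (v e k.2) : MvPolynomial (E × Fin d) K)) ↔
          LinearIndepOn K (fun e => tens d (fun i => x (e, i)) (v e)) (T : Set E) := by
        intro x
        simp only [map_mul, eval_X, eval_C]
        exact (LinearEquiv.curry K K (Fin d) (Fin (n + 1))).toLinearMap.linearIndependent_iff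
          (v := fun (e : (T : Set E)) (k : Fin d × Fin (n + 1)) => x ((e : E), k.1) * v e k.2)
          (LinearEquiv.ker _) |>.symm
      obtain ⟨p, hp, h⟩ := exists_poly_linearIndependent _ (fun ei : E × Fin d => c' ei.1 ei.2)
        ((hiff _).2 hc')
      exact ⟨p, fun h0 => hp (by rw [h0, map_zero]), fun x hx _ => (hiff x).1 (h x hx)⟩
    · exact ⟨1, one_ne_zero, fun x _ h' => absurd h' h⟩
  choose p hp0 hp using key
  obtain ⟨x, hx⟩ : ∃ x, eval x (∏ T, p T) ≠ 0 := by
    by_contra! hc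
    exact Finset.prod_ne_zero_iff.2 (fun T _ => hp0 T)
      (MvPolynomial.funext fun x => by rw [hc, map_zero])
  rw [map_prod, Finset.prod_ne_zero_iff] at hx
  exact ⟨fun e i => x (e, i), fun T hT => hp T x (hx T (Finset.mem_univ _)) hT⟩

theorem linearIndepOn_tens_update {E : Type*} [DecidableEq E] {v : E → Fin (n + 1) → K} {d : ℕ}
    {c : E → Fin d → K} {s : Set E} {e : E} (he : e ∉ s)
    (hs : LinearIndepOn K (fun e => tens d (c e) (v e)) s) {x : Fin d → K}
    (hx : tens d x (v e) ∉ Submodule.span K ((fun e => tens d (c e) (v e)) '' s)) :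
    LinearIndepOn K (fun e' => tens d (Function.update c e x e') (v e')) (insert e s) := by
  have heq : Set.EqOn (fun e => tens d (c e) (v e))
      (fun e' => tens d (Function.update c e x e') (v e')) s := by
    intro e' he'
    have : e' ≠ e := fun h => he (h ▸ he')
    simp [Function.update_of_ne this]
  rw [linearIndepOn_insert he, ← heq.image_eq]
  refine ⟨hs.congr heq, ?_⟩
  simpa using hx

/-- Suppose the generic tensors are dependent on a minimal T. By genericity no change of one
coefficient vector restores independence, so every x ⊗ v_e with e in T lies in their span. The span
then contains K^d ⊗ span v(T), whose dimension is at least |T| by hypothesis, a contradiction. -/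
theorem exists_linearIndependent_tens [Infinite K] {E : Type*} [Finite E]
    (v : E → Fin (n + 1) → K) (d : ℕ)
    (h : ∀ T : Finset E, T.card ≤ d * Module.finrank K (Submodule.span K (v '' T))) :
    ∃ c : E → Fin d → K, LinearIndependent K fun e => tens d (c e) (v e) := by
  classical
  have := Fintype.ofFinite E
  obtain ⟨c, hc⟩ := exists_generic_tens v d
  have key : ∀ T : Finset E, LinearIndepOn K (fun e => tens d (c e) (v e)) (T : Set E) := by
    intro T
    induction T using Finset.strongInduction with
    | H T ih =>
      by_contra hT
      have hmem : ∀ e ∈ T, ∀ x, tens d x (v e) ∈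
          Submodule.span K ((fun e => tens d (c e) (v e)) '' (T : Set E)) := by
        intro e he x
        by_contra hx
        refine hT (hc T ⟨Function.update c e x, ?_⟩)
        have h1 := linearIndepOn_tens_update (s := ((T.erase e : Finset E) : Set E)) (by simp)
          (ih _ (Finset.erase_ssubset he)) (x := x) fun h' => hx (Submodule.span_mono
            (Set.image_mono (Finset.coe_subset.2 (Finset.erase_subset e T))) h')
        rwa [← Finset.coe_insert, Finset.insert_erase he] at h1
      apply hT
      have hspan : (fun e => tens d (c e) (v e)) '' (T : Set E) =
          Set.range fun e : (T : Set E) => tens d (c e) (v e) := by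
        rw [Set.image_eq_range]
      refine linearIndependent_iff_card_le_finrank_span.2 ?_
      have hle : d * Module.finrank K (Submodule.span K (v '' T)) ≤ Module.finrank K
          (Submodule.span K ((fun e => tens d (c e) (v e)) '' (T : Set E))) := by
        have hcard : Module.finrank K (Fin d → Submodule.span K (v '' (T : Set E))) =
            d * Module.finrank K (Submodule.span K (v '' (T : Set E))) := by
          rw [Module.finrank_pi_fintype]
          simp
        rw [← hcard]
        have hsingle : ∀ i, Submodule.span K (v '' (T : Set E)) ≤
            (Submodule.span K ((fun e => tens d (c e) (v e)) '' (T : Set E))).comap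
              (LinearMap.single K (fun _ : Fin d => Fin (n + 1) → K) i) := by
          intro i
          rw [Submodule.span_le]
          rintro _ ⟨e, he, rfl⟩
          have := hmem e he (Pi.single i 1)
          rw [SetLike.mem_coe, Submodule.mem_comap]
          convert this using 1
          ext j k
          by_cases hj : j = i
          · subst hj; simp [tens]
          · simp [tens, hj]
        refine LinearMap.finrank_le_finrank_of_injective
          (f := (LinearMap.pi fun i => (Submodule.subtype _) ∘ₗ LinearMap.proj i).codRestrict _
            fun w => ?_) ?_
        · rw [← Finset.univ_sum_single ((LinearMap.pi fun i =>
            (Submodule.subtype _) ∘ₗ LinearMap.proj i) w)]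
          exact Submodule.sum_mem _ fun i _ => hsingle i (w i).2
        · intro w w' hw
          ext i : 2
          exact congrFun (congrArg Subtype.val hw) i
      have h2 := (h T).trans hle
      rw [hspan] at h2
      rw [Set.finrank]
      refine le_trans (le_of_eq ?_) h2
      simp
  exact ⟨c, by simpa [linearIndepOn_univ_iff] using key Finset.univ⟩

/-- Edmonds' theorem: if every set of vectors has at most `d` times as many members as its rank,
the vectors can be partitioned into `d` independent sets. -/
theorem exists_partition_linearIndepOn [Infinite K] {E : Type*} [Finite E]
    (v : E → Fin (n + 1) → K) (d : ℕ)
    (h : ∀ T : Finset E, T.card ≤ d * Module.finrank K (Submodule.span K (v '' T))) :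
    ∃ κ : E → Fin d, ∀ i, LinearIndepOn K v {e | κ e = i} := by
  classical
  have := Fintype.ofFinite E
  have key : ∀ F : Finset E, ∃ c : E → Fin d → K,
      LinearIndependent K (fun e => tens d (c e) (v e)) ∧ ∀ e ∈ F, ∃ i, c e = Pi.single i 1 := by
    intro F
    induction F using Finset.induction_on with
    | empty =>
      obtain ⟨c, hc⟩ := exists_linearIndependent_tens v d h
      exact ⟨c, hc, fun e he => absurd he (Finset.notMem_empty e)⟩
    | insert e F he ih =>
      obtain ⟨c, hc, hF⟩ := ih
      have huniv : insert e ({e}ᶜ : Set E) = Set.univ := by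
        ext x; by_cases hx : x = e <;> simp [hx]
      have hne : e ∉ ({e}ᶜ : Set E) := by simp
      have hc' := hc.linearIndepOn Set.univ
      rw [← huniv, linearIndepOn_insert hne] at hc'
      -- The tensor c_e ⊗ v_e is a combination of the pure e_i ⊗ v_e, so one of these lies outside
      -- the span of the other tensors and can replace it. Once every coefficient vector is a
      -- coordinate vector, its index is the colour.
      obtain ⟨i, hi⟩ : ∃ i, tens d (Pi.single i 1) (v e) ∉
          Submodule.span K ((fun e => tens d (c e) (v e)) '' {e}ᶜ) := by
        by_contra! hall
        refine hc'.2 ?_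
        have : tens d (c e) (v e) = ∑ i, c e i • tens d (Pi.single i 1) (v e) := by
          ext j k
          simp only [tens, Finset.sum_apply, Pi.smul_apply, smul_eq_mul]
          rw [Finset.sum_eq_single j (fun i _ hi => by simp [Pi.single_eq_of_ne (Ne.symm hi)])
            (by simp)]
          simp
        rw [this]
        exact Submodule.sum_mem _ fun i _ => Submodule.smul_mem _ _ (hall i)
      refine ⟨Function.update c e (Pi.single i 1), ?_, fun e' he' => ?_⟩
      · have := linearIndepOn_tens_update hne hc'.1 hi
        rwa [huniv, linearIndepOn_univ_iff] at this
      · rcases Finset.mem_insert.1 he' with rfl | hF'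
        · exact ⟨i, by simp⟩
        · have : e' ≠ e := fun h' => he (h' ▸ hF')
          rw [Function.update_of_ne this]
          exact hF e' hF'
  obtain ⟨c, hc, hcF⟩ := key Finset.univ
  choose κ hκ using fun e => hcF e (Finset.mem_univ e)
  refine ⟨κ, fun i => ?_⟩
  have h1 : LinearIndepOn K (fun e => tens d (c e) (v e)) {e | κ e = i} := hc.linearIndepOn _
  refine LinearIndependent.of_comp (LinearMap.single K (fun _ : Fin d => Fin (n + 1) → K) i) ?_
  have hfun : (LinearMap.single K (fun _ : Fin d => Fin (n + 1) → K) i ∘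
      fun e : {e | κ e = i} => v e) = fun e : {e | κ e = i} => tens d (c e) (v e) := by
    ext ⟨e, rfl⟩ j k
    rw [hκ]
    by_cases hj : j = κ e
    · subst hj; simp [tens]
    · simp [tens, hj]
  rw [hfun]
  exact h1

/-! ### Sparse sets of points -/

open Classical in
/-- The points of a finite set that lie in a linear subspace. -/
def pointsIn (W : Finset (Projectivization K (Fin (n + 1) → K)))
    (H : Submodule K (Fin (n + 1) → K)) : Finset (Projectivization K (Fin (n + 1) → K)) :=
  W.filter fun p => p.submodule ≤ H

theorem mem_pointsIn {W : Finset (Projectivization K (Fin (n + 1) → K))}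
    {H : Submodule K (Fin (n + 1) → K)} {p : Projectivization K (Fin (n + 1) → K)} :
    p ∈ pointsIn W H ↔ p ∈ W ∧ p.submodule ≤ H := by
  simp [pointsIn]

/-- Every linear subspace `H` contains at most `d * dim H + 1` points of the set. -/
def IsSparse (d : ℕ) (W : Finset (Projectivization K (Fin (n + 1) → K))) : Prop :=
  ∀ H : Submodule K (Fin (n + 1) → K), H ≠ ⊥ →
    (pointsIn W H).card ≤ d * (Module.finrank K H - 1) + 1

theorem submodule_le_iff {p : Projectivization K (Fin (n + 1) → K)}
    {H : Submodule K (Fin (n + 1) → K)} : p.submodule ≤ H ↔ p.rep ∈ H := by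
  rw [p.submodule_eq, Submodule.span_singleton_le_iff_mem]

theorem ne_bot_of_submodule_le {p : Projectivization K (Fin (n + 1) → K)}
    {H : Submodule K (Fin (n + 1) → K)} (h : p.submodule ≤ H) : H ≠ ⊥ := by
  rintro rfl
  exact p.rep_nonzero ((Submodule.mem_bot K).1 (submodule_le_iff.1 h))

theorem eval_smul_of_isHomogeneous {f : MvPolynomial (Fin (n + 1)) K} {d : ℕ}
    (hf : f.IsHomogeneous d) (c : K) (v : Fin (n + 1) → K) :
    eval (c • v) f = c ^ d * eval v f := by
  rw [eval_eq, eval_eq, Finset.mul_sum]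
  refine Finset.sum_congr rfl fun m hm => ?_
  have hd := hf.degree_eq_sum_deg_support hm
  simp only [Pi.smul_apply, smul_eq_mul, mul_pow, Finset.prod_mul_distrib,
    Finset.prod_pow_eq_pow_sum]
  rw [hd]
  ring_nf

theorem eval_eq_zero_of_mem_submodule {f : MvPolynomial (Fin (n + 1)) K} {d : ℕ}
    (hf : f.IsHomogeneous d) {p : Projectivization K (Fin (n + 1) → K)}
    (h : eval p.rep f = 0) {v : Fin (n + 1) → K} (hv : v ∈ p.submodule) :
    eval v f = 0 := by
  rw [p.submodule_eq] at hv
  obtain ⟨c, rfl⟩ := Submodule.mem_span_singleton.1 hv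
  rw [eval_smul_of_isHomogeneous hf, h, mul_zero]

/-- Project from p. A set T of other points whose projections have rank ρ spans with p a subspace of
rank at most ρ + 1, so sparseness gives |T| + 1 ≤ dρ + 1, which is Edmonds' condition. Each of the d
resulting classes lies in a hyperplane that misses p, and the form is the product of these
hyperplanes. -/
theorem IsSparse.exists_separating_form [Infinite K] {d : ℕ}
    {W : Finset (Projectivization K (Fin (n + 1) → K))} (hW : IsSparse d W)
    {p : Projectivization K (Fin (n + 1) → K)} (hp : p ∈ W) :
    ∃ f : MvPolynomial (Fin (n + 1)) K, f.IsHomogeneous d ∧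
      (∀ q ∈ W, q ≠ p → eval q.rep f = 0) ∧ eval p.rep f ≠ 0 := by
  classical
  obtain ⟨w, hw, -⟩ := exists_dotProduct_ne_zero_of_notMem (U := ⊥)
    (fun h => p.rep_nonzero ((Submodule.mem_bot K).1 h))
  have : Finite {q // q ∈ W ∧ q ≠ p} :=
    Finite.of_injective (fun q => (⟨q.1, q.2.1⟩ : W)) fun q q' h => by
      simpa [Subtype.ext_iff] using h
  let π : (Fin (n + 1) → K) →ₗ[K] (Fin (n + 1) → K) :=
    LinearMap.id - ((w ⬝ᵥ p.rep)⁻¹ • dotProductEquiv K (Fin (n + 1)) w).smulRight p.rep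
  have hπ : ∀ x, π x = x - ((w ⬝ᵥ p.rep)⁻¹ * (w ⬝ᵥ x)) • p.rep := fun x => rfl
  have hπp : π p.rep = 0 := by rw [hπ, inv_mul_cancel₀ hw, one_smul, sub_self]
  obtain ⟨κ, hκ⟩ := exists_partition_linearIndepOn
    (fun q : {q // q ∈ W ∧ q ≠ p} => π q.1.rep) d (by
      intro T
      let H := Submodule.span K (insert p.rep ((fun q : {q // q ∈ W ∧ q ≠ p} => q.1.rep) '' T))
      have hpH : p.submodule ≤ H := submodule_le_iff.2 (Submodule.subset_span (Set.mem_insert _ _))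
      have h1 := hW H (ne_bot_of_submodule_le hpH)
      have h2 : T.card + 1 ≤ (pointsIn W H).card := by
        rw [← Finset.card_image_of_injective T Subtype.val_injective,
          ← Finset.card_insert_of_notMem (a := p) (by simp)]
        refine Finset.card_le_card fun q hq => ?_
        rw [mem_pointsIn]
        rcases Finset.mem_insert.1 hq with rfl | hq
        · exact ⟨hp, hpH⟩
        · obtain ⟨q, hqT, rfl⟩ := Finset.mem_image.1 hq
          exact ⟨q.2.1, submodule_le_iff.2 (Submodule.subset_span
            (Set.mem_insert_of_mem _ ⟨q, hqT, rfl⟩))⟩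
      have h3 : Module.finrank K H ≤ 1 + Module.finrank K
          (Submodule.span K ((fun q : {q // q ∈ W ∧ q ≠ p} => π q.1.rep) '' T)) := by
        have hle : H ≤ (K ∙ p.rep) ⊔
            Submodule.span K ((fun q : {q // q ∈ W ∧ q ≠ p} => π q.1.rep) '' T) := by
          rw [Submodule.span_le, Set.insert_subset_iff]
          refine ⟨Submodule.mem_sup_left (Submodule.mem_span_singleton_self _), ?_⟩
          rintro _ ⟨q, hq, rfl⟩
          have : q.1.rep = ((w ⬝ᵥ p.rep)⁻¹ * (w ⬝ᵥ q.1.rep)) • p.rep + π q.1.rep := by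
            rw [hπ]; abel
          rw [SetLike.mem_coe]
          beta_reduce
          rw [this]
          exact Submodule.add_mem_sup (Submodule.smul_mem _ _ (Submodule.mem_span_singleton_self _))
            (Submodule.subset_span ⟨q, hq, rfl⟩)
        refine (Submodule.finrank_mono hle).trans
          ((Submodule.finrank_add_le_finrank_add_finrank _ _).trans ?_)
        rw [finrank_span_singleton p.rep_nonzero]
      have h4 := Nat.mul_le_mul_left d (Nat.sub_le_iff_le_add'.2 h3)
      omega)
  have hex : ∀ i, ∃ m : Fin (n + 1) → K, m ⬝ᵥ p.rep ≠ 0 ∧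
      ∀ q : {q // q ∈ W ∧ q ≠ p}, κ q = i → m ⬝ᵥ q.1.rep = 0 := by
    intro i
    -- The projection kills p, so writing p as a combination of the class would give a relation
    -- between projections that are independent.
    have hnot : p.rep ∉ Submodule.span K (Set.range fun q : {q | κ q = i} => q.1.1.rep) := by
      intro hmem
      have := Fintype.ofFinite {q | κ q = i}
      obtain ⟨c, hc⟩ := (Submodule.mem_span_range_iff_exists_fun K).1 hmem
      have h0 := congrArg π hc
      rw [hπp, map_sum] at h0
      simp only [map_smul] at h0
      have hc0 := Fintype.linearIndependent_iff.1 (hκ i) c h0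
      exact p.rep_nonzero (by rw [← hc]; simp [hc0])
    obtain ⟨m, hm, hm0⟩ := exists_dotProduct_ne_zero_of_notMem hnot
    exact ⟨m, hm, fun q hq => hm0 _ (Submodule.subset_span ⟨⟨q, hq⟩, rfl⟩)⟩
  choose m hm hm0 using hex
  refine ⟨∏ i, linForm (m i), ?_, fun q hq hqp => ?_, ?_⟩
  · have := IsHomogeneous.prod Finset.univ (fun i => linForm (m i)) (fun _ => 1)
      fun i _ => linForm_isHomogeneous (m i)
    simpa using this
  · rw [map_prod]
    refine Finset.prod_eq_zero (Finset.mem_univ (κ ⟨q, hq, hqp⟩)) ?_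
    rw [eval_linForm]
    exact hm0 _ ⟨q, hq, hqp⟩ rfl
  · rw [map_prod, Finset.prod_ne_zero_iff]
    exact fun i _ => by rw [eval_linForm]; exact hm i

/-! ### Conditions imposed on all forms of degree d. -/

/-- Evaluation of forms of degree `d` at the points of a finite set. -/
def evalPoints (W : Finset (Projectivization K (Fin (n + 1) → K))) (d : ℕ) :
    piece (⊤ : Ideal (MvPolynomial (Fin (n + 1)) K)) d →ₗ[K] (W → K) :=
  LinearMap.pi fun q => (aeval (R := K) q.1.rep).toLinearMap ∘ₗ Submodule.subtype _

theorem numConditions_top (W : Finset (Projectivization K (Fin (n + 1) → K))) (d : ℕ) :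
    numConditions ⊤ (projIdeal (W : Set (Projectivization K (Fin (n + 1) → K)))) d =
      Module.finrank K (LinearMap.range (evalPoints W d)) := by
  have h1 := numConditions_add_finrank ⊤
    (projIdeal (W : Set (Projectivization K (Fin (n + 1) → K)))) d
  have h2 := LinearMap.finrank_range_add_finrank_ker (evalPoints W d)
  have h3 : LinearMap.ker (evalPoints W d) = (piece (projIdeal
      (W : Set (Projectivization K (Fin (n + 1) → K))) ⊓ ⊤) d).submoduleOf (piece ⊤ d) := by
    ext f
    rw [Submodule.submoduleOf, Submodule.mem_comap, mem_piece, LinearMap.mem_ker]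
    constructor
    · intro h
      refine ⟨⟨mem_projIdeal.2 fun q hq v hv => ?_, trivial⟩, f.2.2⟩
      exact eval_eq_zero_of_mem_submodule f.2.2 (congrFun h ⟨q, hq⟩) hv
    · intro h
      ext q
      exact mem_projIdeal.1 h.1.1 q.1 q.2 _ (submodule_le_iff.1 le_rfl)
  have hle : piece (projIdeal (W : Set (Projectivization K (Fin (n + 1) → K))) ⊓ ⊤) d ≤
      piece ⊤ d := fun f hf => ⟨trivial, hf.2⟩
  rw [h3, (Submodule.submoduleOfEquivOfLe hle).finrank_eq] at h2
  omega

theorem numConditions_top_le_card (W : Finset (Projectivization K (Fin (n + 1) → K))) (d : ℕ) :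
    numConditions ⊤ (projIdeal (W : Set (Projectivization K (Fin (n + 1) → K)))) d ≤ W.card := by
  rw [numConditions_top]
  refine (Submodule.finrank_le _).trans ?_
  simp

theorem IsSparse.numConditions_top [Infinite K] {d : ℕ}
    {W : Finset (Projectivization K (Fin (n + 1) → K))} (hW : IsSparse d W) :
    numConditions ⊤ (projIdeal (W : Set (Projectivization K (Fin (n + 1) → K)))) d = W.card := by
  classical
  rw [PointConfig.numConditions_top]
  have : LinearMap.range (evalPoints W d) = ⊤ := by
    rw [eq_top_iff, ← (Pi.basisFun K W).span_eq, Submodule.span_le]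
    rintro _ ⟨p, rfl⟩
    obtain ⟨f, hf, hq, hp⟩ := hW.exists_separating_form p.2
    refine ⟨(eval p.1.rep f)⁻¹ • ⟨f, trivial, hf⟩, ?_⟩
    ext q
    rw [map_smul, Pi.smul_apply, Pi.basisFun_apply]
    change (eval p.1.rep f)⁻¹ • eval q.1.rep f = _
    by_cases hqp : q = p
    · subst hqp
      simp [hp]
    · rw [hq q.1 q.2 fun h => hqp (Subtype.ext h), Pi.single_eq_of_ne hqp, smul_zero]
  rw [this, finrank_top]
  simp

/-! ### Tight subspaces -/

/-- A subspace in which a sparse set attains the bound. -/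
def IsTight (d : ℕ) (W : Finset (Projectivization K (Fin (n + 1) → K)))
    (H : Submodule K (Fin (n + 1) → K)) : Prop :=
  H ≠ ⊥ ∧ (pointsIn W H).card = d * (Module.finrank K H - 1) + 1

/-- The bound d dim + 1 is modular in H, while the number of points is supermodular; equality at H
and H' with the bound at H ⊓ H' forces equality at H ⊔ H'. The intersection must be nonzero because
the bound is assumed only for nonempty projective subspaces. -/
theorem IsTight.sup {d : ℕ} {W : Finset (Projectivization K (Fin (n + 1) → K))}
    (hW : IsSparse d W) {H H' : Submodule K (Fin (n + 1) → K)} (h : IsTight d W H)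
    (h' : IsTight d W H') (hne : H ⊓ H' ≠ ⊥) : IsTight d W (H ⊔ H') := by
  classical
  have hsup : H ⊔ H' ≠ ⊥ := fun h0 => h.1 (le_bot_iff.1 (h0 ▸ le_sup_left))
  refine ⟨hsup, le_antisymm (hW _ hsup) ?_⟩
  have h1 := hW _ hne
  have h2 := Submodule.finrank_sup_add_finrank_inf_eq H H'
  have h3 : pointsIn W H ∪ pointsIn W H' ⊆ pointsIn W (H ⊔ H') := by
    intro p hp
    rw [Finset.mem_union, mem_pointsIn, mem_pointsIn] at hp
    rw [mem_pointsIn]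
    rcases hp with hp | hp
    · exact ⟨hp.1, hp.2.trans le_sup_left⟩
    · exact ⟨hp.1, hp.2.trans le_sup_right⟩
  have h4 : pointsIn W H ∩ pointsIn W H' ⊆ pointsIn W (H ⊓ H') := by
    intro p hp
    rw [Finset.mem_inter, mem_pointsIn, mem_pointsIn] at hp
    rw [mem_pointsIn]
    exact ⟨hp.1.1, le_inf hp.1.2 hp.2.2⟩
  have h5 := Finset.card_union_add_card_inter (pointsIn W H) (pointsIn W H')
  have h6 := Finset.card_le_card h3
  have h7 := Finset.card_le_card h4
  rw [h.2, h'.2] at h5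
  have hpos : ∀ {L : Submodule K (Fin (n + 1) → K)}, L ≠ ⊥ → 1 ≤ Module.finrank K L :=
    fun hL => Submodule.one_le_finrank_iff.2 hL
  have p1 := hpos h.1
  have p2 := hpos h'.1
  have p3 := hpos hne
  have p4 := hpos hsup
  have h8 : d * (Module.finrank K H - 1) + d * (Module.finrank K H' - 1) =
      d * (Module.finrank K (H ⊔ H' : Submodule K _) - 1) +
      d * (Module.finrank K (H ⊓ H' : Submodule K _) - 1) := by
    rw [← mul_add, ← mul_add]
    congr 1
    omega
  omega

/-! ### Covers by linear subspaces and maximal sparse sets. -/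

theorem exC_le {Z : Finset (Projectivization K (Fin (n + 1) → K))} {d : ℕ}
    {𝓗 : Finset (Submodule K (Fin (n + 1) → K))} (h0 : ∀ H ∈ 𝓗, H ≠ ⊥)
    (hZ : ∀ p ∈ Z, ∃ H ∈ 𝓗, p.submodule ≤ H) :
    exC Z d ≤ ∑ H ∈ 𝓗, (d * (Module.finrank K H - 1) + 1) :=
  Nat.sInf_le ⟨𝓗, h0, hZ, rfl⟩

theorem exists_cover_eq_exC (Z : Finset (Projectivization K (Fin (n + 1) → K))) (d : ℕ) :
    ∃ 𝓗 : Finset (Submodule K (Fin (n + 1) → K)), (∀ H ∈ 𝓗, H ≠ ⊥) ∧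
      (∀ p ∈ Z, ∃ H ∈ 𝓗, p.submodule ≤ H) ∧
      exC Z d = ∑ H ∈ 𝓗, (d * (Module.finrank K H - 1) + 1) :=
  Nat.sInf_mem (s := {c | ∃ 𝓗 : Finset (Submodule K (Fin (n + 1) → K)),
    (∀ H ∈ 𝓗, H ≠ ⊥) ∧ (∀ p ∈ Z, ∃ H ∈ 𝓗, p.submodule ≤ H) ∧
    c = ∑ H ∈ 𝓗, (d * (Module.finrank K H - 1) + 1)})
    ⟨_, {⊤}, by simp, by simp, rfl⟩

/-- Every z in Z lies in a tight subspace: z itself if z is in W, and otherwise a subspace where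
adding z would break sparseness. Maximal tight subspaces that share a point coincide, so they form a
cover of Z whose cost is the number of points of W in it, each counted once. -/
theorem exC_le_card_of_maximal {Z W : Finset (Projectivization K (Fin (n + 1) → K))} {d : ℕ}
    (hW : IsSparse d W)
    (hmax : ∀ W', IsSparse d W' → W ⊆ W' → W' ⊆ Z → W' ⊆ W) (hWZ : W ⊆ Z) :
    exC Z d ≤ W.card := by
  classical
  have hcov : ∀ z ∈ Z, ∃ H, IsTight d W H ∧ z.submodule ≤ H := by
    intro z hz
    by_cases hzW : z ∈ W
    · refine ⟨z.submodule, ⟨ne_bot_of_submodule_le le_rfl, le_antisymm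
        (hW _ (ne_bot_of_submodule_le le_rfl)) ?_⟩, le_rfl⟩
      rw [z.finrank_submodule]
      have : 1 ≤ (pointsIn W z.submodule).card :=
        Finset.card_pos.2 ⟨z, mem_pointsIn.2 ⟨hzW, le_rfl⟩⟩
      simpa using this
    · have hns : ¬ IsSparse d (insert z W) := fun h =>
        hzW (hmax _ h (Finset.subset_insert z W) (Finset.insert_subset hz hWZ)
          (Finset.mem_insert_self z W))
      rw [IsSparse] at hns
      push Not at hns
      obtain ⟨H, hH, hcard⟩ := hns
      have h1 := hW H hH
      have hzH : z.submodule ≤ H := by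
        by_contra hzH
        have : pointsIn (insert z W) H ⊆ pointsIn W H := by
          intro p hp
          rw [mem_pointsIn, Finset.mem_insert] at hp
          rcases hp with ⟨rfl | hp, hpH⟩
          · exact absurd hpH hzH
          · exact mem_pointsIn.2 ⟨hp, hpH⟩
        have := Finset.card_le_card this
        omega
      have h2 : pointsIn (insert z W) H ⊆ insert z (pointsIn W H) := by
        intro p hp
        rw [mem_pointsIn, Finset.mem_insert] at hp
        rw [Finset.mem_insert, mem_pointsIn]
        exact hp.1.imp id fun h => ⟨h, hp.2⟩
      have h3 := (Finset.card_le_card h2).trans (Finset.card_insert_le _ _)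
      exact ⟨H, ⟨hH, by omega⟩, hzH⟩
  have hcov' : ∀ z : Z, ∃ H, Maximal (IsTight d W) H ∧ z.1.submodule ≤ H := by
    intro z
    obtain ⟨H, hH, hz⟩ := hcov z z.2
    obtain ⟨M, hM, hmaxM⟩ := exists_maximal_ge_of_wellFoundedGT (IsTight d W) H hH
    exact ⟨M, hmaxM, hz.trans hM⟩
  choose M hM hzM using hcov'
  refine (exC_le (𝓗 := Finset.univ.image M) ?_ ?_).trans ?_
  · intro H hH
    obtain ⟨z, -, rfl⟩ := Finset.mem_image.1 hH
    exact (hM z).prop.1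
  · exact fun p hp => ⟨M ⟨p, hp⟩, Finset.mem_image_of_mem _ (Finset.mem_univ _), hzM ⟨p, hp⟩⟩
  · have hmaxH : ∀ H ∈ Finset.univ.image M, Maximal (IsTight d W) H := by
      intro H hH
      obtain ⟨z, -, rfl⟩ := Finset.mem_image.1 hH
      exact hM z
    rw [Finset.sum_congr rfl fun H hH => ((hmaxH H hH).prop.2).symm, ← Finset.card_biUnion]
    · refine Finset.card_le_card fun p hp => ?_
      obtain ⟨H, -, hp⟩ := Finset.mem_biUnion.1 hp
      exact (mem_pointsIn.1 hp).1
    · intro H hH H' hH' hne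
      rw [Function.onFun, Finset.disjoint_left]
      intro p hp hp'
      have hinf : H ⊓ H' ≠ ⊥ :=
        ne_bot_of_submodule_le (le_inf (mem_pointsIn.1 hp).2 (mem_pointsIn.1 hp').2)
      have hs := (hmaxH H hH).prop.sup hW (hmaxH H' hH').prop hinf
      exact hne (((hmaxH H hH).eq_of_le hs le_sup_left).trans
        ((hmaxH H' hH').eq_of_le hs le_sup_right).symm)

/-! ### Restriction to a line -/

/-- The point of the line spanned by `u` that is orthogonal to `v`. -/
def linePoint (u : Fin 2 → Fin (n + 1) → K) (v : Fin (n + 1) → K) : Fin (n + 1) → K :=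
  (u 1 ⬝ᵥ v) • u 0 - (u 0 ⬝ᵥ v) • u 1

/-- Restriction to the line spanned by `u`, parametrised by `linePoint`. -/
def restr (u : Fin 2 → Fin (n + 1) → K) :
    MvPolynomial (Fin (n + 1)) K →ₐ[K] MvPolynomial (Fin (n + 1)) K :=
  aeval fun k => linForm (u 0 k • u 1 - u 1 k • u 0)

theorem eval_restr (u : Fin 2 → Fin (n + 1) → K) (v : Fin (n + 1) → K)
    (f : MvPolynomial (Fin (n + 1)) K) : eval v (restr u f) = eval (linePoint u v) f := by
  induction f using MvPolynomial.induction_on with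
  | C a => simp [restr]
  | add p q hp hq => simp only [map_add, hp, hq]
  | mul_X p i hp =>
    rw [map_mul, map_mul, map_mul, hp, restr, aeval_X, eval_linForm, eval_X]
    simp only [linePoint, sub_dotProduct, smul_dotProduct, Pi.sub_apply, Pi.smul_apply, smul_eq_mul]
    ring

theorem dotProduct_linePoint (u : Fin 2 → Fin (n + 1) → K) (w v : Fin (n + 1) → K) :
    w ⬝ᵥ linePoint u v = (u 1 ⬝ᵥ v) * (u 0 ⬝ᵥ w) - (u 0 ⬝ᵥ v) * (u 1 ⬝ᵥ w) := by
  rw [dotProduct_comm w]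
  simp only [linePoint, sub_dotProduct, smul_dotProduct, smul_eq_mul]

theorem linePoint_mem (u : Fin 2 → Fin (n + 1) → K) (v : Fin (n + 1) → K) :
    linePoint u v ∈ Submodule.span K (Set.range u) :=
  sub_mem (Submodule.smul_mem _ _ (Submodule.subset_span ⟨0, rfl⟩))
    (Submodule.smul_mem _ _ (Submodule.subset_span ⟨1, rfl⟩))

theorem mem_span_range_fin_two {u : Fin 2 → Fin (n + 1) → K} {x : Fin (n + 1) → K} :
    x ∈ Submodule.span K (Set.range u) ↔ ∃ a b : K, a • u 0 + b • u 1 = x := by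
  rw [Submodule.mem_span_range_iff_exists_fun]
  constructor
  · rintro ⟨c, rfl⟩
    exact ⟨c 0, c 1, by rw [Fin.sum_univ_two]⟩
  · rintro ⟨a, b, rfl⟩
    exact ⟨![a, b], by simp [Fin.sum_univ_two]⟩

theorem exists_linePoint_eq {u : Fin 2 → Fin (n + 1) → K} (hu : LinearIndependent K u)
    {x : Fin (n + 1) → K} (hx : x ∈ Submodule.span K (Set.range u)) : ∃ v, linePoint u v = x := by
  obtain ⟨a, b, rfl⟩ := mem_span_range_fin_two.1 hx
  obtain ⟨v, hv⟩ := exists_dotProduct_eq hu ![-b, a]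
  refine ⟨v, ?_⟩
  have h0 : u 0 ⬝ᵥ v = -b := by rw [dotProduct_comm]; simpa using hv 0
  have h1 : u 1 ⬝ᵥ v = a := by rw [dotProduct_comm]; simpa using hv 1
  rw [linePoint, h0, h1]
  simp

theorem restr_eq_zero_iff [Infinite K] {u : Fin 2 → Fin (n + 1) → K} (hu : LinearIndependent K u)
    {f : MvPolynomial (Fin (n + 1)) K} :
    restr u f = 0 ↔ f ∈ linIdeal (Submodule.span K (Set.range u)) := by
  rw [mem_linIdeal]
  constructor
  · intro h x hx
    obtain ⟨v, rfl⟩ := exists_linePoint_eq hu hx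
    rw [← eval_restr, h, map_zero]
  · intro h
    refine MvPolynomial.funext fun v => ?_
    rw [eval_restr, map_zero]
    exact h _ (linePoint_mem u v)

theorem restr_linForm (u : Fin 2 → Fin (n + 1) → K) (w : Fin (n + 1) → K) :
    restr u (linForm w) = linForm ((u 0 ⬝ᵥ w) • u 1 - (u 1 ⬝ᵥ w) • u 0) := by
  rw [linForm, map_sum]
  simp only [map_mul, restr, aeval_X, algHom_C, algebraMap_eq]
  simp only [sub_eq_add_neg, linForm_add, ← neg_smul, linForm_smul, mul_add, Finset.sum_add_distrib,
    ← mul_assoc, ← Finset.sum_mul, ← C_mul, ← map_sum, mul_neg, map_neg, Finset.sum_neg_distrib]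
  simp only [dotProduct, mul_comm]

theorem homogeneousComponent_restr (u : Fin 2 → Fin (n + 1) → K)
    (f : MvPolynomial (Fin (n + 1)) K) (m : ℕ) :
    homogeneousComponent m (restr u f) = restr u (homogeneousComponent m f) := by
  induction f using MvPolynomial.induction_on' with
  | monomial d c =>
    have hd := isHomogeneous_monomial (R := K) (d := d) c rfl
    have hd' : (restr u (monomial d c)).IsHomogeneous (1 * d.degree) :=
      hd.aeval _ fun i => linForm_isHomogeneous _
    rw [one_mul] at hd'
    rw [homogeneousComponent_of_mem hd, homogeneousComponent_of_mem hd']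
    split_ifs <;> simp
  | add p q hp hq => simp only [map_add, hp, hq]

theorem restr_isHomogeneous (u : Fin 2 → Fin (n + 1) → K) {f : MvPolynomial (Fin (n + 1)) K}
    {m : ℕ} (hf : f.IsHomogeneous m) : (restr u f).IsHomogeneous m := by
  have := hf.aeval (fun k => linForm (u 0 k • u 1 - u 1 k • u 0))
    fun i => linForm_isHomogeneous _
  rwa [one_mul] at this

/-! ### Forms in two linear forms -/

/-- The forms of degree `m` in the two linear forms given by `u`. -/
def binForms (u : Fin 2 → Fin (n + 1) → K) (m : ℕ) : Submodule K (MvPolynomial (Fin (n + 1)) K) :=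
  piece (linIdeal (axis u) ^ m) m

theorem restr_mem_binForms (u : Fin 2 → Fin (n + 1) → K) {f : MvPolynomial (Fin (n + 1)) K}
    {m : ℕ} (hf : f.IsHomogeneous m) : restr u f ∈ binForms u m := by
  refine ⟨?_, restr_isHomogeneous u hf⟩
  change restr u f ∈ linIdeal (axis u) ^ m
  rw [restr, aeval_def, eval₂_eq]
  refine Ideal.sum_mem _ fun d hd => Ideal.mul_mem_left _ _ ?_
  rw [hf.degree_eq_sum_deg_support hd, ← Finset.prod_pow_eq_pow_sum]
  refine Ideal.prod_mem_prod fun i _ => Ideal.pow_mem_pow ?_ _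
  rw [linForm_mem_linIdeal, axis, perp_perp]
  exact sub_mem (Submodule.smul_mem _ _ (Submodule.subset_span ⟨1, rfl⟩))
    (Submodule.smul_mem _ _ (Submodule.subset_span ⟨0, rfl⟩))

theorem exists_coeff_of_mem_binForms [Infinite K] {u : Fin 2 → Fin (n + 1) → K} {m : ℕ}
    {f : MvPolynomial (Fin (n + 1)) K} (hf : f ∈ binForms u m) :
    ∃ a : Fin (m + 1) → K,
      f = ∑ j, C (a j) * (linForm (u 1) ^ (j : ℕ) * linForm (u 0) ^ (m - j)) := by
  obtain ⟨c, hc, rfl⟩ := exists_eq_sum_of_mem_pow (r := 0) hf.2 hf.1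
  refine ⟨fun j => coeff 0 (c j), Finset.sum_congr rfl fun j _ => ?_⟩
  congr 1
  exact totalDegree_eq_zero_iff_eq_C.1 ((totalDegree_zero_iff_isHomogeneous _).2 (hc j))

/-- Linear forms that restrict to the two linear forms given by `u`. -/
theorem exists_restr_eq {u : Fin 2 → Fin (n + 1) → K} (hu : LinearIndependent K u) :
    ∃ s t : MvPolynomial (Fin (n + 1)) K, s.IsHomogeneous 1 ∧ t.IsHomogeneous 1 ∧
      restr u s = linForm (u 1) ∧ restr u t = linForm (u 0) := by
  obtain ⟨w, hw⟩ := exists_dotProduct_eq hu ![1, 0]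
  obtain ⟨w', hw'⟩ := exists_dotProduct_eq hu ![0, -1]
  refine ⟨linForm w, linForm w', linForm_isHomogeneous _, linForm_isHomogeneous _, ?_, ?_⟩
  · rw [restr_linForm, dotProduct_comm, hw 0, dotProduct_comm, hw 1]
    simp
  · rw [restr_linForm, dotProduct_comm, hw' 0, dotProduct_comm, hw' 1]
    simp

theorem exists_restr_eq_of_mem_binForms [Infinite K] {u : Fin 2 → Fin (n + 1) → K}
    (hu : LinearIndependent K u)
    {m : ℕ} {f : MvPolynomial (Fin (n + 1)) K} (hf : f ∈ binForms u m) :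
    ∃ g : MvPolynomial (Fin (n + 1)) K, g.IsHomogeneous m ∧ restr u g = f := by
  obtain ⟨a, rfl⟩ := exists_coeff_of_mem_binForms hf
  obtain ⟨s, t, hs, ht, hs', ht'⟩ := exists_restr_eq hu
  refine ⟨∑ j : Fin (m + 1), C (a j) * (s ^ (j : ℕ) * t ^ (m - j)), ?_, ?_⟩
  · refine IsHomogeneous.sum _ _ _ fun j _ => IsHomogeneous.C_mul ?_ _
    have := (hs.pow j).mul (ht.pow (m - j))
    convert this using 1
    omega
  · simp only [map_sum, map_mul, map_pow, hs', ht', algHom_C, algebraMap_eq]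

theorem pow_mul_pow_mem_binForms [Infinite K] (u : Fin 2 → Fin (n + 1) → K) (i j : ℕ) :
    linForm (u 1) ^ i * linForm (u 0) ^ j ∈ binForms u (i + j) := by
  constructor
  · have := pow_mul_pow_mem u (e := i + j) ⟨i, by omega⟩
    simpa using this
  · have := ((linForm_isHomogeneous (u 1)).pow i).mul ((linForm_isHomogeneous (u 0)).pow j)
    simpa using this

theorem finrank_binForms [Infinite K] {u : Fin 2 → Fin (n + 1) → K}
    (hu : LinearIndependent K u) (m : ℕ) :
    Module.finrank K (binForms u m) = m + 1 := by
  let T : (Fin (m + 1) → K) →ₗ[K] MvPolynomial (Fin (n + 1)) K :=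
    Fintype.linearCombination K fun j : Fin (m + 1) =>
      linForm (u 1) ^ (j : ℕ) * linForm (u 0) ^ (m - j)
  have hT : ∀ a, T a = ∑ j, C (a j) * (linForm (u 1) ^ (j : ℕ) * linForm (u 0) ^ (m - j)) :=
    fun a => by simp only [T, Fintype.linearCombination_apply, smul_eq_C_mul]
  have hrange : LinearMap.range T = binForms u m := by
    ext f
    constructor
    · rintro ⟨a, rfl⟩
      rw [hT]
      refine Submodule.sum_mem _ fun j _ => ?_
      rw [← smul_eq_C_mul]
      refine Submodule.smul_mem _ _ ?_
      have := pow_mul_pow_mem_binForms u j (m - j)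
      rwa [show (j : ℕ) + (m - j) = m by omega] at this
    · intro hf
      obtain ⟨a, rfl⟩ := exists_coeff_of_mem_binForms hf
      exact ⟨a, hT a⟩
  have hinj : Function.Injective T := by
    rw [← LinearMap.ker_eq_bot, LinearMap.ker_eq_bot']
    intro a ha
    -- Dehomogenisation: evaluate at vectors with y = 1 and x = t.
    have hp : (∑ j : Fin (m + 1), Polynomial.C (a j) * Polynomial.X ^ (j : ℕ)) = 0 := by
      refine Polynomial.funext fun t => ?_
      obtain ⟨v, hv⟩ := exists_dotProduct_eq hu ![1, t]
      have h0 : u 0 ⬝ᵥ v = 1 := by rw [dotProduct_comm]; simpa using hv 0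
      have h1 : u 1 ⬝ᵥ v = t := by rw [dotProduct_comm]; simpa using hv 1
      have := congrArg (eval v) ha
      rw [hT] at this
      simpa [h0, h1, Polynomial.eval_finsetSum] using this
    ext j
    have := congrArg (fun p => Polynomial.coeff p j) hp
    simpa [Polynomial.finsetSum_coeff, Polynomial.coeff_C_mul, Polynomial.coeff_X_pow,
      Fin.val_inj] using this
  rw [← hrange, LinearMap.finrank_range_of_inj hinj, Module.finrank_fin_fun]

theorem prime_linForm_of_linearIndependent [Infinite K] {u : Fin 2 → Fin (n + 1) → K}
    (hu : LinearIndependent K u) (i : Fin 2) : Prime (linForm (u i)) :=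
  linForm_prime (hu.ne_zero i)

theorem not_linForm_dvd [Infinite K] {u : Fin 2 → Fin (n + 1) → K} (hu : LinearIndependent K u) :
    ¬ linForm (u 1) ∣ linForm (u 0) := by
  rw [linForm_dvd_iff, Submodule.mem_span_singleton]
  rintro ⟨c, hc⟩
  have := Fintype.linearIndependent_iff.1 hu ![1, -c] (by simp [Fin.sum_univ_two, hc]) 0
  exact one_ne_zero this

theorem mem_pow_of_pow_mul_mem [Infinite K] {u : Fin 2 → Fin (n + 1) → K}
    (hu : LinearIndependent K u)
    {g : MvPolynomial (Fin (n + 1)) K} {m k : ℕ}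
    (h : linForm (u 1) ^ k * g ∈ linIdeal (axis u) ^ (m + k)) : g ∈ linIdeal (axis u) ^ m := by
  rw [linIdeal_axis] at h ⊢
  exact mem_span_pair_pow_of_pow_mul_mem (prime_linForm_of_linearIndependent hu 1)
    (not_linForm_dvd hu) k h

theorem pow_dvd_of_mul_eq [Infinite K] {u : Fin 2 → Fin (n + 1) → K} (hu : LinearIndependent K u)
    {f g : MvPolynomial (Fin (n + 1)) K} {k : ℕ}
    (h : linForm (u 0) ^ k * f = linForm (u 1) ^ k * g) : linForm (u 1) ^ k ∣ f :=
  (prime_linForm_of_linearIndependent hu 1).pow_dvd_of_dvd_mul_left k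
    (fun h' => not_linForm_dvd hu
      ((prime_linForm_of_linearIndependent hu 1).dvd_of_dvd_pow h')) ⟨g, h⟩

/-- Forms of degree `m + r` with multiplicity at least `m` that are divisible by a power. -/
theorem exists_eq_pow_mul [Infinite K] {u : Fin 2 → Fin (n + 1) → K} (hu : LinearIndependent K u)
    {f : MvPolynomial (Fin (n + 1)) K} {m r k : ℕ}
    (hf : f ∈ piece (linIdeal (axis u) ^ (m + k)) (m + k + r))
    (h : linForm (u 1) ^ k ∣ f) :
    ∃ g ∈ piece (linIdeal (axis u) ^ m) (m + r), f = linForm (u 1) ^ k * g := by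
  have hk := (linForm_isHomogeneous (u 1)).pow k
  rw [one_mul] at hk
  obtain ⟨g, hg, rfl⟩ := exists_homogeneous_factor (j := m + r) hk
    (by rw [show k + (m + r) = m + k + r by omega]; exact hf.2) h
  exact ⟨g, ⟨mem_pow_of_pow_mul_mem hu hf.1, hg⟩, rfl⟩

/-! ### Derivations and forms with multiplicity along a subspace of codimension two -/

theorem mkDerivation_linForm (g : Fin (n + 1) → MvPolynomial (Fin (n + 1)) K)
    (w : Fin (n + 1) → K) : mkDerivation K g (linForm w) = ∑ i, C (w i) * g i := by
  rw [linForm, map_sum]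
  refine Finset.sum_congr rfl fun i _ => ?_
  rw [← smul_eq_C_mul, ← smul_eq_C_mul, Derivation.map_smul, mkDerivation_X]

theorem linIdeal_perp_submodule [Infinite K] (p : Projectivization K (Fin (n + 1) → K)) :
    linIdeal (perp p.submodule) = Ideal.span {linForm p.rep} := by
  rw [p.submodule_eq, linIdeal_perp_singleton]

theorem mem_derModule_iff [Infinite K] {Z : Finset (Projectivization K (Fin (n + 1) → K))}
    {g : Fin (n + 1) → MvPolynomial (Fin (n + 1)) K} :
    g ∈ derModule (dualArrangement Z) ↔
      ∀ p ∈ Z, linForm p.rep ∣ ∑ i, C (p.rep i) * g i := by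
  constructor
  · intro h p hp
    have := h _ ⟨p, hp, rfl⟩ (linForm p.rep) (by
      rw [linIdeal_perp_submodule]
      exact Ideal.mem_span_singleton_self _)
    rwa [linIdeal_perp_submodule, Ideal.mem_span_singleton, mkDerivation_linForm] at this
  · rintro h _ ⟨p, hp, rfl⟩ f hf
    rw [linIdeal_perp_submodule, Ideal.mem_span_singleton] at hf ⊢
    obtain ⟨c, rfl⟩ := hf
    rw [Derivation.leibniz, mkDerivation_linForm, smul_eq_mul, smul_eq_mul]
    exact dvd_add (Dvd.intro _ rfl) (Dvd.dvd.mul_left (h p hp) _)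

/-- The form on the space of points attached to a derivation. -/
def dForm (u : Fin 2 → Fin (n + 1) → K) (g : Fin (n + 1) → MvPolynomial (Fin (n + 1)) K) :
    MvPolynomial (Fin (n + 1)) K :=
  ∑ i, X i * restr u (g i)

theorem dForm_add (u : Fin 2 → Fin (n + 1) → K)
    (g g' : Fin (n + 1) → MvPolynomial (Fin (n + 1)) K) :
    dForm u (g + g') = dForm u g + dForm u g' := by
  simp only [dForm, Pi.add_apply, map_add, mul_add, Finset.sum_add_distrib]

theorem dForm_smul (u : Fin 2 → Fin (n + 1) → K) (f : MvPolynomial (Fin (n + 1)) K)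
    (g : Fin (n + 1) → MvPolynomial (Fin (n + 1)) K) :
    dForm u (f • g) = restr u f * dForm u g := by
  simp only [dForm, Pi.smul_apply, smul_eq_mul, map_mul, Finset.mul_sum]
  exact Finset.sum_congr rfl fun i _ => by ring

theorem eval_dForm (u : Fin 2 → Fin (n + 1) → K)
    (g : Fin (n + 1) → MvPolynomial (Fin (n + 1)) K) (v : Fin (n + 1) → K) :
    eval v (dForm u g) = eval (linePoint u v) (∑ i, C (v i) * g i) := by
  simp only [dForm, map_sum, map_mul, eval_X, eval_restr, eval_C]

/-- The Euler derivation turns the linear form v into itself, and v vanishes at the point of L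
orthogonal to v. Hence the construction descends to D_0. -/
theorem dForm_eulerDer [Infinite K] (u : Fin 2 → Fin (n + 1) → K) : dForm u (eulerDer K n) = 0 := by
  refine MvPolynomial.funext fun v => ?_
  have : ∑ i, C (v i) * eulerDer K n i = linForm v := rfl
  rw [eval_dForm, this, eval_linForm, dotProduct_linePoint, map_zero]
  ring

/-- The forms of degree `m + 1` that vanish on `Z` and have multiplicity at least `m` along the
subspace given by `u`. -/
def multForms (Z : Finset (Projectivization K (Fin (n + 1) → K))) (u : Fin 2 → Fin (n + 1) → K)
    (m : ℕ) : Submodule K (MvPolynomial (Fin (n + 1)) K) :=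
  piece (projIdeal (Z : Set (Projectivization K (Fin (n + 1) → K))) ⊓ linIdeal (axis u) ^ m) (m + 1)

theorem mem_multForms {Z : Finset (Projectivization K (Fin (n + 1) → K))}
    {u : Fin 2 → Fin (n + 1) → K} {m : ℕ} {f : MvPolynomial (Fin (n + 1)) K} :
    f ∈ multForms Z u m ↔ (∀ p ∈ Z, eval p.rep f = 0) ∧
      f ∈ piece (linIdeal (axis u) ^ m) (m + 1) := by
  constructor
  · intro h
    exact ⟨fun p hp => mem_projIdeal.1 h.1.1 p hp _ (submodule_le_iff.1 le_rfl), h.1.2, h.2⟩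
  · intro h
    exact ⟨⟨mem_projIdeal.2 fun p hp v hv => eval_eq_zero_of_mem_submodule h.2.2 (h.1 p hp) hv,
      h.2.1⟩, h.2.2⟩

/-- At p the value is that of θ(ℓ_p) at the point of L where ℓ_p vanishes, and ℓ_p divides θ(ℓ_p).
Membership in I(Q)^m holds because restrictions to L are binary forms in x and y. -/
theorem dForm_mem_multForms [Infinite K] {Z : Finset (Projectivization K (Fin (n + 1) → K))}
    (u : Fin 2 → Fin (n + 1) → K) {g : Fin (n + 1) → MvPolynomial (Fin (n + 1)) K}
    (hg : g ∈ derModule (dualArrangement Z)) {m : ℕ} (hm : ∀ i, (g i).IsHomogeneous m) :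
    dForm u g ∈ multForms Z u m := by
  refine mem_multForms.2 ⟨fun p hp => ?_, ?_, ?_⟩
  · rw [eval_dForm]
    obtain ⟨c, hc⟩ := mem_derModule_iff.1 hg p hp
    rw [hc, map_mul, eval_linForm, dotProduct_linePoint]
    ring
  · exact Ideal.sum_mem _ fun i _ => Ideal.mul_mem_left _ _ (restr_mem_binForms u (hm i)).1
  · refine IsHomogeneous.sum _ _ _ fun i _ => ?_
    rw [mul_comm]
    exact (restr_isHomogeneous u (hm i)).mul (isHomogeneous_X K i)

/-! ### Lines general for Z, and surjectivity in large degrees. -/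

/-- The line spanned by `u` is general with respect to the arrangement dual to `Z`. -/
def IsGeneralFor (Z : Finset (Projectivization K (Fin (n + 1) → K)))
    (u : Fin 2 → Fin (n + 1) → K) : Prop :=
  (∀ p ∈ Z, u 1 ⬝ᵥ p.rep ≠ 0) ∧ ∀ p ∈ Z, ∀ p' ∈ Z, p ≠ p' →
    (u 0 ⬝ᵥ p'.rep) * (u 1 ⬝ᵥ p.rep) - (u 1 ⬝ᵥ p'.rep) * (u 0 ⬝ᵥ p.rep) ≠ 0

theorem linearIndependent_rep_pair {p p' : Projectivization K (Fin (n + 1) → K)} (h : p ≠ p') :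
    LinearIndependent K ![p.rep, p'.rep] := by
  rw [LinearIndependent.pair_iff' p.rep_nonzero]
  intro a ha
  apply h
  have ha0 : a ≠ 0 := by
    rintro rfl
    exact p'.rep_nonzero (by rw [← ha, zero_smul])
  rw [← p.mk_rep, ← p'.mk_rep, Projectivization.mk_eq_mk_iff']
  exact ⟨a⁻¹, by rw [← ha, inv_smul_smul₀ ha0]⟩

theorem forGeneralPair_dotProduct_ne_zero {v : Fin (n + 1) → K} (hv : v ≠ 0) (j : Fin 2) :
    ForGeneralPair fun u => u j ⬝ᵥ v ≠ 0 := by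
  obtain ⟨i, hi⟩ := Function.ne_iff.1 hv
  refine ⟨∑ i, C (v i) * X (j, i), fun h => hi ?_, fun u _ hu => ?_⟩
  · simpa [Pi.single_apply, Prod.ext_iff] using
      congrArg (eval (Pi.single (M := fun _ => K) (j, i) 1)) h
  · simpa [dotProduct, mul_comm] using hu

theorem forGeneralPair_isGeneralFor (Z : Finset (Projectivization K (Fin (n + 1) → K))) :
    ForGeneralPair (IsGeneralFor Z) := by
  refine ForGeneralPair.and
    (ForGeneralPair.forall_finset Z fun p _ => forGeneralPair_dotProduct_ne_zero p.rep_nonzero 1)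
    (ForGeneralPair.forall_finset Z fun p _ => ForGeneralPair.forall_finset Z fun p' _ => ?_)
  by_cases hpp : p = p'
  · exact ForGeneralPair.of_forall fun u _ h => absurd hpp h
  have key : ∀ (j : Fin 2) (v : Fin (n + 1) → K) (u : Fin 2 → Fin (n + 1) → K),
      eval (fun ij => u ij.1 ij.2) (∑ i, C (v i) * X (j, i) : MvPolynomial (Fin 2 × Fin (n + 1)) K)
        = u j ⬝ᵥ v := fun j v u => by simp [dotProduct, mul_comm]
  refine ⟨(∑ i, C (p'.rep i) * X (0, i)) * (∑ i, C (p.rep i) * X (1, i)) -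
    (∑ i, C (p'.rep i) * X (1, i)) * (∑ i, C (p.rep i) * X (0, i)),
    fun h0 => ?_, fun u _ hu _ => ?_⟩
  · obtain ⟨x, hx⟩ := exists_dotProduct_eq (linearIndependent_rep_pair hpp) ![1, 0]
    obtain ⟨y, hy⟩ := exists_dotProduct_eq (linearIndependent_rep_pair hpp) ![0, 1]
    have hx0 : x ⬝ᵥ p.rep = 1 := hx 0
    have hx1 : x ⬝ᵥ p'.rep = 0 := hx 1
    have hy0 : y ⬝ᵥ p.rep = 0 := hy 0
    have hy1 : y ⬝ᵥ p'.rep = 1 := hy 1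
    have := congrArg (eval fun ij : Fin 2 × Fin (n + 1) =>
      (![y, x] : Fin 2 → Fin (n + 1) → K) ij.1 ij.2) h0
    rw [map_sub, map_mul, map_mul, key, key, key, key, map_zero] at this
    simp [hx0, hx1, hy0, hy1] at this
  · rwa [map_sub, map_mul, map_mul, key, key, key, key] at hu

open Classical in
/-- The product of the linear forms dual to the points of `Z` other than `p`. -/
def cofactor (Z : Finset (Projectivization K (Fin (n + 1) → K)))
    (p : Projectivization K (Fin (n + 1) → K)) : MvPolynomial (Fin (n + 1)) K :=
  ∏ q ∈ Z.erase p, linForm q.rep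

theorem cofactor_isHomogeneous {Z : Finset (Projectivization K (Fin (n + 1) → K))}
    {p : Projectivization K (Fin (n + 1) → K)} (hp : p ∈ Z) :
    (cofactor Z p).IsHomogeneous (Z.card - 1) := by
  classical
  have := IsHomogeneous.prod (Z.erase p) (fun q => linForm q.rep) (fun _ => 1)
    fun q _ => linForm_isHomogeneous q.rep
  rw [Finset.sum_const, Finset.card_erase_of_mem hp, smul_eq_mul, mul_one] at this
  exact this

theorem linForm_dvd_cofactor {Z : Finset (Projectivization K (Fin (n + 1) → K))}
    {p q : Projectivization K (Fin (n + 1) → K)} (hq : q ∈ Z) (hqp : q ≠ p) :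
    linForm q.rep ∣ cofactor Z p := by
  classical
  exact Finset.dvd_prod_of_mem (fun q : Projectivization K (Fin (n + 1) → K) => linForm q.rep)
    (Finset.mem_erase.2 ⟨hqp, hq⟩)

theorem eval_restr_linForm (u : Fin 2 → Fin (n + 1) → K) (w v : Fin (n + 1) → K) :
    eval v (restr u (linForm w)) = (u 0 ⬝ᵥ w) * (u 1 ⬝ᵥ v) - (u 1 ⬝ᵥ w) * (u 0 ⬝ᵥ v) := by
  rw [eval_restr, eval_linForm, dotProduct_linePoint]
  ring

theorem eval_restr_cofactor_of_ne {Z : Finset (Projectivization K (Fin (n + 1) → K))}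
    (u : Fin 2 → Fin (n + 1) → K) {p q : Projectivization K (Fin (n + 1) → K)} (hq : q ∈ Z)
    (hqp : q ≠ p) : eval q.rep (restr u (cofactor Z p)) = 0 := by
  obtain ⟨c, hc⟩ := linForm_dvd_cofactor hq hqp
  rw [hc, map_mul, map_mul, eval_restr_linForm]
  ring

theorem IsGeneralFor.eval_restr_cofactor_ne_zero
    {Z : Finset (Projectivization K (Fin (n + 1) → K))} {u : Fin 2 → Fin (n + 1) → K}
    (h : IsGeneralFor Z u) {p : Projectivization K (Fin (n + 1) → K)} (hp : p ∈ Z) :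
    eval p.rep (restr u (cofactor Z p)) ≠ 0 := by
  classical
  rw [cofactor, map_prod, map_prod, Finset.prod_ne_zero_iff]
  intro q hq
  rw [eval_restr_linForm]
  exact h.2 p hp q (Finset.mem_of_mem_erase hq) (Finset.ne_of_mem_erase hq).symm

/-- Interpolation: the restrictions of the cofactors generate all binary forms of large degree. -/
theorem IsGeneralFor.exists_eq_sum_cofactor [Infinite K]
    {Z : Finset (Projectivization K (Fin (n + 1) → K))} (hZ : Z.Nonempty)
    {u : Fin 2 → Fin (n + 1) → K} (hu : LinearIndependent K u) (h : IsGeneralFor Z u) {m : ℕ}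
    {f : MvPolynomial (Fin (n + 1)) K} (hf : f ∈ binForms u (Z.card - 1 + m)) :
    ∃ b : Z → MvPolynomial (Fin (n + 1)) K, (∀ p, b p ∈ binForms u m) ∧
      f = ∑ p : Z, restr u (cofactor Z p) * b p := by
  -- Binary forms of degree |Z| - 1 have dimension |Z|, so the restricted cofactors, independent by
  -- evaluation at Z, form a basis of them. In higher degrees each monomial in x and y is split into
  -- a factor of degree |Z| - 1 and a factor of degree m.
  have hcard : Fintype.card Z = Module.finrank K (binForms u (Z.card - 1)) := by
    rw [finrank_binForms hu, Fintype.card_coe, Nat.sub_add_cancel hZ.card_pos]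
  let A : Z → binForms u (Z.card - 1) := fun p =>
    ⟨restr u (cofactor Z p), restr_mem_binForms u (cofactor_isHomogeneous p.2)⟩
  have hLI : LinearIndependent K A := by
    rw [Fintype.linearIndependent_iff]
    intro c hc p
    have h1 := congrArg (fun f => eval p.1.rep (Subtype.val f)) hc
    simp only [Submodule.coe_sum, Submodule.coe_smul, map_sum, smul_eval, Submodule.coe_zero,
      map_zero, A] at h1
    rw [Finset.sum_eq_single p (fun q _ hq => by
      rw [eval_restr_cofactor_of_ne u p.2 (fun h => hq (Subtype.ext h.symm)), mul_zero])
      (by simp)] at h1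
    exact (mul_eq_zero.1 h1).resolve_right (h.eval_restr_cofactor_ne_zero p.2)
  have : FiniteDimensional K (binForms u (Z.card - 1)) :=
    inferInstanceAs (FiniteDimensional K (piece _ _))
  have hspan := hLI.span_eq_top_of_card_eq_finrank' hcard
  have hgen : ∀ g ∈ binForms u (Z.card - 1), ∃ c : Z → K,
      g = ∑ p : Z, C (c p) * restr u (cofactor Z p) := by
    intro g hg
    obtain ⟨c, hc⟩ := (Submodule.mem_span_range_iff_exists_fun K).1
      (hspan ▸ Submodule.mem_top : (⟨g, hg⟩ : binForms u (Z.card - 1)) ∈ _)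
    refine ⟨c, ?_⟩
    have := congrArg Subtype.val hc
    simpa [A, smul_eq_C_mul] using this.symm
  obtain ⟨a, rfl⟩ := exists_coeff_of_mem_binForms hf
  have hj : ∀ j : Fin (Z.card - 1 + m + 1), ∃ b : Z → MvPolynomial (Fin (n + 1)) K,
      (∀ p, b p ∈ binForms u m) ∧
      C (a j) * (linForm (u 1) ^ (j : ℕ) * linForm (u 0) ^ (Z.card - 1 + m - j)) =
        ∑ p : Z, restr u (cofactor Z p) * b p := by
    intro j
    obtain ⟨i, i', k, k', hi, hk, hik, hik'⟩ : ∃ i i' k k' : ℕ, i + i' = Z.card - 1 ∧ k + k' = m ∧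
        i + k = j ∧ i' + k' = Z.card - 1 + m - j := by
      rcases le_total (j : ℕ) (Z.card - 1) with hle | hle
      · exact ⟨j, Z.card - 1 - j, 0, m, by omega, by omega, by omega, by omega⟩
      · exact ⟨Z.card - 1, 0, j - (Z.card - 1), m - (j - (Z.card - 1)), by omega, by omega,
          by omega, by omega⟩
    have hg := pow_mul_pow_mem_binForms u i i'
    rw [hi] at hg
    obtain ⟨c, hc⟩ := hgen _ hg
    have hh := pow_mul_pow_mem_binForms u k k'
    rw [hk] at hh
    refine ⟨fun p => (a j * c p) • (linForm (u 1) ^ k * linForm (u 0) ^ k'),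
      fun p => Submodule.smul_mem _ _ hh, ?_⟩
    rw [← hik', ← hik, pow_add, pow_add]
    calc C (a j) * (linForm (u 1) ^ i * linForm (u 1) ^ k * (linForm (u 0) ^ i' * linForm (u 0) ^ k'))
        = (linForm (u 1) ^ i * linForm (u 0) ^ i') *
          (C (a j) * (linForm (u 1) ^ k * linForm (u 0) ^ k')) := by ring
      _ = _ := by
        rw [hc, Finset.sum_mul]
        refine Finset.sum_congr rfl fun p _ => ?_
        beta_reduce
        rw [smul_eq_C_mul, C_mul]
        ring
  choose b hb hbf using hj
  refine ⟨fun p => ∑ j, b j p, fun p => Submodule.sum_mem _ fun j _ => hb j p, ?_⟩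
  simp only [hbf, Finset.mul_sum]
  exact Finset.sum_comm

/-- A form that vanishes at the point of a line orthogonal to `v` is a multiple of the linear form
`v` modulo the ideal of the line. -/
theorem exists_eq_linForm_mul_add [Infinite K] {u : Fin 2 → Fin (n + 1) → K}
    (hu : LinearIndependent K u) {v : Fin (n + 1) → K} (hv : u 1 ⬝ᵥ v ≠ 0) {m : ℕ} (hm : 1 ≤ m)
    {k : MvPolynomial (Fin (n + 1)) K} (hk : k.IsHomogeneous m)
    (h0 : eval (linePoint u v) k = 0) :
    ∃ h r : MvPolynomial (Fin (n + 1)) K, k = linForm v * h + r ∧ r.IsHomogeneous m ∧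
      restr u r = 0 := by
  -- On L the form v vanishes only at multiples of `linePoint u v`, so k vanishes on v^⊥ ∩ L. The
  -- ideal of this intersection is generated by v and the linear forms vanishing on L.
  have hmem : k ∈ linIdeal (perp (Submodule.span K
      (insert v (perp (Submodule.span K (Set.range u)) : Set (Fin (n + 1) → K))))) := by
    rw [mem_linIdeal]
    intro x hx
    rw [mem_perp_span] at hx
    have hxL : x ∈ Submodule.span K (Set.range u) := by
      rw [← perp_perp (Submodule.span K (Set.range u))]
      exact fun w hw => hx w (Set.mem_insert_of_mem _ hw)
    obtain ⟨a, b, rfl⟩ := mem_span_range_fin_two.1 hxL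
    have hxv := hx v (Set.mem_insert _ _)
    rw [dotProduct_add, dotProduct_smul, dotProduct_smul, smul_eq_mul, smul_eq_mul,
      dotProduct_comm, dotProduct_comm v] at hxv
    have : a • u 0 + b • u 1 = (a / (u 1 ⬝ᵥ v)) • linePoint u v := by
      have hb : b = -(a / (u 1 ⬝ᵥ v) * (u 0 ⬝ᵥ v)) := by
        field_simp
        linear_combination hxv
      rw [linePoint, smul_sub, smul_smul, smul_smul, div_mul_cancel₀ _ hv, hb, neg_smul,
        sub_eq_add_neg]
    rw [this, eval_smul_of_isHomogeneous hk, h0, mul_zero]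
  rw [linIdeal_perp_span, Set.image_insert_eq, Ideal.span_insert, Submodule.mem_sup] at hmem
  obtain ⟨y, hy, z, hz, rfl⟩ := hmem
  obtain ⟨h, rfl⟩ := Ideal.mem_span_singleton.1 hy
  obtain ⟨m, rfl⟩ : ∃ m', m = 1 + m' := ⟨m - 1, by omega⟩
  have hz0 : restr u z = 0 := by
    rw [restr_eq_zero_iff hu]
    refine (Ideal.span_le.2 ?_ : Ideal.span _ ≤ _) hz
    rintro _ ⟨w, hw, rfl⟩
    exact linForm_mem_linIdeal.2 hw
  refine ⟨homogeneousComponent m h, homogeneousComponent (1 + m) z, ?_,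
    homogeneousComponent_isHomogeneous _ _, ?_⟩
  · rw [← homogeneousComponent_mul (linForm_isHomogeneous v), ← map_add,
      homogeneousComponent_eq_self hk]
  · rw [← homogeneousComponent_restr, hz0, map_zero]

theorem mem_binForms_sum [Infinite K] {u : Fin 2 → Fin (n + 1) → K} {m : ℕ}
    {f : MvPolynomial (Fin (n + 1)) K} (hf : f ∈ piece (linIdeal (axis u) ^ m) (m + 1)) :
    ∃ c : Fin (n + 1) → MvPolynomial (Fin (n + 1)) K, (∀ i, c i ∈ binForms u m) ∧
      f = ∑ i, X i * c i := by
  rw [← range_powForm] at hf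
  obtain ⟨h, rfl⟩ := hf
  refine ⟨fun i => ∑ j, h j i • (linForm (u 1) ^ (j : ℕ) * linForm (u 0) ^ (m - j)),
    fun i => Submodule.sum_mem _ fun j _ => Submodule.smul_mem _ _ ?_, ?_⟩
  · have := pow_mul_pow_mem_binForms u j (m - j)
    rwa [show (j : ℕ) + (m - j) = m by omega] at this
  · have hl : ∀ j, linForm (h j) = ∑ i, C (h j i) * X i := fun _ => rfl
    simp only [powForm_apply, hl, Finset.mul_sum, Finset.sum_mul]
    rw [Finset.sum_comm]
    refine Finset.sum_congr rfl fun i _ => Finset.sum_congr rfl fun j _ => ?_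
    rw [smul_eq_C_mul]
    ring

/-- Write f = ∑ X_i c_i with binary c_i, expand each c_i in the cofactors and lift the coefficients
to g_{ip}. Vanishing of f at p makes ∑ p_i g_{ip} a multiple of ℓ_p up to a remainder r_p in I(L).
Subtracting w_i r_p with w · p = 1 removes the remainder without changing the restriction to L, and
the corrected family is a derivation of the arrangement. -/
theorem IsGeneralFor.exists_dForm_eq [Infinite K]
    {Z : Finset (Projectivization K (Fin (n + 1) → K))} (hZ : Z.Nonempty)
    {u : Fin 2 → Fin (n + 1) → K} (hu : LinearIndependent K u) (h : IsGeneralFor Z u) {m : ℕ}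
    (hm : Z.card ≤ m) {f : MvPolynomial (Fin (n + 1)) K} (hf : f ∈ multForms Z u m) :
    ∃ g ∈ derModule (dualArrangement Z), (∀ i, (g i).IsHomogeneous m) ∧ dForm u g = f := by
  have hpos := hZ.card_pos
  obtain ⟨M, hM, rfl⟩ : ∃ M, 1 ≤ M ∧ m = Z.card - 1 + M :=
    ⟨m - (Z.card - 1), by omega, by omega⟩
  obtain ⟨hfZ, hf⟩ := mem_multForms.1 hf
  obtain ⟨c, hc, rfl⟩ := mem_binForms_sum hf
  choose b hb hcb using fun i => h.exists_eq_sum_cofactor hZ hu (hc i)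
  choose g hg hgb using fun i p => exists_restr_eq_of_mem_binForms hu (hb i p)
  have hkill : ∀ p : Z, eval (linePoint u p.1.rep) (∑ i, C (p.1.rep i) * g i p) = 0 := by
    intro p
    have h1 := hfZ p p.2
    have h2 : eval p.1.rep (∑ i, X i * c i) = eval p.1.rep (restr u (cofactor Z p)) *
        eval (linePoint u p.1.rep) (∑ i, C (p.1.rep i) * g i p) := by
      simp only [map_sum, map_mul, eval_X, eval_C, Finset.mul_sum]
      refine Finset.sum_congr rfl fun i _ => ?_
      rw [hcb i, map_sum, Finset.sum_eq_single p (fun q _ hq => by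
        rw [map_mul, eval_restr_cofactor_of_ne u p.2 (fun h => hq (Subtype.ext h.symm)), zero_mul])
        (by simp), map_mul, ← hgb, eval_restr _ _ (g i p)]
      ring
    rw [h2] at h1
    exact (mul_eq_zero.1 h1).resolve_left (h.eval_restr_cofactor_ne_zero p.2)
  have hk : ∀ p : Z, (∑ i, C (p.1.rep i) * g i p).IsHomogeneous M := fun p =>
    IsHomogeneous.sum _ _ _ fun i _ => (hg i p).C_mul _
  choose l r hlr hr hr0 using fun p : Z =>
    exists_eq_linForm_mul_add hu (h.1 p p.2) hM (hk p) (hkill p)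
  have hw : ∀ p : Z, ∃ w : Fin (n + 1) → K, w ⬝ᵥ p.1.rep = 1 := by
    intro p
    obtain ⟨w, hw⟩ := exists_dotProduct_eq (b := fun _ : Unit => p.1.rep)
      (linearIndependent_unique_iff.2 p.1.rep_nonzero) fun _ => 1
    exact ⟨w, hw ()⟩
  choose w hw using hw
  refine ⟨fun i => ∑ p : Z, cofactor Z p * (g i p - C (w p i) * r p), ?_, fun i => ?_, ?_⟩
  · rw [mem_derModule_iff]
    intro p hp
    have hsum : ∀ q : Z, ∑ i, C (p.rep i) * (cofactor Z q * (g i q - C (w q i) * r q)) =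
        cofactor Z q * ∑ i, C (p.rep i) * (g i q - C (w q i) * r q) := fun q => by
      rw [Finset.mul_sum]
      exact Finset.sum_congr rfl fun i _ => by ring
    simp only [Finset.mul_sum (s := (Finset.univ : Finset Z))]
    rw [Finset.sum_comm]
    refine Finset.dvd_sum fun q _ => ?_
    rw [hsum]
    by_cases hq : (q : Projectivization K (Fin (n + 1) → K)) = p
    · subst hq
      refine Dvd.dvd.mul_left ?_ _
      have h1 : ∑ i, C (q.1.rep i) * (C (w q i) * r q) = r q := by
        simp only [← mul_assoc, ← C_mul]
        rw [← Finset.sum_mul, ← map_sum]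
        have : ∑ i, q.1.rep i * w q i = 1 := by
          rw [← hw q, dotProduct_comm]; rfl
        rw [this, C_1, one_mul]
      simp only [mul_sub, Finset.sum_sub_distrib]
      rw [h1, hlr q]
      exact ⟨l q, by ring⟩
    · exact Dvd.dvd.mul_right (linForm_dvd_cofactor hp (Ne.symm hq)) _
  · exact IsHomogeneous.sum _ _ _ fun p _ => (cofactor_isHomogeneous p.2).mul
      ((hg i p).sub ((hr p).C_mul _))
  · rw [dForm]
    refine Finset.sum_congr rfl fun i _ => ?_
    rw [hcb i, map_sum]
    congr 1
    refine Finset.sum_congr rfl fun p _ => ?_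
    rw [map_mul, map_sub, map_mul, hr0, mul_zero, sub_zero, hgb]

/-- Moving v along Q does not move its point of L, so a vanishing form makes the vector of the g_i
on L orthogonal to Q, hence equal to α u_0 + β u_1. The remaining relation y α + x β = 0 is a Koszul
relation, α = x γ and β = -y γ, and this is γ times the Euler vector on L. -/
theorem dForm_eq_zero [Infinite K] {u : Fin 2 → Fin (n + 1) → K}
    (hu : LinearIndependent K u) {m : ℕ} {g : Fin (n + 1) → MvPolynomial (Fin (n + 1)) K}
    (hg : ∀ i, (g i).IsHomogeneous (m + 1)) (h : dForm u g = 0) :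
    ∃ γ : MvPolynomial (Fin (n + 1)) K, ∀ i, restr u (g i - γ * X i) = 0 := by
  have hL : ∀ v, (fun i => eval v (restr u (g i))) ∈ Submodule.span K (Set.range u) := by
    intro v
    rw [← perp_perp (Submodule.span K (Set.range u))]
    intro z hz
    have hz0 : ∀ j, u j ⬝ᵥ z = 0 := fun j => mem_perp_span.1 hz _ ⟨j, rfl⟩
    have h1 := congrArg (eval v) h
    have h2 := congrArg (eval (v + z)) h
    have hq : linePoint u (v + z) = linePoint u v := by
      simp only [linePoint, dotProduct_add, hz0, add_zero]
    rw [eval_dForm, map_zero] at h1 h2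
    rw [hq] at h2
    simp only [map_sum, map_mul, eval_C, Pi.add_apply, add_mul, Finset.sum_add_distrib] at h1 h2
    rw [h1, zero_add] at h2
    simp only [eval_restr]
    exact h2
  obtain ⟨x, hx⟩ := exists_dotProduct_eq hu ![1, 0]
  obtain ⟨y, hy⟩ := exists_dotProduct_eq hu ![0, 1]
  have hx0 : x ⬝ᵥ u 0 = 1 := hx 0
  have hx1 : x ⬝ᵥ u 1 = 0 := hx 1
  have hy0 : y ⬝ᵥ u 0 = 0 := hy 0
  have hy1 : y ⬝ᵥ u 1 = 1 := hy 1
  let α := restr u (∑ i, C (x i) * g i)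
  let β := restr u (∑ i, C (y i) * g i)
  have hα : α ∈ binForms u (m + 1) :=
    restr_mem_binForms u (IsHomogeneous.sum _ _ _ fun i _ => (hg i).C_mul _)
  have hdot : ∀ (w v : Fin (n + 1) → K), eval v (restr u (∑ i, C (w i) * g i)) =
      w ⬝ᵥ fun i => eval v (restr u (g i)) := by
    intro w v
    simp only [eval_restr, map_sum, map_mul, eval_C, dotProduct]
  have hc : ∀ i, restr u (g i) = C (u 0 i) * α + C (u 1 i) * β := by
    intro i
    refine MvPolynomial.funext fun v => ?_
    obtain ⟨a, b, hab⟩ := mem_span_range_fin_two.1 (hL v)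
    rw [map_add, map_mul, map_mul, eval_C, eval_C, hdot, hdot, ← hab, ← congrFun hab i]
    simp only [dotProduct_add, dotProduct_smul, hx0, hx1, hy0, hy1, smul_eq_mul, mul_one, mul_zero,
      add_zero, zero_add, Pi.add_apply, Pi.smul_apply]
    ring
  have hrel : linForm (u 0) * α + linForm (u 1) * β = 0 := by
    rw [← h, dForm, linForm, linForm, Finset.sum_mul, Finset.sum_mul, ← Finset.sum_add_distrib]
    refine Finset.sum_congr rfl fun i _ => ?_
    rw [hc]
    ring
  have hdvd : linForm (u 1) ^ 1 ∣ α := pow_dvd_of_mul_eq hu (k := 1) (g := -β) (by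
    linear_combination hrel)
  obtain ⟨γ', hγ', hαγ⟩ := exists_eq_pow_mul hu (m := m) (r := 0) (k := 1) hα hdvd
  obtain ⟨γ, -, hγ⟩ := exists_restr_eq_of_mem_binForms hu hγ'
  have hβ : β = -(linForm (u 0) * γ') := by
    apply mul_left_cancel₀ (prime_linForm_of_linearIndependent hu 1).ne_zero
    rw [hαγ] at hrel
    linear_combination hrel
  refine ⟨γ, fun i => ?_⟩
  have hX : restr u (X i) = C (u 0 i) * linForm (u 1) - C (u 1 i) * linForm (u 0) := by
    rw [restr, aeval_X, sub_eq_add_neg, ← neg_smul, linForm_add, linForm_smul, linForm_smul, C_neg]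
    ring
  rw [map_sub, map_mul, hγ, hc, hX, hαγ, hβ]
  ring

/-! ### The splitting type and forms with multiplicity -/

/-- The derivations of degree `m`. -/
def homDer (Z : Finset (Projectivization K (Fin (n + 1) → K))) (m : ℕ) :
    Submodule K (derModule (dualArrangement Z)) where
  carrier := {θ | ∀ i, (θ.1 i).IsHomogeneous m}
  zero_mem' := fun _ => isHomogeneous_zero _ _ _
  add_mem' := fun hθ hθ' i => (hθ i).add (hθ' i)
  smul_mem' := fun c _ hθ i => (homogeneousSubmodule (Fin (n + 1)) K m).smul_mem c (hθ i)

theorem smul_mem_homDer {Z : Finset (Projectivization K (Fin (n + 1) → K))} {m k : ℕ}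
    {s : MvPolynomial (Fin (n + 1)) K} (hs : s.IsHomogeneous k)
    {θ : derModule (dualArrangement Z)} (hθ : θ ∈ homDer Z m) : s • θ ∈ homDer Z (k + m) :=
  fun i => hs.mul (hθ i)

/-- The class of a derivation in the restriction of the reduced module to a line. -/
def derClass (Z : Finset (Projectivization K (Fin (n + 1) → K)))
    (L : Submodule K (Fin (n + 1) → K)) :
    derModule (dualArrangement Z) →ₗ[MvPolynomial (Fin (n + 1)) K]
      RedDerRestrict (dualArrangement Z) L :=
  Submodule.mkQ _ ∘ₗ Submodule.mkQ _

theorem dForm_eq_zero_of_derClass_eq_zero [Infinite K]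
    {Z : Finset (Projectivization K (Fin (n + 1) → K))} {u : Fin 2 → Fin (n + 1) → K}
    (hu : LinearIndependent K u) {θ : derModule (dualArrangement Z)}
    (h : derClass Z (Submodule.span K (Set.range u)) θ = 0) : dForm u θ.1 = 0 := by
  have hmk : ∀ θ₁ θ₂ : derModule (dualArrangement Z),
      (Submodule.Quotient.mk θ₁ : RedDerModule (dualArrangement Z)) = Submodule.Quotient.mk θ₂ →
        dForm u θ₁.1 = dForm u θ₂.1 := by
    intro θ₁ θ₂ h12
    have h1 : (θ₁ - θ₂).1 ∈ Submodule.span (MvPolynomial (Fin (n + 1)) K) {eulerDer K n} :=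
      (Submodule.Quotient.eq ((Submodule.span (MvPolynomial (Fin (n + 1)) K)
        {eulerDer K n}).submoduleOf (derModule (dualArrangement Z)))).1 h12
    obtain ⟨c, hc⟩ := Submodule.mem_span_singleton.1 h1
    have h2 : θ₁.1 = c • eulerDer K n + θ₂.1 := by
      rw [hc]
      simp
    rw [h2, dForm_add, dForm_smul, dForm_eulerDer, mul_zero, zero_add]
  have h0 : (Submodule.Quotient.mk θ : RedDerModule (dualArrangement Z)) ∈
      linIdeal (Submodule.span K (Set.range u)) •
        (⊤ : Submodule (MvPolynomial (Fin (n + 1)) K) (RedDerModule (dualArrangement Z))) :=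
    (Submodule.Quotient.mk_eq_zero _).1 h
  have key : ∀ y ∈ linIdeal (Submodule.span K (Set.range u)) •
        (⊤ : Submodule (MvPolynomial (Fin (n + 1)) K) (RedDerModule (dualArrangement Z))),
      ∀ θ' : derModule (dualArrangement Z), Submodule.Quotient.mk θ' = y → dForm u θ'.1 = 0 := by
    intro y hy
    refine Submodule.smul_induction_on hy ?_ ?_
    · intro r hr x _ θ' hθ'
      obtain ⟨θ₁, rfl⟩ := Submodule.Quotient.mk_surjective _ x
      rw [← Submodule.Quotient.mk_smul] at hθ'
      rw [hmk _ _ hθ']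
      have : (r • θ₁).1 = r • θ₁.1 := rfl
      rw [this, dForm_smul, (restr_eq_zero_iff hu).2 hr, zero_mul]
    · intro x y hx hy θ' hθ'
      obtain ⟨θ₁, rfl⟩ := Submodule.Quotient.mk_surjective _ x
      obtain ⟨θ₂, rfl⟩ := Submodule.Quotient.mk_surjective _ y
      rw [← Submodule.Quotient.mk_add] at hθ'
      rw [hmk _ _ hθ']
      have : (θ₁ + θ₂).1 = θ₁.1 + θ₂.1 := rfl
      rw [this, dForm_add, hx _ rfl, hy _ rfl, add_zero]
  exact key _ h0 θ rfl

/-- The product of the linear forms dual to the points of `Z`. -/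
def arrForm (Z : Finset (Projectivization K (Fin (n + 1) → K))) : MvPolynomial (Fin (n + 1)) K :=
  ∏ q ∈ Z, linForm q.rep

theorem IsGeneralFor.restr_arrForm_ne_zero {Z : Finset (Projectivization K (Fin (n + 1) → K))}
    {u : Fin 2 → Fin (n + 1) → K} (hu : LinearIndependent K u) (h : IsGeneralFor Z u) :
    restr u (arrForm Z) ≠ 0 := by
  rw [arrForm, map_prod, Finset.prod_ne_zero_iff]
  intro p hp h0
  rw [restr_linForm, ← linForm_zero] at h0
  have h1 := linForm_injective h0
  have := Fintype.linearIndependent_iff.1 hu ![-(u 1 ⬝ᵥ p.rep), u 0 ⬝ᵥ p.rep] (by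
    rw [← h1, Fin.sum_univ_two]
    simp only [Matrix.cons_val_zero, Matrix.cons_val_one, neg_smul]
    abel) 0
  exact h.1 p hp (by simpa using this)

/-- The congruence of θ with γ θ_e modulo I(L) holds only coordinatewise in Der S. Multiplying by
the product of all ℓ_p turns each coordinate derivation into an element of D(𝓐), so the difference
lands in I(L) D(𝓐). Thus the kernel of `dForm` on the restriction is torsion. -/
theorem derClass_arrForm_smul_eq_zero [Infinite K]
    {Z : Finset (Projectivization K (Fin (n + 1) → K))} {u : Fin 2 → Fin (n + 1) → K}
    (hu : LinearIndependent K u) {θ : derModule (dualArrangement Z)}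
    {γ : MvPolynomial (Fin (n + 1)) K} (h : ∀ i, restr u (θ.1 i - γ * X i) = 0) :
    derClass Z (Submodule.span K (Set.range u)) (arrForm Z • θ) = 0 := by
  have hP : ∀ i, arrForm Z • (Pi.single i 1 : Fin (n + 1) → MvPolynomial (Fin (n + 1)) K) ∈
      derModule (dualArrangement Z) := by
    intro i
    rw [mem_derModule_iff]
    intro p hp
    have : linForm p.rep ∣ arrForm Z :=
      Finset.dvd_prod_of_mem (fun q : Projectivization K (Fin (n + 1) → K) => linForm q.rep) hp
    exact Finset.dvd_sum fun j _ => Dvd.dvd.mul_left (Dvd.dvd.mul_right this _) _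
  have he : eulerDer K n ∈ derModule (dualArrangement Z) :=
    mem_derModule_iff.2 fun p _ => dvd_refl (linForm p.rep)
  have hsum : arrForm Z • θ = ∑ i, (θ.1 i - γ * X i) •
      (⟨_, hP i⟩ : derModule (dualArrangement Z)) + (arrForm Z * γ) • ⟨_, he⟩ := by
    apply Subtype.ext
    ext1 j
    simp only [Submodule.coe_smul, Submodule.coe_add, Submodule.coe_sum, Pi.smul_apply,
      Pi.add_apply, Finset.sum_apply, smul_eq_mul, eulerDer]
    rw [Finset.sum_eq_single j (fun i _ hi => by
      rw [Pi.single_eq_of_ne (Ne.symm hi), mul_zero, mul_zero]) (by simp), Pi.single_eq_same]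
    ring
  rw [hsum, map_add, map_sum]
  have h1 : ∀ i, derClass Z (Submodule.span K (Set.range u)) ((θ.1 i - γ * X i) •
      (⟨_, hP i⟩ : derModule (dualArrangement Z))) = 0 := by
    intro i
    refine (Submodule.Quotient.mk_eq_zero _).2 ?_
    rw [map_smul]
    exact Submodule.smul_mem_smul ((restr_eq_zero_iff hu).1 (h i)) Submodule.mem_top
  have h2 : derClass Z (Submodule.span K (Set.range u))
      (⟨_, he⟩ : derModule (dualArrangement Z)) = 0 := by
    have : (Submodule.Quotient.mk (⟨_, he⟩ : derModule (dualArrangement Z)) :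
        RedDerModule (dualArrangement Z)) = 0 :=
      (Submodule.Quotient.mk_eq_zero _).2 (Submodule.mem_span_singleton_self _)
    change Submodule.Quotient.mk (Submodule.Quotient.mk _) = _
    rw [this, Submodule.Quotient.mk_zero]
  rw [map_smul, h2, smul_zero, add_zero]
  exact Finset.sum_eq_zero fun i _ => h1 i

/-- The degree `m` part of `⨁ i, S(-a i)`, for the ring `S` of binary forms given by `u`. -/
def freeForms (u : Fin 2 → Fin (n + 1) → K) (a : Fin n → ℕ) (m : ℕ) :
    Submodule K (Fin n → MvPolynomial (Fin (n + 1)) K) :=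
  Submodule.pi Set.univ fun i => if a i ≤ m then binForms u (m - a i) else ⊥

theorem mem_freeForms {u : Fin 2 → Fin (n + 1) → K} {a : Fin n → ℕ} {m : ℕ}
    {f : Fin n → MvPolynomial (Fin (n + 1)) K} :
    f ∈ freeForms u a m ↔ ∀ i, (a i ≤ m → f i ∈ binForms u (m - a i)) ∧ (m < a i → f i = 0) := by
  simp only [freeForms, Submodule.mem_pi, Set.mem_univ, true_imp_iff]
  refine forall_congr' fun i => ?_
  split_ifs with h
  · simp [h, Nat.not_lt.2 h]
  · simp [h, Nat.not_le.1 h]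

theorem finrank_freeForms [Infinite K] {u : Fin 2 → Fin (n + 1) → K} (hu : LinearIndependent K u)
    (a : Fin n → ℕ) (m : ℕ) : Module.finrank K (freeForms u a m) = ∑ i, (m + 1 - a i) := by
  let p : Fin n → Submodule K (MvPolynomial (Fin (n + 1)) K) :=
    fun i => if a i ≤ m then binForms u (m - a i) else ⊥
  let E : freeForms u a m ≃ₗ[K] ((i : Fin n) → p i) :=
    { toFun := fun w i => ⟨w.1 i, w.2 i trivial⟩
      invFun := fun w => ⟨fun i => (w i).1, fun i _ => (w i).2⟩
      map_add' := fun _ _ => rfl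
      map_smul' := fun _ _ => rfl
      left_inv := fun _ => rfl
      right_inv := fun _ => rfl }
  have hp₁ : ∀ i, a i ≤ m → p i = binForms u (m - a i) := fun i h => if_pos h
  have hp₂ : ∀ i, ¬a i ≤ m → p i = ⊥ := fun i h => if_neg h
  have hfin : ∀ i, FiniteDimensional K (p i) := by
    intro i
    by_cases h : a i ≤ m
    · rw [hp₁ i h]
      exact inferInstanceAs
        (FiniteDimensional K (piece (linIdeal (axis u) ^ (m - a i)) (m - a i)))
    · rw [hp₂ i h]
      infer_instance
  rw [E.finrank_eq, Module.finrank_pi_fintype]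
  refine Finset.sum_congr rfl fun i _ => ?_
  by_cases h : a i ≤ m
  · rw [hp₁ i h, finrank_binForms hu]
    omega
  · rw [hp₂ i h, finrank_bot]
    omega

/-- The `K`-linear map `dForm` on the module of derivations. -/
def dFormLin (Z : Finset (Projectivization K (Fin (n + 1) → K))) (u : Fin 2 → Fin (n + 1) → K) :
    derModule (dualArrangement Z) →ₗ[K] MvPolynomial (Fin (n + 1)) K where
  toFun θ := dForm u θ.1
  map_add' θ θ' := dForm_add u _ _
  map_smul' c θ := by
    have : (c • θ).1 = (C c : MvPolynomial (Fin (n + 1)) K) • θ.1 := by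
      ext1 i
      exact smul_eq_C_mul _ _
    rw [this, dForm_smul, RingHom.id_apply, smul_eq_C_mul, restr, algHom_C, algebraMap_eq]

/-- Large degree makes the map F induced by the splitting injective on classes, so its kernel dies
under `dForm`. Conversely, a class killed by `dForm` is torsion, and the target of F is torsion
free. -/
theorem exists_comparison [Infinite K] {Z : Finset (Projectivization K (Fin (n + 1) → K))}
    {u : Fin 2 → Fin (n + 1) → K} (hu : LinearIndependent K u)
    (hgen : IsGeneralFor Z u) {a : Fin n → ℕ}
    (hs : SplitsOnLine (dualArrangement Z) (Submodule.span K (Set.range u)) a) :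
    ∃ (F : derModule (dualArrangement Z) →ₗ[K] (Fin n → MvPolynomial (Fin (n + 1)) K)) (m₁ : ℕ),
      (∀ s θ, F (s • θ) = restr u s • F θ) ∧
      ∀ m, m₁ ≤ m → (∀ θ ∈ homDer Z m, F θ ∈ freeForms u a m) ∧
        (∀ x ∈ freeForms u a m, ∃ θ ∈ homDer Z m, F θ = x) ∧
        ∀ θ ∈ homDer Z m, (F θ = 0 ↔ dForm u θ.1 = 0) := by
  obtain ⟨φ, -, m₀, hφ⟩ := hs
  let L := Submodule.span K (Set.range u)
  let ρ : (MvPolynomial (Fin (n + 1)) K ⧸ linIdeal L) →+* MvPolynomial (Fin (n + 1)) K :=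
    Ideal.Quotient.lift (linIdeal L) (restr u).toRingHom
      fun f hf => (restr_eq_zero_iff hu).2 hf
  have hρ : ∀ f, ρ (Ideal.Quotient.mk (linIdeal L) f) = restr u f := fun f => rfl
  have hρinj : ∀ x, ρ x = 0 → x = 0 := by
    intro x hx
    obtain ⟨f, rfl⟩ := Ideal.Quotient.mk_surjective x
    rw [hρ, restr_eq_zero_iff hu] at hx
    exact Ideal.Quotient.eq_zero_iff_mem.2 hx
  have hsmul : ∀ (s : MvPolynomial (Fin (n + 1)) K) (θ : derModule (dualArrangement Z)),
      (fun i => ρ (φ (derClass Z L (s • θ)) i)) =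
        restr u s • fun i => ρ (φ (derClass Z L θ) i) := by
    intro s θ
    ext1 i
    rw [map_smul, map_smul, Pi.smul_apply, Pi.smul_apply, smul_eq_mul, ← hρ s, ← map_mul]
    obtain ⟨f, hf⟩ := Ideal.Quotient.mk_surjective (φ (derClass Z L θ) i)
    rw [← hf]
    rfl
  let F : derModule (dualArrangement Z) →ₗ[K] (Fin n → MvPolynomial (Fin (n + 1)) K) :=
    { toFun := fun θ i => ρ (φ (derClass Z L θ) i)
      map_add' := fun θ θ' => by
        ext1 i
        rw [map_add, map_add, Pi.add_apply, Pi.add_apply, map_add]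
      map_smul' := fun c θ => by
        have h1 : c • θ = (C c : MvPolynomial (Fin (n + 1)) K) • θ := by
          apply Subtype.ext
          ext1 i
          exact smul_eq_C_mul _ _
        rw [h1, hsmul, restr, algHom_C, algebraMap_eq, RingHom.id_apply]
        ext1 i
        exact (smul_eq_C_mul _ _).symm }
  -- The degree is kept positive because the description of the kernel of `dForm` divides once by x.
  refine ⟨F, max m₀ 1, hsmul, fun m hm => ⟨fun θ hθ => ?_, fun x hx => ?_, fun θ hθ => ?_⟩⟩
  · have h1 := (hφ m (le_of_max_le_left hm)).mapsTo
      (⟨θ, hθ, rfl⟩ : derClass Z L θ ∈ redDerPiece (dualArrangement Z) L m)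
    rw [mem_freeForms]
    intro i
    refine ⟨fun hi => ?_, fun hi => ?_⟩
    · obtain ⟨f, hf, hfi⟩ := (h1 i).1 hi
      change ρ (φ (derClass Z L θ) i) ∈ _
      rw [hfi, hρ]
      exact restr_mem_binForms u hf
    · change ρ (φ (derClass Z L θ) i) = 0
      rw [(h1 i).2 hi, map_zero]
  · rw [mem_freeForms] at hx
    have hf : ∀ i, ∃ f : MvPolynomial (Fin (n + 1)) K,
        (a i ≤ m → f.IsHomogeneous (m - a i)) ∧ (m < a i → f = 0) ∧ restr u f = x i := by
      intro i
      rcases le_or_gt (a i) m with hi | hi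
      · obtain ⟨f, hf, hfx⟩ := exists_restr_eq_of_mem_binForms hu ((hx i).1 hi)
        exact ⟨f, fun _ => hf, fun h => absurd h (Nat.not_lt.2 hi), hfx⟩
      · exact ⟨0, fun h => absurd hi (Nat.not_lt.2 h), fun _ => rfl,
          by rw [map_zero, (hx i).2 hi]⟩
    choose f hf1 hf2 hf3 using hf
    have hfree : (fun i => Ideal.Quotient.mk (linIdeal L) (f i)) ∈ freePiece L a m :=
      fun i => ⟨fun hi => ⟨f i, hf1 i hi, rfl⟩, fun hi => by
        change Ideal.Quotient.mk (linIdeal L) (f i) = 0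
        rw [hf2 i hi, map_zero]⟩
    obtain ⟨y, ⟨θ, hθ, rfl⟩, hy⟩ := (hφ m (le_of_max_le_left hm)).surjOn hfree
    refine ⟨θ, hθ, ?_⟩
    ext1 i
    change ρ (φ (Submodule.Quotient.mk (Submodule.Quotient.mk θ)) i) = _
    rw [hy]
    exact hf3 i
  · constructor
    · intro h
      refine dForm_eq_zero_of_derClass_eq_zero hu ?_
      refine (hφ m (le_of_max_le_left hm)).injOn ⟨θ, hθ, rfl⟩
        ⟨0, fun i => isHomogeneous_zero _ _ _, by simp⟩ ?_
      rw [map_zero]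
      ext1 i
      exact hρinj _ (congrFun h i)
    · intro h
      obtain ⟨m, rfl⟩ : ∃ m', m = m' + 1 := ⟨m - 1, by have := le_of_max_le_right hm; omega⟩
      obtain ⟨γ, hγ⟩ := dForm_eq_zero hu hθ h
      have h1 := hsmul (arrForm Z) θ
      rw [derClass_arrForm_smul_eq_zero hu hγ, map_zero] at h1
      ext1 i
      have h2 := congrFun h1 i
      rw [Pi.zero_apply, map_zero, Pi.smul_apply, smul_eq_mul] at h2
      exact (mul_eq_zero.1 h2.symm).resolve_left (hgen.restr_arrForm_ne_zero hu)

/-! ### Descent from large degrees to every degree. -/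

/-- Transfer of divisibility between two graded images of the module of derivations. -/
theorem exists_eq_pow_smul_of_transfer [Infinite K]
    {Z : Finset (Projectivization K (Fin (n + 1) → K))}
    {u : Fin 2 → Fin (n + 1) → K} (hu : LinearIndependent K u)
    {M₁ M₂ : Type*} [AddCommGroup M₁] [Module K M₁] [Module (MvPolynomial (Fin (n + 1)) K) M₁]
    [AddCommGroup M₂] [Module K M₂] [Module (MvPolynomial (Fin (n + 1)) K) M₂]
    (f : derModule (dualArrangement Z) →ₗ[K] M₁) (g : derModule (dualArrangement Z) →ₗ[K] M₂)
    (hf : ∀ s θ, f (s • θ) = restr u s • f θ) (hg : ∀ s θ, g (s • θ) = restr u s • g θ)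
    {A₁ : Submodule K M₁} {B₁ : Submodule K M₁} {A₂ B₂ : Submodule K M₂} {m k : ℕ}
    (hsurj : ∀ x ∈ B₁, ∃ θ ∈ homDer Z m, f θ = x)
    (hmaps : ∀ θ ∈ homDer Z m, g θ ∈ B₂)
    (hker : ∀ θ ∈ homDer Z (k + m), f θ = 0 → g θ = 0)
    (hup : ∀ x ∈ A₁, linForm (u 0) ^ k • x ∈ B₁)
    (hsat : ∀ x ∈ B₂, ∀ y ∈ B₂, linForm (u 0) ^ k • x = linForm (u 1) ^ k • y →
      ∃ z ∈ A₂, x = linForm (u 1) ^ k • z)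
    {θ : derModule (dualArrangement Z)} (hθ : θ ∈ homDer Z m) {x : M₁} (hx : x ∈ A₁)
    (h : f θ = linForm (u 1) ^ k • x) : ∃ z ∈ A₂, g θ = linForm (u 1) ^ k • z := by
  obtain ⟨s, t, hs, ht, hs', ht'⟩ := exists_restr_eq hu
  -- Choose θ' over y^k times the given element, and let s and t restrict to x and y. Then t^k θ -
  -- s^k θ' is killed by f, hence by g, so y^k g(θ) = x^k g(θ'). Coprimality of x and y gives
  -- divisibility of g(θ) by x^k.
  obtain ⟨θ', hθ', hfθ'⟩ := hsurj _ (hup x hx)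
  have hmem : t ^ k • θ - s ^ k • θ' ∈ homDer Z (k + m) := by
    refine sub_mem (smul_mem_homDer ?_ hθ) (smul_mem_homDer ?_ hθ')
    · simpa using ht.pow k
    · simpa using hs.pow k
  have h0 := hker _ hmem (by
    rw [map_sub, hf, hf, map_pow, map_pow, hs', ht', h, hfθ', smul_smul, smul_smul, mul_comm,
      sub_self])
  rw [map_sub, hg, hg, map_pow, map_pow, hs', ht', sub_eq_zero] at h0
  exact hsat _ (hmaps θ hθ) _ (hmaps θ' hθ') h0

theorem finrank_map_eq_of_ker_eq {V M₁ M₂ : Type*} [AddCommGroup V] [Module K V] [AddCommGroup M₁]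
    [Module K M₁] [AddCommGroup M₂] [Module K M₂] (f : V →ₗ[K] M₁) (g : V →ₗ[K] M₂)
    (T : Submodule K V) (h : ∀ x ∈ T, f x = 0 ↔ g x = 0) :
    Module.finrank K (T.map f) = Module.finrank K (T.map g) := by
  have hker : LinearMap.ker (f.domRestrict T) = LinearMap.ker (g.domRestrict T) := by
    ext x
    exact h x x.2
  rw [← LinearMap.range_domRestrict, ← LinearMap.range_domRestrict,
    ← (f.domRestrict T).quotKerEquivRange.finrank_eq,
    ← (g.domRestrict T).quotKerEquivRange.finrank_eq, hker]

theorem pow_mul_mem_multForms {Z : Finset (Projectivization K (Fin (n + 1) → K))}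
    [Infinite K] {u : Fin 2 → Fin (n + 1) → K} (i : Fin 2) {e : ℕ} (k : ℕ)
    {f : MvPolynomial (Fin (n + 1)) K} (hf : f ∈ multForms Z u e) :
    linForm (u i) ^ k * f ∈ multForms Z u (e + k) := by
  obtain ⟨h1, h2, h3⟩ := mem_multForms.1 hf
  refine mem_multForms.2 ⟨fun p hp => by rw [map_mul, h1 p hp, mul_zero], ?_, ?_⟩
  · change _ ∈ linIdeal (axis u) ^ (e + k)
    rw [add_comm e k, pow_add]
    refine Ideal.mul_mem_mul (Ideal.pow_mem_pow ?_ k) h2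
    rw [linForm_mem_linIdeal, axis, perp_perp]
    exact Submodule.subset_span ⟨i, rfl⟩
  · have := ((linForm_isHomogeneous (u i)).pow k).mul h3
    rw [show e + k + 1 = 1 * k + (e + 1) by omega]
    exact this

theorem IsGeneralFor.exists_multForms_of_dvd {Z : Finset (Projectivization K (Fin (n + 1) → K))}
    [Infinite K] {u : Fin 2 → Fin (n + 1) → K} (hu : LinearIndependent K u)
    (hgen : IsGeneralFor Z u) {e k : ℕ} {f : MvPolynomial (Fin (n + 1)) K}
    (hf : f ∈ multForms Z u (e + k)) (h : linForm (u 1) ^ k ∣ f) :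
    ∃ g ∈ multForms Z u e, f = linForm (u 1) ^ k * g := by
  obtain ⟨h1, h2⟩ := mem_multForms.1 hf
  obtain ⟨g, hg, rfl⟩ := exists_eq_pow_mul hu (r := 1) h2 h
  refine ⟨g, mem_multForms.2 ⟨fun p hp => ?_, hg⟩, rfl⟩
  have := h1 p hp
  rw [map_mul, map_pow, eval_linForm] at this
  exact (mul_eq_zero.1 this).resolve_left (pow_ne_zero _ (hgen.1 p hp))

theorem pow_smul_mem_freeForms [Infinite K] {u : Fin 2 → Fin (n + 1) → K} (i : Fin 2)
    {a : Fin n → ℕ} {e : ℕ} (k : ℕ) {f : Fin n → MvPolynomial (Fin (n + 1)) K}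
    (hf : f ∈ freeForms u a e) : linForm (u i) ^ k • f ∈ freeForms u a (e + k) := by
  rw [mem_freeForms] at hf ⊢
  intro j
  refine ⟨fun hj => ?_, fun hj => ?_⟩
  · rcases le_or_gt (a j) e with hje | hje
    · obtain ⟨h2, h3⟩ := (hf j).1 hje
      rw [show e + k - a j = k + (e - a j) by omega]
      constructor
      · change _ ∈ linIdeal (axis u) ^ _
        rw [pow_add]
        refine Ideal.mul_mem_mul (Ideal.pow_mem_pow ?_ k) h2
        rw [linForm_mem_linIdeal, axis, perp_perp]
        exact Submodule.subset_span ⟨i, rfl⟩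
      · have := ((linForm_isHomogeneous (u i)).pow k).mul h3
        rwa [one_mul] at this
    · rw [Pi.smul_apply, (hf j).2 hje, smul_zero]
      exact Submodule.zero_mem _
  · rw [Pi.smul_apply, (hf j).2 (by omega), smul_zero]

theorem exists_freeForms_of_dvd [Infinite K] {u : Fin 2 → Fin (n + 1) → K}
    (hu : LinearIndependent K u) {a : Fin n → ℕ} {e k : ℕ}
    {f : Fin n → MvPolynomial (Fin (n + 1)) K} (hf : f ∈ freeForms u a (e + k))
    (h : ∀ i, linForm (u 1) ^ k ∣ f i) :
    ∃ g ∈ freeForms u a e, f = linForm (u 1) ^ k • g := by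
  rw [mem_freeForms] at hf
  have hk := (linForm_isHomogeneous (u 1)).pow k
  rw [one_mul] at hk
  have hex : ∀ i, ∃ g : MvPolynomial (Fin (n + 1)) K,
      (a i ≤ e → g ∈ binForms u (e - a i)) ∧ (e < a i → g = 0) ∧ f i = linForm (u 1) ^ k * g := by
    intro i
    rcases le_or_gt (a i) e with hi | hi
    · have h1 := (hf i).1 (by omega)
      rw [show e + k - a i = e - a i + k by omega] at h1
      obtain ⟨g, hg, hfg⟩ := exists_eq_pow_mul hu (r := 0) h1 (h i)
      exact ⟨g, fun _ => hg, fun h => absurd h (Nat.not_lt.2 hi), hfg⟩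
    · refine ⟨0, fun h => absurd hi (Nat.not_lt.2 h), fun _ => rfl, ?_⟩
      rw [mul_zero]
      rcases le_or_gt (a i) (e + k) with hik | hik
      · exact eq_zero_of_dvd_of_lt hk
          (pow_ne_zero _ (prime_linForm_of_linearIndependent hu 1).ne_zero)
          ((hf i).1 hik).2 (by omega) (h i)
      · exact (hf i).2 hik
  choose g hg1 hg2 hg3 using hex
  exact ⟨g, mem_freeForms.2 fun i => ⟨hg1 i, hg2 i⟩, funext hg3⟩

/-- Multiplication by x^k embeds both degree e pieces into degree e + k. The transfers show that the
same derivations lie over both embedded pieces; as f and F have the same kernel there, the pieces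
have equal dimension. -/
theorem finrank_multForms_of_comparison [Infinite K]
    {Z : Finset (Projectivization K (Fin (n + 1) → K))}
    {u : Fin 2 → Fin (n + 1) → K} (hu : LinearIndependent K u)
    {a : Fin n → ℕ} {e k : ℕ}
    (f : derModule (dualArrangement Z) →ₗ[K] MvPolynomial (Fin (n + 1)) K)
    (F : derModule (dualArrangement Z) →ₗ[K] (Fin n → MvPolynomial (Fin (n + 1)) K))
    (hf2 : ∀ x ∈ multForms Z u (e + k), ∃ θ ∈ homDer Z (e + k), f θ = x)
    (hF2 : ∀ x ∈ freeForms u a (e + k), ∃ θ ∈ homDer Z (e + k), F θ = x)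
    (hF3 : ∀ θ ∈ homDer Z (e + k), (F θ = 0 ↔ f θ = 0))
    (htrans₁ : ∀ θ ∈ homDer Z (e + k), ∀ x ∈ multForms Z u e, f θ = linForm (u 1) ^ k • x →
      ∃ z ∈ freeForms u a e, F θ = linForm (u 1) ^ k • z)
    (htrans₂ : ∀ θ ∈ homDer Z (e + k), ∀ x ∈ freeForms u a e, F θ = linForm (u 1) ^ k • x →
      ∃ z ∈ multForms Z u e, f θ = linForm (u 1) ^ k • z) :
    Module.finrank K (multForms Z u e) = ∑ i, (e + 1 - a i) := by
  have hne : linForm (u 1) ^ k ≠ 0 :=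
    pow_ne_zero _ (prime_linForm_of_linearIndependent hu 1).ne_zero
  obtain ⟨μ₁, hμ₁⟩ : ∃ μ₁ : MvPolynomial (Fin (n + 1)) K →ₗ[K] MvPolynomial (Fin (n + 1)) K,
      ∀ x, μ₁ x = linForm (u 1) ^ k * x := ⟨LinearMap.mulLeft K (linForm (u 1) ^ k), fun _ => rfl⟩
  obtain ⟨μ₂, hμ₂⟩ : ∃ μ₂ : (Fin n → MvPolynomial (Fin (n + 1)) K) →ₗ[K]
      (Fin n → MvPolynomial (Fin (n + 1)) K), ∀ x, μ₂ x = linForm (u 1) ^ k • x :=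
    ⟨LinearMap.pi fun i => μ₁ ∘ₗ LinearMap.proj i, fun x => funext fun i => by
      rw [Pi.smul_apply, smul_eq_mul]
      exact hμ₁ (x i)⟩
  have hμ₁i : Function.Injective μ₁ := fun x y h => by
    rw [hμ₁, hμ₁] at h
    exact mul_left_cancel₀ hne h
  have hμ₂i : Function.Injective μ₂ := fun x y h => by
    rw [hμ₂, hμ₂] at h
    refine funext fun i => mul_left_cancel₀ hne ?_
    simpa only [Pi.smul_apply, smul_eq_mul] using congrFun h i
  have hT₁ : (homDer Z (e + k) ⊓ ((multForms Z u e).map μ₁).comap f).map f =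
      (multForms Z u e).map μ₁ := by
    apply le_antisymm
    · rintro _ ⟨θ, hθ, rfl⟩
      exact hθ.2
    · rintro _ ⟨x, hx, rfl⟩
      obtain ⟨θ, hθ, hθx⟩ := hf2 _ (pow_mul_mem_multForms 1 k hx)
      have h : f θ = μ₁ x := hθx.trans (hμ₁ x).symm
      exact ⟨θ, ⟨hθ, ⟨x, hx, h.symm⟩⟩, h⟩
  have hT₂ : (homDer Z (e + k) ⊓ ((multForms Z u e).map μ₁).comap f).map F =
      (freeForms u a e).map μ₂ := by
    apply le_antisymm
    · rintro _ ⟨θ, ⟨hθ, ⟨x, hx, hxθ⟩⟩, rfl⟩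
      obtain ⟨z, hz, hzθ⟩ := htrans₁ θ hθ x hx (by rw [smul_eq_mul, ← hμ₁, hxθ])
      exact ⟨z, hz, (hμ₂ z).trans hzθ.symm⟩
    · rintro _ ⟨x, hx, rfl⟩
      obtain ⟨θ, hθ, hθx⟩ := hF2 _ (pow_smul_mem_freeForms 1 k hx)
      obtain ⟨z, hz, hzθ⟩ := htrans₂ θ hθ x hx hθx
      exact ⟨θ, ⟨hθ, ⟨z, hz, by rw [hzθ, hμ₁, smul_eq_mul]⟩⟩, by rw [hθx, hμ₂]⟩
  have hfin := finrank_map_eq_of_ker_eq f F _ fun θ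
    (hθ : θ ∈ homDer Z (e + k) ⊓ ((multForms Z u e).map μ₁).comap f) => (hF3 θ hθ.1).symm
  rwa [hT₁, hT₂, ← (Submodule.equivMapOfInjective μ₁ hμ₁i _).finrank_eq,
    ← (Submodule.equivMapOfInjective μ₂ hμ₂i _).finrank_eq, finrank_freeForms hu] at hfin

theorem finrank_multForms_of_splitsOnLine [Infinite K]
    {Z : Finset (Projectivization K (Fin (n + 1) → K))} (hZ : Z.Nonempty)
    {u : Fin 2 → Fin (n + 1) → K} (hu : LinearIndependent K u) (hgen : IsGeneralFor Z u)
    {a : Fin n → ℕ}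
    (hs : SplitsOnLine (dualArrangement Z) (Submodule.span K (Set.range u)) a) (e : ℕ) :
    Module.finrank K (multForms Z u e) = ∑ i, (e + 1 - a i) := by
  obtain ⟨F, m₁, hFs, hF⟩ := exists_comparison hu hgen hs
  obtain ⟨f, hf⟩ : ∃ f : derModule (dualArrangement Z) →ₗ[K] MvPolynomial (Fin (n + 1)) K,
      ∀ θ, f θ = dForm u θ.1 := ⟨dFormLin Z u, fun _ => rfl⟩
  have hfs : ∀ s θ, f (s • θ) = restr u s • f θ := fun s θ => by
    rw [hf, hf, smul_eq_mul]
    exact dForm_smul u s θ.1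
  obtain ⟨k, hk₁, hk₂⟩ : ∃ k, m₁ ≤ k ∧ Z.card ≤ k :=
    ⟨max m₁ Z.card, le_max_left _ _, le_max_right _ _⟩
  obtain ⟨hF1, hF2, hF3⟩ := hF (e + k) (by omega)
  obtain ⟨-, -, hF3'⟩ := hF (k + (e + k)) (by omega)
  have hf1 : ∀ θ ∈ homDer Z (e + k), f θ ∈ multForms Z u (e + k) := fun θ hθ => by
    rw [hf]
    exact dForm_mem_multForms u θ.2 hθ
  have hf2 : ∀ x ∈ multForms Z u (e + k), ∃ θ ∈ homDer Z (e + k), f θ = x := by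
    intro x hx
    obtain ⟨g, hg, hgm, hgx⟩ := hgen.exists_dForm_eq hZ hu (by omega) hx
    exact ⟨⟨g, hg⟩, hgm, (hf _).trans hgx⟩
  have hker : ∀ θ ∈ homDer Z (k + (e + k)), (F θ = 0 ↔ f θ = 0) := fun θ hθ => by
    rw [hf]
    exact hF3' θ hθ
  refine finrank_multForms_of_comparison hu f F hf2 hF2 (fun θ hθ => by rw [hf]; exact hF3 θ hθ)
    (fun θ hθ x hx h => ?_) (fun θ hθ x hx h => ?_)
  · refine exists_eq_pow_smul_of_transfer hu f F hfs hFs hf2 hF1 (fun θ hθ => (hker θ hθ).2)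
      (fun x hx => by rw [smul_eq_mul]; exact pow_mul_mem_multForms 0 k hx)
      (fun x hx y _ hxy => ?_) hθ hx h
    refine exists_freeForms_of_dvd hu hx fun i => pow_dvd_of_mul_eq hu (g := y i) ?_
    simpa only [Pi.smul_apply, smul_eq_mul] using congrFun hxy i
  · refine exists_eq_pow_smul_of_transfer hu F f hFs hfs hF2 hf1 (fun θ hθ => (hker θ hθ).1)
      (fun x hx => pow_smul_mem_freeForms 0 k hx) (fun x hx y _ hxy => ?_) hθ hx h
    rw [smul_eq_mul, smul_eq_mul] at hxy
    obtain ⟨z, hz, hxz⟩ := hgen.exists_multForms_of_dvd hu hx (pow_dvd_of_mul_eq hu hxy)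
    exact ⟨z, hz, by rw [smul_eq_mul, hxz]⟩

/-! ### Irreducible subvarieties and their cones -/

theorem isIrredCone_submodule [Infinite K] (H : Submodule K (Fin (n + 1) → K)) :
    IsIrredCone (H : Set (Fin (n + 1) → K)) := by
  intro f g _ _ _ _ h
  have hfg : f * g ∈ linIdeal H := mem_linIdeal.2 fun v hv => by rw [map_mul, h v hv]
  exact ((linIdeal_isPrime H).mem_or_mem hfg).imp mem_linIdeal.1 mem_linIdeal.1

theorem IsIrredSubvariety.isIrredCone {X : Set (Projectivization K (Fin (n + 1) → K))}
    (hX : IsIrredSubvariety X) : IsIrredCone (cone X) := by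
  intro f g k l hf hg h
  have hclosed : ∀ (f : MvPolynomial (Fin (n + 1)) K) (k : ℕ), f.IsHomogeneous k →
      IsProjClosed {p : Projectivization K (Fin (n + 1) → K) | ∀ v ∈ p.submodule, eval v f = 0} :=
    fun f k hf => ⟨{f}, fun _ h => ⟨k, h ▸ hf⟩, by simp⟩
  have := hX.2.2 _ _ (hclosed f k hf) (hclosed g l hg) fun p hp => by
    rcases mul_eq_zero.1 (h p.rep ⟨p, hp, submodule_le_iff.1 le_rfl⟩) with h0 | h0
    · exact Or.inl fun v hv => eval_eq_zero_of_mem_submodule hf h0 hv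
    · exact Or.inr fun v hv => eval_eq_zero_of_mem_submodule hg h0 hv
  exact this.imp (fun h v ⟨p, hp, hv⟩ => h hp v hv) (fun h v ⟨p, hp, hv⟩ => h hp v hv)

theorem isIrredSubvariety_of_isIrredCone {X : Set (Projectivization K (Fin (n + 1) → K))}
    (hX : IsProjClosed X) (hne : X.Nonempty) (h : IsIrredCone (cone X)) : IsIrredSubvariety X := by
  refine ⟨hX, hne, ?_⟩
  rintro _ _ ⟨F₁, hF₁, rfl⟩ ⟨F₂, hF₂, rfl⟩ hsub
  by_contra! hc
  obtain ⟨h1, h2⟩ := hc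
  obtain ⟨p₁, hp₁, hp₁'⟩ := Set.not_subset.1 h1
  obtain ⟨p₂, hp₂, hp₂'⟩ := Set.not_subset.1 h2
  simp only [Set.mem_ofPred_eq, not_forall] at hp₁' hp₂'
  obtain ⟨f₁, hf₁, v₁, hv₁, hfv₁⟩ := hp₁'
  obtain ⟨f₂, hf₂, v₂, hv₂, hfv₂⟩ := hp₂'
  obtain ⟨k, hk⟩ := hF₁ f₁ hf₁
  obtain ⟨l, hl⟩ := hF₂ f₂ hf₂
  rcases h f₁ f₂ k l hk hl (fun v ⟨p, hp, hv⟩ => by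
    rcases hsub hp with hp | hp
    · rw [hp f₁ hf₁ v hv, zero_mul]
    · rw [hp f₂ hf₂ v hv, mul_zero]) with h0 | h0
  · exact hfv₁ (h0 v₁ ⟨p₁, hp₁, hv₁⟩)
  · exact hfv₂ (h0 v₂ ⟨p₂, hp₂, hv₂⟩)

/-- The points of a linear subspace. -/
def linPoints (H : Submodule K (Fin (n + 1) → K)) : Set (Projectivization K (Fin (n + 1) → K)) :=
  {p | p.submodule ≤ H}

theorem exists_submodule_le {H : Submodule K (Fin (n + 1) → K)} {v : Fin (n + 1) → K} (hv : v ∈ H)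
    (hv0 : v ≠ 0) : ∃ p ∈ linPoints H, v ∈ p.submodule := by
  refine ⟨Projectivization.mk K v hv0, ?_, ?_⟩
  · rw [linPoints, Set.mem_ofPred_eq, Projectivization.submodule_mk]
    exact (Submodule.span_singleton_le_iff_mem _ _).2 hv
  · rw [Projectivization.submodule_mk]
    exact Submodule.mem_span_singleton_self v

theorem cone_linPoints {H : Submodule K (Fin (n + 1) → K)} (hH : H ≠ ⊥) :
    cone (linPoints H) = H := by
  ext v
  constructor
  · rintro ⟨p, hp, hv⟩
    exact hp hv
  · intro hv
    by_cases hv0 : v = 0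
    · obtain ⟨w, hw, hw0⟩ := H.exists_mem_ne_zero_of_ne_bot hH
      obtain ⟨p, hp, -⟩ := exists_submodule_le hw hw0
      exact ⟨p, hp, hv0 ▸ Submodule.zero_mem _⟩
    · exact exists_submodule_le hv hv0

theorem isIrredSubvariety_linPoints [Infinite K] {H : Submodule K (Fin (n + 1) → K)} (hH : H ≠ ⊥) :
    IsIrredSubvariety (linPoints H) := by
  refine isIrredSubvariety_of_isIrredCone
    ⟨{f | ∃ w ∈ perp H, f = linForm w}, ?_, ?_⟩ ?_ (cone_linPoints hH ▸ isIrredCone_submodule H)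
  · rintro _ ⟨w, -, rfl⟩
    exact ⟨1, linForm_isHomogeneous w⟩
  · ext p
    constructor
    · rintro hp _ ⟨w, hw, rfl⟩ v hv
      rw [eval_linForm]
      have := perp_perp H ▸ hp hv
      exact mem_perp.1 this w hw
    · intro hp v hv
      rw [← perp_perp H, mem_perp]
      intro w hw
      rw [← eval_linForm]
      exact hp _ ⟨w, hw, rfl⟩ v hv
  · obtain ⟨v, hv, hv0⟩ := H.exists_mem_ne_zero_of_ne_bot hH
    obtain ⟨p, hp, -⟩ := exists_submodule_le hv hv0
    exact ⟨p, hp⟩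

theorem ncard_inter_linPoints (W : Finset (Projectivization K (Fin (n + 1) → K)))
    (H : Submodule K (Fin (n + 1) → K)) :
    ((W : Set (Projectivization K (Fin (n + 1) → K))) ∩ linPoints H).ncard =
      (pointsIn W H).card := by
  rw [← Set.ncard_coe_finset]
  congr 1
  ext p
  simp [mem_pointsIn, linPoints]

/-! ### Conditions imposed on forms with multiplicity along a general subspace -/

theorem powSpan_cone (u : Fin 2 → Fin (n + 1) → K) (e : ℕ)
    (X : Set (Projectivization K (Fin (n + 1) → K))) :
    powSpan u e (cone X) = Submodule.span K ((fun p => powVec u e p.rep) '' X) := by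
  apply le_antisymm
  · refine Submodule.span_le.2 ?_
    rintro _ ⟨v, ⟨p, hp, hv⟩, rfl⟩
    rw [p.submodule_eq] at hv
    obtain ⟨c, rfl⟩ := Submodule.mem_span_singleton.1 hv
    rw [powVec_smul]
    exact Submodule.smul_mem _ _ (Submodule.subset_span ⟨p, hp, rfl⟩)
  · refine Submodule.span_le.2 ?_
    rintro _ ⟨p, hp, rfl⟩
    exact powVec_mem_powSpan ⟨p, hp, submodule_le_iff.1 le_rfl⟩

theorem cone_mono {X Y : Set (Projectivization K (Fin (n + 1) → K))} (h : X ⊆ Y) :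
    cone X ⊆ cone Y := fun _ ⟨p, hp, hv⟩ => ⟨p, h hp, hv⟩

theorem piece_eq_of_finrank_powSpan_eq [Infinite K] {u : Fin 2 → Fin (n + 1) → K} {e : ℕ}
    {X Y : Set (Projectivization K (Fin (n + 1) → K))} (hXY : X ⊆ Y)
    (h : Module.finrank K (powSpan u e (cone X)) = Module.finrank K (powSpan u e (cone Y))) :
    piece (projIdeal Y ⊓ linIdeal (axis u) ^ e) (e + 1) =
      piece (projIdeal X ⊓ linIdeal (axis u) ^ e) (e + 1) := by
  refine Submodule.eq_of_le_of_finrank_eq (fun f hf => ⟨⟨?_, hf.1.2⟩, hf.2⟩) ?_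
  · exact mem_projIdeal.2 fun p hp => mem_projIdeal.1 hf.1.1 p (hXY hp)
  · have h1 := numConditions_add_finrank (linIdeal (axis u) ^ e) (projIdeal X) (e + 1)
    have h2 := numConditions_add_finrank (linIdeal (axis u) ^ e) (projIdeal Y) (e + 1)
    rw [numConditions_axis] at h1 h2
    omega

theorem finrank_powSpan_cone_eq_of_piece_eq [Infinite K] {u : Fin 2 → Fin (n + 1) → K} {e : ℕ}
    {X Y : Set (Projectivization K (Fin (n + 1) → K))}
    (h : piece (projIdeal Y ⊓ linIdeal (axis u) ^ e) (e + 1) =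
      piece (projIdeal X ⊓ linIdeal (axis u) ^ e) (e + 1)) :
    Module.finrank K (powSpan u e (cone X)) = Module.finrank K (powSpan u e (cone Y)) := by
  have h1 := numConditions_add_finrank (linIdeal (axis u) ^ e) (projIdeal X) (e + 1)
  have h2 := numConditions_add_finrank (linIdeal (axis u) ^ e) (projIdeal Y) (e + 1)
  rw [numConditions_axis] at h1 h2
  rw [h] at h2
  omega

/-- Applied to the whole space, the two rank bounds coincide, and only the zero form vanishes
everywhere; so the number of conditions is the full dimension. -/
theorem forGeneralPair_finrank_piece [Infinite K] (e : ℕ) :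
    ForGeneralPair fun u : Fin 2 → Fin (n + 1) → K =>
      Module.finrank K (piece (linIdeal (axis u) ^ e) (e + 1)) = (e + 1) * n + 1 := by
  have htop : (⊤ : Submodule K (Fin (n + 1) → K)) ≠ ⊥ := top_ne_bot
  have hne : ∃ v ∈ ((⊤ : Submodule K (Fin (n + 1) → K)) : Set (Fin (n + 1) → K)), v ≠ 0 :=
    Submodule.exists_mem_ne_zero_of_ne_bot htop
  refine ((forGeneralPair_le_finrank_powSpan_of_isIrredCone
    (isIrredCone_submodule (⊤ : Submodule K (Fin (n + 1) → K))) hne e).and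
    (forGeneralPair_finrank_powSpan_le htop e)).mono fun u _ hu => ?_
  rw [Submodule.span_eq, finrank_top, Module.finrank_fin_fun, Nat.add_sub_cancel] at hu
  have h1 := numConditions_add_finrank (linIdeal (axis u) ^ e)
    (projIdeal (linPoints (⊤ : Submodule K (Fin (n + 1) → K)))) (e + 1)
  have h2 : piece (projIdeal (linPoints (⊤ : Submodule K (Fin (n + 1) → K))) ⊓
      linIdeal (axis u) ^ e) (e + 1) = ⊥ := by
    refine (Submodule.eq_bot_iff _).2 fun f hf => MvPolynomial.funext fun v => ?_
    have := mem_projIdeal_iff_cone.1 hf.1.1 v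
    rw [cone_linPoints htop] at this
    rw [this trivial, map_zero]
  rw [numConditions_axis, cone_linPoints htop, h2, finrank_bot] at h1
  omega

/-- The relation between the splitting type and the number of conditions that the points impose. -/
theorem IsSplittingType.forGeneralPair_finrank [Infinite K]
    {Z : Finset (Projectivization K (Fin (n + 1) → K))} (hZ : Z.Nonempty) {a : Fin n → ℕ}
    (ha : IsSplittingType (dualArrangement Z) a) (e : ℕ) :
    ForGeneralPair fun u => Module.finrank K (powSpan u e
      (cone (Z : Set (Projectivization K (Fin (n + 1) → K))))) +
      ∑ i, (e + 1 - a i) = (e + 1) * n + 1 := by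
  refine (((forGeneralLine_iff.1 ha.2).and (forGeneralPair_isGeneralFor Z)).and
    (forGeneralPair_finrank_piece e)).mono fun u hu h => ?_
  obtain ⟨⟨h1, h2⟩, h3⟩ := h
  have h4 := finrank_multForms_of_splitsOnLine hZ hu h2 h1 e
  have h5 := numConditions_add_finrank (linIdeal (axis u) ^ e) (projIdeal (Z : Set _)) (e + 1)
  rw [numConditions_axis] at h5
  rw [multForms] at h4
  omega

/-! ### Sparse sets, covers and very unexpected hypersurfaces. -/

theorem card_le_of_linearIndependent_powVec {u : Fin 2 → Fin (n + 1) → K} {e r : ℕ}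
    {B : Finset (Projectivization K (Fin (n + 1) → K))}
    (hB : LinearIndependent K fun p : B => powVec u e p.1.rep) {H : Submodule K (Fin (n + 1) → K)}
    (h : Module.finrank K (powSpan u e (H : Set (Fin (n + 1) → K))) ≤ r) :
    (pointsIn B H).card ≤ r := by
  refine le_trans ?_ h
  let ι : pointsIn B H → B := fun p => ⟨p.1, (mem_pointsIn.1 p.2).1⟩
  have hι : Function.Injective ι := fun p q hpq => Subtype.ext (congrArg (fun x : B => x.1) hpq)
  have h1 := finrank_span_eq_card (hB.comp ι hι)
  rw [Fintype.card_coe] at h1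
  rw [← h1]
  refine Submodule.finrank_mono (Submodule.span_le.2 ?_)
  rintro _ ⟨p, rfl⟩
  exact powVec_mem_powSpan (submodule_le_iff.1 (mem_pointsIn.1 p.2).2)

theorem isSparse_of_forGeneralPair [Infinite K] (hn : 1 ≤ n) {e : ℕ}
    {B : Finset (Projectivization K (Fin (n + 1) → K))}
    (hB : ForGeneralPair fun u => LinearIndependent K fun p : B => powVec u e p.1.rep) :
    IsSparse (e + 1) B := by
  intro H hH
  obtain ⟨u, -, hu, hu'⟩ := (hB.and (forGeneralPair_finrank_powSpan_le hH e)).exists hn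
  exact card_le_of_linearIndependent_powVec hu hu'

theorem exists_maximal_isSparse {d : ℕ} {Z B : Finset (Projectivization K (Fin (n + 1) → K))}
    (hB : IsSparse d B) (hBZ : B ⊆ Z) :
    ∃ W, B ⊆ W ∧ W ⊆ Z ∧ IsSparse d W ∧
      ∀ W', IsSparse d W' → W ⊆ W' → W' ⊆ Z → W' ⊆ W := by
  classical
  obtain ⟨W, hBW, hW⟩ := (Z.powerset.filter (IsSparse d)).exists_le_maximal
    (Finset.mem_filter.2 ⟨Finset.mem_powerset.2 hBZ, hB⟩)
  obtain ⟨hWZ, hWs⟩ := Finset.mem_filter.1 hW.prop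
  exact ⟨W, hBW, Finset.mem_powerset.1 hWZ, hWs, fun W' h1 h2 h3 =>
    hW.le_of_ge (Finset.mem_filter.2 ⟨Finset.mem_powerset.2 h3, h1⟩) h2⟩

theorem finrank_powSpan_cone_le {u : Fin 2 → Fin (n + 1) → K} {e : ℕ}
    {Z : Finset (Projectivization K (Fin (n + 1) → K))} {𝓗 : Finset (Submodule K (Fin (n + 1) → K))}
    (hZ : ∀ p ∈ Z, ∃ H ∈ 𝓗, p.submodule ≤ H) :
    Module.finrank K (powSpan u e (cone (Z : Set (Projectivization K (Fin (n + 1) → K))))) ≤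
      ∑ H ∈ 𝓗, Module.finrank K (powSpan u e (H : Set (Fin (n + 1) → K))) := by
  classical
  have h1 : powSpan u e (cone (Z : Set (Projectivization K (Fin (n + 1) → K)))) ≤
      𝓗.sup fun H : Submodule K (Fin (n + 1) → K) => powSpan u e (H : Set (Fin (n + 1) → K)) := by
    refine Submodule.span_le.2 ?_
    rintro _ ⟨v, ⟨p, hp, hv⟩, rfl⟩
    obtain ⟨H, hH, hpH⟩ := hZ p hp
    exact Finset.le_sup
      (f := fun H : Submodule K (Fin (n + 1) → K) => powSpan u e (H : Set (Fin (n + 1) → K))) hH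
      (powVec_mem_powSpan (hpH hv))
  refine (Submodule.finrank_mono h1).trans ?_
  clear h1 hZ
  induction 𝓗 using Finset.induction_on with
  | empty => simp
  | insert H 𝓗 hH ih =>
    rw [Finset.sup_insert, Finset.sum_insert hH]
    exact (Submodule.finrank_add_le_finrank_add_finrank _ _).trans (Nat.add_le_add_left ih _)

theorem card_le_sum_card_pointsIn {Z : Finset (Projectivization K (Fin (n + 1) → K))}
    {𝓗 : Finset (Submodule K (Fin (n + 1) → K))} (hZ : ∀ p ∈ Z, ∃ H ∈ 𝓗, p.submodule ≤ H) :
    Z.card ≤ ∑ H ∈ 𝓗, (pointsIn Z H).card := by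
  classical
  refine le_trans (Finset.card_le_card fun p hp => ?_) Finset.card_biUnion_le
  obtain ⟨H, hH, hpH⟩ := hZ p hp
  exact Finset.mem_biUnion.2 ⟨H, hH, mem_pointsIn.2 ⟨hp, hpH⟩⟩

theorem IsSparse.card_le_exC {d : ℕ} {W Z : Finset (Projectivization K (Fin (n + 1) → K))}
    (hW : IsSparse d W) (hWZ : W ⊆ Z) : W.card ≤ exC Z d := by
  obtain ⟨𝓗, h0, hcov, hex⟩ := exists_cover_eq_exC Z d
  rw [hex]
  exact (card_le_sum_card_pointsIn fun p hp => hcov p (hWZ hp)).trans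
    (Finset.sum_le_sum fun H hH => hW H (h0 H hH))

theorem le_exC [Infinite K] (hn : 1 ≤ n) {Z : Finset (Projectivization K (Fin (n + 1) → K))}
    {e r : ℕ}
    (hr : ForGeneralPair fun u => Module.finrank K (powSpan u e
      (cone (Z : Set (Projectivization K (Fin (n + 1) → K))))) = r) :
    r ≤ exC Z (e + 1) := by
  obtain ⟨𝓗, h0, hcov, hex⟩ := exists_cover_eq_exC Z (e + 1)
  obtain ⟨u, -, hu, hu'⟩ := (hr.and (ForGeneralPair.forall_finset 𝓗 fun H hH =>
    forGeneralPair_finrank_powSpan_le (h0 H hH) e)).exists hn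
  rw [hex, ← hu]
  exact (finrank_powSpan_cone_le hcov).trans (Finset.sum_le_sum hu')

/-- Condition (II) for linear X makes W sparse, (I) says that W imposes the same r conditions as Z,
and (III) gives r < |W| since W imposes at most |W| conditions on all forms. Sparseness bounds |W|
by the cost of any cover. -/
theorem AdmitsVeryUnexpected.lt_exC [Infinite K] (hn : 1 ≤ n)
    {Z : Finset (Projectivization K (Fin (n + 1) → K))} {e r : ℕ}
    (h : AdmitsVeryUnexpected Z (e + 1))
    (hr : ForGeneralPair fun u => Module.finrank K (powSpan u e
      (cone (Z : Set (Projectivization K (Fin (n + 1) → K))))) = r) :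
    r < exC Z (e + 1) := by
  obtain ⟨W, hWZ, h1, h2, h3⟩ := h
  rw [Nat.add_sub_cancel] at h1 h2 h3
  have hsparse : IsSparse (e + 1) W := by
    intro H hH
    obtain ⟨u, -, hu, hu'⟩ := ((forGeneralCodimTwo_iff.1
      (h2 _ (isIrredSubvariety_linPoints hH))).and
        (forGeneralPair_finrank_powSpan_le hH e)).exists hn
    rw [ncard_inter_linPoints, ← axis, numConditions_axis, cone_linPoints hH] at hu
    exact hu.trans hu'
  obtain ⟨u, -, ⟨hu1, hu3⟩, hur⟩ := (((forGeneralCodimTwo_iff.1 h1).and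
    (forGeneralCodimTwo_iff.1 h3)).and hr).exists hn
  rw [← axis] at hu1 hu3
  rw [numConditions_axis, finrank_powSpan_cone_eq_of_piece_eq hu1, hur] at hu3
  exact hu3.trans_le ((numConditions_top_le_card W _).trans (hsparse.card_le_exC hWZ))

theorem exists_basis_powSpan_cone {Z : Finset (Projectivization K (Fin (n + 1) → K))}
    (u : Fin 2 → Fin (n + 1) → K) (e : ℕ) :
    ∃ B ⊆ Z, (LinearIndependent K fun p : B => powVec u e p.1.rep) ∧
      B.card = Module.finrank K (powSpan u e
        (cone (Z : Set (Projectivization K (Fin (n + 1) → K))))) := by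
  obtain ⟨b, hbZ, -, hspan, hLI⟩ := exists_linearIndepOn_extension
    (v := fun p : Projectivization K (Fin (n + 1) → K) => powVec u e p.rep)
    (linearIndepOn_empty K _) (Set.empty_subset (Z : Set _))
  obtain ⟨B, rfl⟩ := (Z.finite_toSet.subset hbZ).exists_finset_coe
  have hLI' : LinearIndependent K fun p : B => powVec u e p.1.rep := hLI
  refine ⟨B, Finset.coe_subset.1 hbZ, hLI', ?_⟩
  have h1 := finrank_span_eq_card hLI'
  rw [Fintype.card_coe] at h1
  rw [← h1, powSpan_cone]
  refine congrArg (fun U : Submodule K _ => Module.finrank K U) (le_antisymm ?_ ?_)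
  · refine Submodule.span_mono ?_
    rintro _ ⟨p, rfl⟩
    exact ⟨p.1, hbZ p.2, rfl⟩
  · refine Submodule.span_le.2 (hspan.trans ?_)
    rw [Set.image_eq_range]
    exact subset_rfl

/-- An irreducible X imposes, for general Q, at least the bound attached to its linear span, so
sparseness in that span is enough. -/
theorem IsSparse.ncard_inter_le [Infinite K] {e : ℕ}
    {W : Finset (Projectivization K (Fin (n + 1) → K))} (hW : IsSparse (e + 1) W)
    {X : Set (Projectivization K (Fin (n + 1) → K))} (hX : IsIrredSubvariety X) :
    ForGeneralPair fun u => ((W : Set (Projectivization K (Fin (n + 1) → K))) ∩ X).ncard ≤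
      numConditions (linIdeal (axis u) ^ e) (projIdeal X) (e + 1) := by
  obtain ⟨p, hp⟩ := hX.2.1
  have hne : ∃ v ∈ cone X, v ≠ 0 :=
    ⟨p.rep, ⟨p, hp, submodule_le_iff.1 le_rfl⟩, p.rep_nonzero⟩
  have hbot : Submodule.span K (cone X) ≠ ⊥ := by
    obtain ⟨v, hv, hv0⟩ := hne
    exact fun h => hv0 ((Submodule.mem_bot K).1 (h ▸ Submodule.subset_span hv))
  refine (forGeneralPair_le_finrank_powSpan_of_isIrredCone hX.isIrredCone hne e).mono
    fun u _ hu => ?_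
  rw [numConditions_axis]
  refine le_trans (le_trans ?_ (hW _ hbot)) hu
  rw [← Set.ncard_coe_finset]
  refine Set.ncard_le_ncard (fun q hq => ?_) (Finset.finite_toSet _)
  refine mem_pointsIn.2 ⟨hq.1, fun v hv => Submodule.subset_span ⟨q, hq.2, hv⟩⟩

/-- The points B are a basis for one pair u₀, but their independence is open, so B is sparse and
generically already imposes all r conditions. Any W between B and Z then gives (I), while maximality
of W gives |W| ≥ Ex.C(Z, d) > r, hence (III). -/
theorem admitsVeryUnexpected_of_lt_exC [Infinite K] (hn : 1 ≤ n)
    {Z : Finset (Projectivization K (Fin (n + 1) → K))} {e r : ℕ}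
    (hr : ForGeneralPair fun u => Module.finrank K (powSpan u e
      (cone (Z : Set (Projectivization K (Fin (n + 1) → K))))) = r)
    (h : r < exC Z (e + 1)) : AdmitsVeryUnexpected Z (e + 1) := by
  obtain ⟨u₀, -, hu₀⟩ := hr.exists hn
  obtain ⟨B, hBZ, hLI, hcard⟩ := exists_basis_powSpan_cone (Z := Z) u₀ e
  have hB := forGeneralPair_linearIndependent_powVec hLI
  obtain ⟨W, hBW, hWZ, hW, hmax⟩ :=
    exists_maximal_isSparse (isSparse_of_forGeneralPair hn hB) hBZ
  have hWr : ForGeneralPair fun u => Module.finrank K (powSpan u e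
      (cone (W : Set (Projectivization K (Fin (n + 1) → K))))) = r ∧
      Module.finrank K (powSpan u e
        (cone (Z : Set (Projectivization K (Fin (n + 1) → K))))) = r := by
    refine (hB.and hr).mono fun u _ hu => ⟨le_antisymm ?_ ?_, hu.2⟩
    · rw [← hu.2]
      exact Submodule.finrank_mono (powSpan_mono (cone_mono (Finset.coe_subset.2 hWZ)))
    · have h1 := finrank_span_eq_card hu.1
      rw [Fintype.card_coe, hcard, hu₀] at h1
      rw [← h1]
      refine Submodule.finrank_mono (Submodule.span_le.2 ?_)
      rintro _ ⟨p, rfl⟩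
      exact powVec_mem_powSpan ⟨p.1, hBW p.2, submodule_le_iff.1 le_rfl⟩
  refine ⟨W, hWZ, ?_, fun X hX => ?_, ?_⟩
  · rw [Nat.add_sub_cancel, forGeneralCodimTwo_iff]
    refine hWr.mono fun u _ hu => ?_
    exact piece_eq_of_finrank_powSpan_eq (Finset.coe_subset.2 hWZ) (hu.1.trans hu.2.symm)
  · rw [Nat.add_sub_cancel, forGeneralCodimTwo_iff]
    exact hW.ncard_inter_le hX
  · rw [Nat.add_sub_cancel, forGeneralCodimTwo_iff]
    refine hWr.mono fun u _ hu => ?_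
    rw [← axis, numConditions_axis, hu.1, hW.numConditions_top]
    exact h.trans_le (exC_le_card_of_maximal hW hmax hWZ)

/-! ### Degree zero -/

theorem exC_zero {Z : Finset (Projectivization K (Fin (n + 1) → K))} (hZ : Z.Nonempty) :
    exC Z 0 = 1 := by
  apply le_antisymm
  · refine (exC_le (𝓗 := {⊤}) (by simp) (by simp)).trans (by simp)
  · obtain ⟨𝓗, -, hcov, hex⟩ := exists_cover_eq_exC Z 0
    obtain ⟨p, hp⟩ := hZ
    obtain ⟨H, hH, -⟩ := hcov p hp
    rw [hex]
    simpa [Nat.one_le_iff_ne_zero] using Finset.ne_empty_of_mem hH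

/-- The multiplicity is the truncated 0 - 1 = 0, so I(Q)^0 is the whole ring and (III) compares a
number with itself. -/
theorem not_admitsVeryUnexpected_zero [Infinite K] (hn : 1 ≤ n)
    (Z : Finset (Projectivization K (Fin (n + 1) → K))) : ¬ AdmitsVeryUnexpected Z 0 := by
  rintro ⟨W, -, -, -, h3⟩
  obtain ⟨u, -, hu⟩ := (forGeneralCodimTwo_iff.1 h3).exists hn
  rw [Nat.zero_sub, pow_zero, Ideal.one_eq_top] at hu
  exact lt_irrefl _ hu

theorem sum_max_eq (a : Fin n → ℕ) (d : ℕ) :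
    ∑ i, max 0 ((d : ℤ) - a i) = ((∑ i, (d - a i) : ℕ) : ℤ) := by
  rw [Nat.cast_sum]
  exact Finset.sum_congr rfl fun i _ => by omega

end

end PointConfig

end

/-! ### Assembly of the theorem. -/

theorem theorem5p27 {K : Type*} [Field K] [IsAlgClosed K] {n : ℕ} (hn : 1 ≤ n)
    (Z : Finset (Projectivization K (Fin (n + 1) → K))) (hZ : Z.Nonempty)
    (a : Fin n → ℕ)
    (ha : PointConfig.IsSplittingType (PointConfig.dualArrangement Z) a) (d : ℕ) :
    ((n : ℤ) * d + 1 - PointConfig.exC Z d ≤ ∑ i, max 0 ((d : ℤ) - a i)) ∧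
    ((n : ℤ) * d + 1 - PointConfig.exC Z d < ∑ i, max 0 ((d : ℤ) - a i) ↔
      PointConfig.AdmitsVeryUnexpected Z d) := by
  have : Infinite K := IsAlgClosed.instInfinite
  rw [PointConfig.sum_max_eq]
  cases d with
  | zero =>
    -- In degree zero each subspace costs 1, so both sides of the inequality are 0.
    rw [PointConfig.exC_zero hZ]
    simp [PointConfig.not_admitsVeryUnexpected_zero hn Z]
  | succ e =>
    have hgen := ha.forGeneralPair_finrank hZ e
    obtain ⟨u₀, -, hu₀⟩ := hgen.exists hn
    generalize hr : Module.finrank K (PointConfig.powSpan u₀ e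
      (PointConfig.cone (Z : Set (Projectivization K (Fin (n + 1) → K))))) = r at hu₀
    -- The identity rank + ∑ (e + 1 - a_i) = (e + 1) n + 1 fixes the generic rank, so its value at
    -- one general pair is its value at all of them.
    have hr' := hgen.mono (P' := fun u => Module.finrank K
      (PointConfig.powSpan u e
        (PointConfig.cone (Z : Set (Projectivization K (Fin (n + 1) → K))))) = r)
      fun u _ hu => by omega
    have h1 := PointConfig.le_exC hn hr'
    have hcast : ((r : ℤ)) + ((∑ i, (e + 1 - a i) : ℕ) : ℤ) = (n : ℤ) * (e + 1 : ℕ) + 1 := by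
      rw [mul_comm (n : ℤ)]
      exact_mod_cast hu₀
    refine ⟨by omega, fun h => ?_, fun h => ?_⟩
    · exact PointConfig.admitsVeryUnexpected_of_lt_exC hn hr' (by omega)
    · have h2 := h.lt_exC hn hr'
      omega
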